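/- **Setting.** Let $\alpha<0$. Let $\mathcal S$ be the set of sequences $s_1\ge s_2\ge\dots\ge 0$ with $\sum_i s_i<\infty$, with the $\ell_1$-distance, let $\mathcal S_1=\{\mathbf s\in\mathcal S:\sum_i s_i=1\}$, $\mathbf 1=(1,0,0,\dots)$ and $\mathbf 0=(0,0,\dots)$, and let $\nu$ be a probability measure on $\mathcal S_1$ with $\nu(\{\mathbf 1\})=0$. Let $F$ be the fragmentation process with index $\alpha$ and dislocation measure $\nu$ started from $\mathbf 1$, together with its genealogy: the blocks evolve independently, and a block of mass $m>0$ lives for an exponential time of mean $m^{-\alpha}$ and then splits into blocks of masses $m\mathbf S$, where $\mathbf S$ has law $\nu$. The state $F(t)$ is the decreasing rearrangement (written $\{\cdot\}^{\downarrow}$, padded with zeros) of the masses of the blocks present at time $t$. Let $\zeta=\inf\{t\ge0:F(t)=\mathbf 0\}$, which is a.s. finite. Almost surely, for each $t<\zeta$ exactly one block present at time $t$ is the last to be reduced to dust, i.e. has descendants up to time $\zeta$. Let $F_*(t)$ be the mass of that block, and $F_*(t)=0$ for $t\ge\zeta$. Let $T_0=0$ and $T_n=\inf\{t\ge T_{n-1}:F_*(t)<F_*(T_{n-1})\}$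 for $n\ge1$. Put $Z_n=F_*(T_n)^\alpha(\zeta-T_n)$ for $n\ge 0$, $\Theta_0=1$, $\mathbf\Delta_0=\mathbf 0$, $Y_0=\zeta^{1/\alpha}$ and, for $n\ge1$, $\Theta_n=F_*(T_n)/F_*(T_{n-1})$ and $Y_n=\big((\zeta-T_n)/(\zeta-T_{n-1})\big)^{1/\alpha}$; let $\mathbf\Delta_n=(\Delta_{n,1}\ge\Delta_{n,2}\ge\dots)$ be the masses, divided by $F_*(T_{n-1})$, of the other sub-blocks produced by the split of the last fragment at time $T_n$. For $\epsilon>0$ let $N_\epsilon=\sup\{n\ge0:T_n\le\zeta-\epsilon\}$, with $\sup\emptyset=-\infty$, and, when $N_\epsilon\ne-\infty$, let $R_\epsilon(k)=\epsilon^{-1}\prod_{j=0}^{N_\epsilon+k}Y_j^\alpha$ for integers $k\ge-N_\epsilon$. For $x\in(0,\infty)$, denote by $\bar F^{(x)}$ the time-reversal of a fragmentation conditioned to become extinct before time $x$: it has làdcàg (left-continuous with right limits) paths in $\mathcal S$, with $\bar F^{(x)}(0)=\mathbf 0$ and $\bar F^{(x)}(x)=\mathbf 1$, and $(\bar F^{(x)}(t),t\ge0)$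 has the law of $\big(F(x-t)\,\mathbb 1_{\{t\le x\}},\,t\ge0\big)$ conditional on $\zeta<x$ (so that $\bar F^{(x)}(t)=\mathbf 0$ for $t>x$). **Proposition (spine decomposition).** Fix $\epsilon>0$. The sequence $(Z_n,\Theta_n,\mathbf\Delta_n)_{n\ge0}$ is a random variable, and almost surely $N_\epsilon<\infty$, and $N_\epsilon\ne-\infty$ if and only if $\epsilon\le\zeta$. There is a collection of processes $\bar F_{i,m}$, $i\in\mathbb Z$, $m\ge1$, defined on the same probability space as $F$, with the following two properties. 1. Consider the indices with $N_\epsilon\neq-\infty$, $i\ge-N_\epsilon+1$ and $\Delta_{N_\epsilon+i,m}>0$. Conditionally on $(Z_n,\Theta_n,\mathbf\Delta_n)_{n\ge0}$, the corresponding processes $\bar F_{i,m}$ are independent, and $\bar F_{i,m}$ is distributed as $\bar F^{(x)}$ with $x=\Delta_{N_\epsilon+i,m}^{\alpha}\,\Theta_{N_\epsilon+i}^{-\alpha}\,Z_{N_\epsilon+i}$; we therefore write it $\bar F_{i,m}^{(\Delta_{N_\epsilon+i,m}^{\alpha}\Theta_{N_\epsilon+i}^{-\alpha}Z_{N_\epsilon+i})}$.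 2. Almost surely on the event $\{N_\epsilon\ne-\infty\}=\{\epsilon\le\zeta\}$, for every $t$ with $0<t\le\zeta/\epsilon$ there is a unique integer $k\ge-N_\epsilon$ with $R_\epsilon(k)\ge t>R_\epsilon(k+1)$, and $$F(\zeta-\epsilon t)=\Big\{\prod_{j=0}^{N_\epsilon+k}\Theta_j,\ \Big(\prod_{j=0}^{N_\epsilon+i-1}\Theta_j\Big)\Delta_{N_\epsilon+i,m}\,\bar F_{i,m}^{(\Delta_{N_\epsilon+i,m}^{\alpha}\Theta_{N_\epsilon+i}^{-\alpha}Z_{N_\epsilon+i})}\Big(t\,\epsilon\Big(\prod_{j=0}^{N_\epsilon+i-1}\Theta_j\Big)^{\alpha}\Delta_{N_\epsilon+i,m}^{\alpha}\Big):\ m\ge1,\ -N_\epsilon+1\le i\le k\Big\}^{\downarrow},$$ where a term with $\Delta_{N_\epsilon+i,m}=0$ is read as $\mathbf 0$. -/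

import Mathlib

open MeasureTheory ProbabilityTheory Filter Topology
open scoped NNReal ENNReal

noncomputable section

namespace Fragmentation

/-! ### Mass sequences -/

/-- `s` belongs to the state space of the fragmentation: a non-increasing, non-negative, summable
sequence. Sequences are indexed from `0`, so that `s 0` is the largest mass. -/
def IsMassSeq (s : ℕ → ℝ) : Prop :=
  Antitone s ∧ (∀ i, 0 ≤ s i) ∧ Summable s

/-- The mass sequences of total mass one. Its σ-algebra is the one generated by the coordinates,
which on summable sequences is the Borel σ-algebra of the `ℓ¹`-distance. -/
abbrev UnitMassSeq : Type := {s : ℕ → ℝ // IsMassSeq s ∧ ∑' i, s i = 1}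

/-- The state `(1, 0, 0, …)`. -/
def oneState : ℕ → ℝ := Pi.single 0 1

/-- The `ℓ¹`-distance. -/
def l1Dist (s s' : ℕ → ℝ) : ℝ := ∑' i, |s i - s' i|

/-- The decreasing rearrangement of a family of non-negative numbers (of which only finitely many
exceed any given positive level), padded with zeros: its term of index `k` is the smallest level
`y ≥ 0` that is exceeded by at most `k` members of the family. -/
def decRearr {ι : Type*} (a : ι → ℝ) (k : ℕ) : ℝ :=
  sInf {y : ℝ | 0 ≤ y ∧ {i | y < a i}.encard ≤ (k : ℕ∞)}

/-! ### The fragmentation, with its genealogy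

Blocks are labelled by finite words of natural numbers; the `i`-th sub-block of block `u` is
`i :: u`, so that `v` descends from `u` (or is `u`) exactly when `u` is a suffix of `v`.
Block `u` carries a standard exponential clock `(x u).1` and the sequence `(x u).2` of the
relative masses of its sub-blocks. -/

/-- A realization of all clocks and all dislocations. -/
abbrev Realization : Type := List ℕ → ℝ × UnitMassSeq

/-- The mass of a block. -/
def mass (x : Realization) : List ℕ → ℝ
  | [] => 1
  | i :: u => mass x u * ((x u).2 : ℕ → ℝ) i

/-- The time at which a block appears: the block `u` lives for a time `m ^ (-α)` times its clock,
`m` being its mass, and is then replaced by its sub-blocks. -/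
def birth (α : ℝ) (x : Realization) : List ℕ → ℝ
  | [] => 0
  | _ :: u => birth α x u + mass x u ^ (-α) * (x u).1

/-- The time at which a block splits. -/
def death (α : ℝ) (x : Realization) (u : List ℕ) : ℝ :=
  birth α x u + mass x u ^ (-α) * (x u).1

/-- The block `u` is present at time `t`. -/
def Alive (α : ℝ) (x : Realization) (t : ℝ) (u : List ℕ) : Prop :=
  0 < mass x u ∧ birth α x u ≤ t ∧ t < death α x u

/-- The state `F(t)` of the fragmentation started from `(1, 0, …)`. -/
def frag (α : ℝ) (x : Realization) (t : ℝ) : ℕ → ℝ :=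
  decRearr fun u : {u // Alive α x t u} => mass x u

/-- The extinction time `ζ`. -/
def extinction (α : ℝ) (x : Realization) : ℝ :=
  sInf {t | 0 ≤ t ∧ frag α x t = 0}

/-- The state, at time `t + s`, of the fragmentation of the block `u` present at time `t`. -/
def subFrag (α : ℝ) (x : Realization) (t : ℝ) (u : List ℕ) (s : ℝ) : ℕ → ℝ :=
  decRearr fun v : {v // u <:+ v ∧ Alive α x (t + s) v} => mass x v

/-- The time, counted from `t`, at which the block `u` present at time `t` is reduced to dust. -/
def subExtinction (α : ℝ) (x : Realization) (t : ℝ) (u : List ℕ) : ℝ :=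
  sInf {s | 0 ≤ s ∧ subFrag α x t u s = 0}

/-! ### The last fragment and its Markov chain -/

/-- Among the blocks present at time `t`, the block `u` is a last one to be reduced to dust. -/
def IsLast (α : ℝ) (x : Realization) (t : ℝ) (u : List ℕ) : Prop :=
  Alive α x t u ∧ ∀ v, Alive α x t v → subExtinction α x t v ≤ subExtinction α x t u

/-- At each time before extinction exactly one block is the last to be reduced to dust. -/
def LastWellDefined (α : ℝ) (x : Realization) : Prop :=
  ∀ t, 0 ≤ t → t < extinction α x → ∃! u, IsLast α x t u

open Classical in
/-- The label of the last fragment at time `t`. -/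
def lastLabel (α : ℝ) (x : Realization) (t : ℝ) : List ℕ :=
  if h : ∃ u, IsLast α x t u then h.choose else []

open Classical in
/-- The last fragment process `F_*`. -/
def lastFrag (α : ℝ) (x : Realization) (t : ℝ) : ℝ :=
  if LastWellDefined α x ∧ t < extinction α x then mass x (lastLabel α x t) else 0

/-- The times `T_n` at which the last fragment splits, with `T_0 = 0`. -/
def splitTime (α : ℝ) (x : Realization) : ℕ → ℝ
  | 0 => 0
  | n + 1 => sInf {t | splitTime α x n ≤ t ∧ lastFrag α x t < lastFrag α x (splitTime α x n)}

/-- `Z_n = F_*(T_n) ^ α * (ζ - T_n)`. -/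
def chainZ (α : ℝ) (x : Realization) (n : ℕ) : ℝ :=
  lastFrag α x (splitTime α x n) ^ α * (extinction α x - splitTime α x n)

/-- `Θ_0 = 1` and `Θ_n = F_*(T_n) / F_*(T_{n-1})`. -/
def chainΘ (α : ℝ) (x : Realization) : ℕ → ℝ
  | 0 => 1
  | n + 1 => lastFrag α x (splitTime α x (n + 1)) / lastFrag α x (splitTime α x n)

/-- The masses of the siblings of a block, in their order (which is non-increasing). -/
def siblingMass (x : Realization) : List ℕ → ℕ → ℝ
  | [], _ => 0
  | i :: u, m => mass x ((if m < i then m else m + 1) :: u)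

/-- `Δ_0 = (0, 0, …)`, and `Δ_n` is the sequence of the relative masses of the other sub-blocks
that result from the split of the last fragment at time `T_n`. Indexed from `m = 0`. -/
def chainΔ (α : ℝ) (x : Realization) : ℕ → ℕ → ℝ
  | 0, _ => 0
  | n + 1, m =>
    siblingMass x (lastLabel α x (splitTime α x (n + 1))) m / lastFrag α x (splitTime α x n)

/-- The chain `(Z_n, Θ_n, Δ_n)_{n ≥ 0}`. -/
def chain (α : ℝ) (x : Realization) : ℕ → ℝ × ℝ × (ℕ → ℝ) :=
  fun n => (chainZ α x n, chainΘ α x n, chainΔ α x n)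

/-- `Y_0 = ζ ^ (1/α)` and `Y_n = ((ζ - T_n) / (ζ - T_{n-1})) ^ (1/α)`. -/
def chainY (α : ℝ) (x : Realization) : ℕ → ℝ
  | 0 => extinction α x ^ (1 / α)
  | n + 1 => ((extinction α x - splitTime α x (n + 1)) /
      (extinction α x - splitTime α x n)) ^ (1 / α)

/-! ### Re-centering -/

/-- `N_ε = sup {n ≥ 0 : ζ - ε ≥ T_n}`, where `⊥ = -∞` is the supremum of the empty set. -/
def Neps (α : ℝ) (x : Realization) (ε : ℝ) : WithBot ℕ∞ :=
  sSup ((fun n : ℕ => ((n : ℕ∞) : WithBot ℕ∞)) '' {n | splitTime α x n ≤ extinction α x - ε})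

/-- `N_ε` as an integer; only used where `N_ε` is finite. -/
def NepsInt (α : ℝ) (x : Realization) (ε : ℝ) : ℤ :=
  (((Neps α x ε).unbotD 0).toNat : ℤ)

/-- `R_ε(k) = ε⁻¹ ∏_{0 ≤ j ≤ N_ε + k} Y_j ^ α`, for integers `k ≥ -N_ε`. -/
def Reps (α : ℝ) (x : Realization) (ε : ℝ) (k : ℤ) : ℝ :=
  ε⁻¹ * ∏ j ∈ Finset.range (NepsInt α x ε + k + 1).toNat, chainY α x j ^ α

/-- `∏_{0 ≤ j ≤ N_ε + k} Θ_j`, for integers `k ≥ -N_ε`. -/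
def prodΘ (α : ℝ) (x : Realization) (ε : ℝ) (k : ℤ) : ℝ :=
  ∏ j ∈ Finset.range (NepsInt α x ε + k + 1).toNat, chainΘ α x j

/-- `Δ_{N_ε + i, m}`, for integers `i ≥ -N_ε`. -/
def shiftΔ (α : ℝ) (x : Realization) (ε : ℝ) (i : ℤ) (m : ℕ) : ℝ :=
  chainΔ α x (NepsInt α x ε + i).toNat m

/-- `Δ_{N_ε + i, m} ^ α * Θ_{N_ε + i} ^ (-α) * Z_{N_ε + i}`, for integers `i ≥ -N_ε`. -/
def condTime (α : ℝ) (x : Realization) (ε : ℝ) (i : ℤ) (m : ℕ) : ℝ :=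
  shiftΔ α x ε i m ^ α * chainΘ α x (NepsInt α x ε + i).toNat ^ (-α) *
    chainZ α x (NepsInt α x ε + i).toNat

/-- The pair `(i, m)` is the index of a block of positive mass that splits off from the last
fragment (at the time `T_{N_ε + i}`, where `N_ε ≠ -∞` and `i ≥ -N_ε + 1`). -/
def IsIndex (α : ℝ) (x : Realization) (ε : ℝ) (i : ℤ) (m : ℕ) : Prop :=
  Neps α x ε ≠ ⊥ ∧ -NepsInt α x ε + 1 ≤ i ∧ 0 < shiftΔ α x ε i m

/-! ### Conditioned time-reversed fragmentations -/

/-- The time-reversal of the fragmentation from time `c`: `r ↦ F(c - r)` for `0 ≤ r ≤ c`, and the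
zero state for `r > c`. -/
def revPath (α : ℝ) (x : Realization) (c : ℝ) (r : ℝ≥0) : ℕ → ℝ :=
  if (r : ℝ) ≤ c then frag α x (c - r) else 0

/-- The law of the time-reversal, from time `c`, of the fragmentation conditioned to become extinct
before time `c`, evaluated at a set `B` of paths (in the product σ-algebra). -/
def condRevLaw {Ω : Type*} [MeasurableSpace Ω] (P : Measure Ω) (X : Ω → Realization)
    (α c : ℝ) (B : Set (ℝ≥0 → ℕ → ℝ)) : ℝ≥0∞ :=
  P[|{ω | extinction α (X ω) < c}] {ω | revPath α (X ω) c ∈ B}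

/-- The path regularity that is part of the definition of a time-reversed fragmentation conditioned
to become extinct before time `c`: it takes its values in the mass sequences, starts from the zero
state, equals `(1, 0, …)` at time `c` and the zero state afterwards, and it is left-continuous with
right limits for the `ℓ¹`-distance. -/
def IsRevPath (c : ℝ) (f : ℝ≥0 → ℕ → ℝ) : Prop :=
  (∀ r, IsMassSeq (f r)) ∧ f 0 = 0 ∧ f c.toNNReal = oneState ∧ (∀ r : ℝ≥0, c < r → f r = 0) ∧
  (∀ r, Tendsto (fun r' => l1Dist (f r') (f r)) (𝓝[<] r) (𝓝 0)) ∧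
  (∀ r, ∃ l, IsMassSeq l ∧ Tendsto (fun r' => l1Dist (f r') l) (𝓝[>] r) (𝓝 0))

/-- `(G i m)` is a collection of time-reversed fragmentations that, conditionally on the chain
`(Z_n, Θ_n, Δ_n)_{n ≥ 0}`, are independent and respectively conditioned to become extinct before
the times `condTime … i m`. The conditional law is spelt out on its finite-dimensional marginals:
for a measurable set `A` of trajectories of the chain and finitely many indices `p`,
`P(chain ∈ A, G p ∈ B p for all p) = E[1_{chain ∈ A} ∏_p P(reversed fragmentation_p ∈ B p)]`,
on the event, determined by the chain, that all these `p` are indices of split-off blocks. -/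
def IsCondIndepRevFrag {Ω : Type*} [MeasurableSpace Ω] (P : Measure Ω) (X : Ω → Realization)
    (α ε : ℝ) (G : ℤ → ℕ → Ω → ℝ≥0 → ℕ → ℝ) : Prop :=
  (∀ i m, Measurable (G i m)) ∧
  (∀ᵐ ω ∂P, ∀ i m, IsIndex α (X ω) ε i m → IsRevPath (condTime α (X ω) ε i m) (G i m ω)) ∧
  ∀ (s : Finset (ℤ × ℕ)) (A : Set (ℕ → ℝ × ℝ × (ℕ → ℝ)))
    (B : ℤ × ℕ → Set (ℝ≥0 → ℕ → ℝ)), MeasurableSet A → (∀ p, MeasurableSet (B p)) →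
    P {ω | chain α (X ω) ∈ A ∧ ∀ p ∈ s, IsIndex α (X ω) ε p.1 p.2 ∧ G p.1 p.2 ω ∈ B p} =
      ∫⁻ ω in {ω | chain α (X ω) ∈ A ∧ ∀ p ∈ s, IsIndex α (X ω) ε p.1 p.2},
        ∏ p ∈ s, condRevLaw P X α (condTime α (X ω) ε p.1 p.2) (B p) ∂P

/-- The masses, at (rescaled, reversed) time `t` with `R_ε(k) ≥ t > R_ε(k+1)`, given by the
spine decomposition: the mass of the spine, and the masses in the fragmentations of the blocks
that split off from it. -/
def spineMasses (α : ℝ) (x : Realization) (ε : ℝ) (g : ℤ → ℕ → ℝ≥0 → ℕ → ℝ) (t : ℝ) (k : ℤ) :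
    Unit ⊕ ({i : ℤ // -NepsInt α x ε + 1 ≤ i ∧ i ≤ k} × ℕ × ℕ) → ℝ
  | .inl _ => prodΘ α x ε k
  | .inr (i, m, l) =>
    prodΘ α x ε (i - 1) * shiftΔ α x ε i m *
      g i m (t * ε * prodΘ α x ε (i - 1) ^ α * shiftΔ α x ε i m ^ α).toNNReal l

end Fragmentation

end

/-!
The spine follows, at each split, the sub-block that is the last to be reduced to dust. The moments
`E ∑ S_i ^ p` decrease to `0` as `p → ∞`, because `ν` does not charge `(1, 0, …)`; they control the
masses of the blocks of generation `n`, hence, through the mean lives `m ^ (-α)`, the time to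
extinction, which is therefore finite and is attained along a single line of descent: a tie would
impose a value on an exponential clock. A block that is present at a given time is on the spine or
descends from one sibling of the spine, and by scaling this is the decomposition of the state.

For the conditional law, replace the fragmentation of one sibling of the spine by an independent
copy. Neither the spine nor the chain changes as long as the new fragmentation becomes extinct
before the time left to the spine, and the sibling would belong to the spine otherwise. Given the
chain, the fragmentation of the sibling is therefore one conditioned to become extinct before that
time, and the siblings may be treated one after the other.

The left limits of the state in the `ℓ¹` distance require that no positive mass is reduced to dust
at a single time: the birth times of two distinct blocks of a high generation differ by a variable
with a continuous law, and the squared mass of the blocks born in a short time interval is at most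
the total mass of the pairs of blocks born close to each other.
-/

noncomputable section

namespace Fragmentation

/-! ### Decreasing rearrangements -/

section Rearrangement

variable {ι κ : Type*} {a : ι → ℝ} {M : ℝ}

lemma encard_setOf_natCast_lt (N : ℕ∞) : {k : ℕ | (k : ℕ∞) < N}.encard = N := by
  induction N using ENat.recTopCoe with
  | top => simp
  | coe n =>
    have : {k : ℕ | (k : ℕ∞) < n} = ((Finset.range n : Finset ℕ) : Set ℕ) := by
      ext k; simp
    rw [this, Set.encard_coe_eq_coe_finsetCard, Finset.card_range]

lemma encard_subtype_and (p q : ι → Prop) :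
    {i : {i // p i} | q i}.encard = {i | p i ∧ q i}.encard :=
  Set.encard_congr (Equiv.subtypeSubtypeEquivSubtypeInter p q)

lemma encard_setOf_sum (p : ι ⊕ κ → Prop) :
    {q | p q}.encard = {i | p (.inl i)}.encard + {k | p (.inr k)}.encard := by
  have setOf_eq : {q | p q} = Sum.inl '' {i | p (.inl i)} ∪ Sum.inr '' {k | p (.inr k)} := by
    ext q
    rcases q with i | k <;> simp
  rw [setOf_eq, Set.encard_union_eq
      (Set.isCompl_range_inl_range_inr.disjoint.mono (Set.image_subset_range _ _)
        (Set.image_subset_range _ _)),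
    Sum.inl_injective.encard_image, Sum.inr_injective.encard_image]

lemma tsum_encard_eq_encard_setOf_prod (s : ι → Set κ) :
    ∑' i, ((s i).encard : ℝ≥0∞) = ({p : ι × κ | p.2 ∈ s p.1}.encard : ℝ≥0∞) := by
  simp_rw [← ENNReal.tsum_set_one, tsum_subtype _ (fun _ => (1 : ℝ≥0∞))]
  rw [ENNReal.tsum_prod']
  rfl

lemma encard_setOf_prod_congr {κ' : Type*} {p : ι × κ → Prop} {q : ι × κ' → Prop}
    (h : ∀ i, {k | p (i, k)}.encard = {k | q (i, k)}.encard) :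
    {z | p z}.encard = {z | q z}.encard := by
  rw [← ENat.toENNReal_inj]
  exact (tsum_encard_eq_encard_setOf_prod fun i => {k | p (i, k)}).symm.trans
    ((tsum_congr fun i => by rw [h]).trans
      (tsum_encard_eq_encard_setOf_prod fun i => {k | q (i, k)}))

lemma lt_decRearr_iff (ha : ∀ i, a i ≤ M) {y : ℝ} (hy : 0 ≤ y) (k : ℕ) :
    y < decRearr a k ↔ (k : ℕ∞) < {i | y < a i}.encard := by
  have hbdd : BddBelow {y : ℝ | 0 ≤ y ∧ {i | y < a i}.encard ≤ (k : ℕ∞)} := ⟨0, fun _ h => h.1⟩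
  constructor
  · intro h
    by_contra! hk
    exact (csInf_le hbdd ⟨hy, hk⟩).not_gt h
  · intro h
    obtain ⟨T, hT, hTc⟩ := Set.exists_subset_encard_eq (Order.add_one_le_of_lt h)
    have hfin : T.Finite := Set.finite_of_encard_eq_coe (k := k + 1) (by simpa using hTc)
    have hne : T.Nonempty := by
      rw [Set.nonempty_iff_ne_empty]
      rintro rfl
      rw [Set.encard_empty] at hTc
      exact absurd hTc.symm (by simp)
    obtain ⟨i₀, hi₀, hmin⟩ := Set.exists_min_image T a hfin hne
    have hlt : y < a i₀ := hT hi₀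
    obtain ⟨y', hy1, hy2⟩ := exists_between hlt
    refine lt_of_lt_of_le hy1 (le_csInf ⟨max M 0, le_max_right _ _, ?_⟩ ?_)
    · have hempty : {i | max M 0 < a i} = ∅ := by
        ext i; simp [ha i]
      rw [hempty]
      simp
    · rintro z ⟨-, hzc⟩
      by_contra! hlt'
      have hsub : T ⊆ {i | z < a i} := fun i hi => hlt'.trans (hy2.trans_le (hmin i hi))
      have := (Set.encard_le_encard hsub).trans hzc
      rw [hTc] at this
      exact absurd this (not_le.2 (by exact_mod_cast Nat.lt_succ_self k))

lemma decRearr_nonneg (a : ι → ℝ) (k : ℕ) : 0 ≤ decRearr a k :=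
  Real.sInf_nonneg fun _ h => h.1

lemma decRearr_le_iff (ha : ∀ i, a i ≤ M) {y : ℝ} (hy : 0 ≤ y) (k : ℕ) :
    decRearr a k ≤ y ↔ {i | y < a i}.encard ≤ (k : ℕ∞) := by
  rw [← not_lt, lt_decRearr_iff ha hy, not_lt]

lemma antitone_decRearr (ha : ∀ i, a i ≤ M) : Antitone (decRearr a) := by
  intro k l hkl
  rw [decRearr_le_iff ha (decRearr_nonneg _ _)]
  exact ((decRearr_le_iff ha (decRearr_nonneg _ _) k).1 le_rfl).trans (by exact_mod_cast hkl)

lemma decRearr_congr {b : κ → ℝ}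
    (h : ∀ y, 0 ≤ y → {i | y < a i}.encard = {i | y < b i}.encard) : decRearr a = decRearr b := by
  funext k
  unfold decRearr
  congr 1
  ext y
  exact and_congr_right fun hy => by rw [h y hy]

lemma encard_setOf_lt_decRearr (ha : ∀ i, a i ≤ M) {y : ℝ} (hy : 0 ≤ y) :
    {k | y < decRearr a k}.encard = {i | y < a i}.encard := by
  simp_rw [lt_decRearr_iff ha hy]
  exact encard_setOf_natCast_lt _

lemma decRearr_eq_zero_iff (ha : ∀ i, a i ≤ M) : decRearr a = 0 ↔ ∀ i, a i ≤ 0 := by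
  constructor
  · intro h i
    have hle : decRearr a 0 ≤ 0 := by simp [h]
    rw [decRearr_le_iff ha le_rfl, Nat.cast_zero, nonpos_iff_eq_zero, Set.encard_eq_zero] at hle
    exact not_lt.1 fun hi => Set.eq_empty_iff_forall_notMem.1 hle i hi
  · intro h
    funext k
    refine le_antisymm ?_ (decRearr_nonneg _ _)
    rw [Pi.zero_apply, decRearr_le_iff ha le_rfl]
    simp [(h _).not_gt]

lemma decRearr_of_unique [Unique ι] (ha : 0 ≤ a default) :
    decRearr a = Pi.single 0 (a default) := by
  have hcard : ∀ y, {i | y < a i}.encard ≤ 1 :=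
    fun y => Set.encard_le_one_iff_subsingleton.2 Set.subsingleton_of_subsingleton
  funext k
  rcases k with _ | k
  · have : {y : ℝ | 0 ≤ y ∧ {i | y < a i}.encard ≤ ((0 : ℕ) : ℕ∞)} = Set.Ici (a default) := by
      ext y
      simpa [Set.eq_empty_iff_forall_notMem, Unique.forall_iff] using ha.trans
    rw [decRearr, this, csInf_Ici, Pi.single_eq_same]
  · have : {y : ℝ | 0 ≤ y ∧ {i | y < a i}.encard ≤ ((k + 1 : ℕ) : ℕ∞)} = Set.Ici 0 := by
      ext y
      simpa using fun _ => (hcard y).trans (by exact_mod_cast Nat.le_add_left 1 k)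
    rw [decRearr, this, csInf_Ici, Pi.single_eq_of_ne k.succ_ne_zero]

lemma tsum_ofReal_eq_lintegral_encard [Countable ι] (a : ι → ℝ) :
    ∑' i, ENNReal.ofReal (a i) = ∫⁻ y in Set.Ici (0 : ℝ), ({i | y < a i}.encard : ℝ≥0∞) := by
  have layer_cake : ∀ i, ENNReal.ofReal (a i) =
      ∫⁻ y in Set.Ici (0 : ℝ), (Set.Iio (a i)).indicator (fun _ => (1 : ℝ≥0∞)) y := by
    intro i
    rw [lintegral_indicator measurableSet_Iio, Measure.restrict_restrict measurableSet_Iio]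
    simp only [lintegral_one, MeasurableSet.univ, Measure.restrict_apply, Set.univ_inter]
    rw [Set.Iio_inter_Ici, Real.volume_Ico, sub_zero]
  simp_rw [layer_cake]
  rw [← lintegral_tsum fun i =>
    ((measurable_const (a := (1 : ℝ≥0∞))).indicator measurableSet_Iio).aemeasurable]
  refine lintegral_congr fun y => ?_
  rw [← ENNReal.tsum_set_one, tsum_subtype {i | y < a i} (fun _ => (1 : ℝ≥0∞))]
  refine tsum_congr fun i => ?_
  by_cases h : y < a i <;> simp [Set.indicator, h]

lemma tsum_ofReal_decRearr [Countable ι] (ha : ∀ i, a i ≤ M) :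
    ∑' k, ENNReal.ofReal (decRearr a k) = ∑' i, ENNReal.ofReal (a i) := by
  rw [tsum_ofReal_eq_lintegral_encard, tsum_ofReal_eq_lintegral_encard]
  refine setLIntegral_congr_fun measurableSet_Ici fun y hy => ?_
  rw [encard_setOf_lt_decRearr ha hy]

lemma isMassSeq_decRearr [Countable ι] (ha : ∀ i, a i ≤ M)
    (hs : ∑' i, ENNReal.ofReal (a i) ≠ ∞) : IsMassSeq (decRearr a) := by
  refine ⟨antitone_decRearr ha, decRearr_nonneg a, ?_⟩
  rw [← tsum_ofReal_decRearr ha] at hs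
  have := ENNReal.summable_toReal hs
  simpa [ENNReal.toReal_ofReal (decRearr_nonneg a _)] using this

end Rearrangement

/-! ### The genealogical tree -/

section Tree

/-- The realization of the fragmentation of the block `v`, in its own units. -/
def subtree (v : List ℕ) (x : Realization) : Realization := fun w => x (w ++ v)

/-- The words of length `n`. -/
abbrev Lev (n : ℕ) : Type := {u : List ℕ // u.length = n}

/-- Words of length `n + 1` as a letter in front of a word of length `n`. -/
def levCons (n : ℕ) : ℕ × Lev n ≃ Lev (n + 1) where
  toFun p := ⟨p.1 :: p.2.1, by simp [p.2.2]⟩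
  invFun u := (u.1.head (by rintro h; simpa [h] using u.2), ⟨u.1.tail, by simp [u.2]⟩)
  left_inv p := by simp
  right_inv u := by simp

/-- Words of length `n + k` as a word of length `n` in front of a word of length `k`. -/
def levAppend (n k : ℕ) : Lev n × Lev k ≃ Lev (n + k) where
  toFun p := ⟨p.1.1 ++ p.2.1, by simp [p.1.2, p.2.2]⟩
  invFun u := (⟨u.1.take n, by simp [u.2]⟩, ⟨u.1.drop n, by simp [u.2]⟩)
  left_inv p := by
    obtain ⟨⟨u, hu⟩, ⟨v, hv⟩⟩ := p
    subst hu
    simp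
  right_inv u := by simp

lemma eq_of_suffix_of_suffix_of_length_eq {u v w : List ℕ} (hu : u <:+ w) (hv : v <:+ w)
    (h : u.length = v.length) : u = v :=
  (List.suffix_of_suffix_length_le hu hv h.le).eq_of_length h

variable {α : ℝ} {x : Realization}

@[simp] lemma subtree_nil (x : Realization) : subtree [] x = x := by
  funext w; simp [subtree]

lemma subtree_subtree (u v : List ℕ) (x : Realization) :
    subtree u (subtree v x) = subtree (u ++ v) x := by
  funext w; simp [subtree]

lemma subtree_apply (v w : List ℕ) (x : Realization) : subtree v x w = x (w ++ v) := rfl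

lemma UnitMassSeq.nonneg (s : UnitMassSeq) (i : ℕ) : 0 ≤ (s : ℕ → ℝ) i := s.2.1.2.1 i

lemma UnitMassSeq.hasSum (s : UnitMassSeq) : HasSum (s : ℕ → ℝ) 1 := by
  have := s.2.1.2.2.hasSum
  rwa [s.2.2] at this

lemma UnitMassSeq.exists_pos (s : UnitMassSeq) : ∃ i, 0 < (s : ℕ → ℝ) i := by
  by_contra! h
  have hzero : (s : ℕ → ℝ) = 0 := funext fun i => le_antisymm (h i) (s.nonneg i)
  simpa [hzero] using s.2.2

lemma UnitMassSeq.le_one (s : UnitMassSeq) (i : ℕ) : (s : ℕ → ℝ) i ≤ 1 :=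
  le_hasSum s.hasSum i fun j _ => s.nonneg j

lemma UnitMassSeq.tsum_ofReal (s : UnitMassSeq) :
    ∑' i, ENNReal.ofReal ((s : ℕ → ℝ) i) = 1 := by
  rw [← ENNReal.ofReal_tsum_of_nonneg s.nonneg s.2.1.2.2, s.2.2, ENNReal.ofReal_one]

lemma mass_nonneg (x : Realization) : ∀ u, 0 ≤ mass x u
  | [] => zero_le_one
  | _ :: u => mul_nonneg (mass_nonneg x u) (UnitMassSeq.nonneg _ _)

lemma mass_append (x : Realization) (w v : List ℕ) :
    mass x (w ++ v) = mass x v * mass (subtree v x) w := by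
  induction w with
  | nil => simp [mass]
  | cons i w ih => simp only [List.cons_append, mass, ih, subtree_apply, mul_assoc]

lemma mass_append_le (x : Realization) (w v : List ℕ) : mass x (w ++ v) ≤ mass x v := by
  induction w with
  | nil => simp
  | cons i w ih =>
    exact (mul_le_of_le_one_right (mass_nonneg _ _) (UnitMassSeq.le_one _ _)).trans ih

lemma mass_le_one (x : Realization) (u : List ℕ) : mass x u ≤ 1 := by
  simpa [mass] using mass_append_le x u []

lemma mass_pos_of_suffix {u v : List ℕ} (huv : u <:+ v) (hv : 0 < mass x v) : 0 < mass x u := by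
  obtain ⟨w, rfl⟩ := huv
  exact hv.trans_le (mass_append_le x w u)

lemma birth_append (x : Realization) (w v : List ℕ) :
    birth α x (w ++ v) = birth α x v + mass x v ^ (-α) * birth α (subtree v x) w := by
  induction w with
  | nil => simp [birth]
  | cons i w ih =>
    simp only [List.cons_append, birth, ih, mass_append, subtree_apply]
    rw [Real.mul_rpow (mass_nonneg _ _) (mass_nonneg _ _)]
    ring

lemma death_append (x : Realization) (w v : List ℕ) :
    death α x (w ++ v) = birth α x v + mass x v ^ (-α) * death α (subtree v x) w :=
  birth_append x (0 :: w) v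

lemma tsum_mass_cons (x : Realization) (u : List ℕ) :
    ∑' i, ENNReal.ofReal (mass x (i :: u)) = ENNReal.ofReal (mass x u) := by
  simp_rw [mass, ENNReal.ofReal_mul (mass_nonneg x u)]
  rw [ENNReal.tsum_mul_left, UnitMassSeq.tsum_ofReal, mul_one]

lemma tsum_lev_mass (x : Realization) (n : ℕ) :
    ∑' u : Lev n, ENNReal.ofReal (mass x u.1) = 1 := by
  induction n with
  | zero =>
    have : ∀ u : Lev 0, u = ⟨[], rfl⟩ := fun u => Subtype.ext (List.length_eq_zero_iff.1 u.2)
    rw [tsum_eq_single ⟨[], rfl⟩ fun u hu => absurd (this u) hu]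
    simp [mass]
  | succ n ih =>
    rw [← (levCons n).tsum_eq, ENNReal.tsum_prod', ENNReal.tsum_comm, ← ih]
    exact tsum_congr fun u => tsum_mass_cons x u.1

lemma tsum_lev_mass_append (x : Realization) (n : ℕ) (v : List ℕ) :
    ∑' u : Lev n, ENNReal.ofReal (mass x (u.1 ++ v)) = ENNReal.ofReal (mass x v) := by
  simp_rw [mass_append, ENNReal.ofReal_mul (mass_nonneg x v)]
  rw [ENNReal.tsum_mul_left, tsum_lev_mass, mul_one]

/-- The total mass of a set of blocks. -/
def massOf (x : Realization) (A : Set (List ℕ)) : ℝ≥0∞ := ∑' u : A, ENNReal.ofReal (mass x u)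

lemma massOf_eq_tsum_indicator (x : Realization) (A : Set (List ℕ)) :
    massOf x A = ∑' u, A.indicator (fun u => ENNReal.ofReal (mass x u)) u :=
  tsum_subtype A fun u => ENNReal.ofReal (mass x u)

lemma massOf_mono {A B : Set (List ℕ)} (h : A ⊆ B) : massOf x A ≤ massOf x B :=
  ENNReal.tsum_mono_subtype (fun u => ENNReal.ofReal (mass x u)) h

lemma massOf_union_le (A B : Set (List ℕ)) : massOf x (A ∪ B) ≤ massOf x A + massOf x B :=
  ENNReal.tsum_union_le (fun u => ENNReal.ofReal (mass x u)) A B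

lemma massOf_singleton (v : List ℕ) : massOf x {v} = ENNReal.ofReal (mass x v) :=
  tsum_singleton v fun u => ENNReal.ofReal (mass x u)

lemma massOf_setOf_pos (A : Set (List ℕ)) : massOf x {u ∈ A | 0 < mass x u} = massOf x A := by
  rw [massOf_eq_tsum_indicator, massOf_eq_tsum_indicator]
  refine tsum_congr fun u => ?_
  rcases (mass_nonneg x u).eq_or_lt with h | h
  · simp [Set.indicator, ← h]
  · by_cases hA : u ∈ A <;> simp [Set.indicator, h, hA]

lemma massOf_le_of_forall_length_le {A : Set (List ℕ)} {C : ℝ≥0∞}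
    (h : ∀ n, massOf x {v ∈ A | v.length ≤ n} ≤ C) : massOf x A ≤ C := by
  rw [massOf_eq_tsum_indicator, ENNReal.tsum_eq_iSup_sum]
  refine iSup_le fun s => le_trans ?_ (h (s.sup List.length))
  rw [massOf_eq_tsum_indicator]
  refine (Finset.sum_le_sum fun v hv => ?_).trans (ENNReal.sum_le_tsum s)
  have hlen : v.length ≤ s.sup List.length := Finset.le_sup hv
  by_cases hA : v ∈ A <;> simp [Set.indicator, hA, hlen]

/-- The blocks of generation `n` that descend from a block of `A`. -/
def descendants (A : Set (List ℕ)) (n : ℕ) : Set (List ℕ) := {u | u.length = n ∧ ∃ v ∈ A, v <:+ u}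

lemma descendants_eq_biUnion (A : Set (List ℕ)) (n : ℕ) :
    descendants A n = ⋃ v ∈ A, descendants {v} n := by
  ext u
  simp [descendants]

lemma descendants_subset (A : Set (List ℕ)) (n : ℕ) : descendants A n ⊆ {u | u.length = n} :=
  fun _ hu => hu.1

lemma massOf_setOf_length_eq (x : Realization) (n : ℕ) : massOf x {u | u.length = n} = 1 :=
  tsum_lev_mass x n

lemma massOf_descendants_singleton (x : Realization) {v : List ℕ} {n : ℕ} (hv : v.length ≤ n) :
    massOf x (descendants {v} n) = massOf x {v} := by
  obtain ⟨k, rfl⟩ := Nat.exists_eq_add_of_le' hv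
  have himage : descendants {v} (k + v.length) = Set.range fun u : Lev k => u.1 ++ v := by
    ext u
    constructor
    · rintro ⟨hlen, v, rfl, w, rfl⟩
      exact ⟨⟨w, by simpa using hlen⟩, rfl⟩
    · rintro ⟨w, rfl⟩
      exact ⟨by simp [w.2], v, rfl, List.suffix_append _ _⟩
  have hinj : Function.Injective fun u : Lev k => u.1 ++ v :=
    fun u w h => Subtype.ext (List.append_cancel_right h)
  rw [massOf_singleton, ← tsum_lev_mass_append x k v, massOf, himage,
    tsum_range (fun u => ENNReal.ofReal (mass x u)) hinj]

lemma massOf_descendants_le (x : Realization) (A : Set (List ℕ)) (n : ℕ) :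
    massOf x (descendants A n) ≤ massOf x A := by
  rw [descendants_eq_biUnion]
  refine (ENNReal.tsum_biUnion_le_tsum (fun u => ENNReal.ofReal (mass x u)) A _).trans
    (ENNReal.tsum_le_tsum fun v => ?_)
  by_cases hv : v.1.length ≤ n
  · exact (massOf_descendants_singleton x hv).le.trans (massOf_singleton _).le
  · have hempty : descendants {v.1} n = ∅ :=
      Set.eq_empty_of_forall_notMem fun u ⟨hlen, w, hw, hwu⟩ =>
        hv (hlen ▸ (Set.mem_singleton_iff.1 hw ▸ hwu.length_le))
    simp [hempty]

lemma massOf_descendants_of_isAntichain (x : Realization) {A : Set (List ℕ)}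
    (hA : IsAntichain (· <:+ ·) A) {n : ℕ} (hn : ∀ u ∈ A, u.length ≤ n) :
    massOf x (descendants A n) = massOf x A := by
  have hdisj : A.PairwiseDisjoint fun v => descendants {v} n := by
    refine fun u hu v hv huv => Set.disjoint_left.2 ?_
    rintro w ⟨-, _, rfl, huw⟩ ⟨-, _, rfl, hvw⟩
    rcases List.suffix_or_suffix_of_suffix huw hvw with h | h
    · exact hA hu hv huv h
    · exact hA hv hu huv.symm h
  rw [descendants_eq_biUnion]
  refine (ENNReal.tsum_biUnion' (f := fun u => ENNReal.ofReal (mass x u)) hdisj).trans ?_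
  exact tsum_congr fun v => (massOf_descendants_singleton x (hn v v.2)).trans (massOf_singleton _)

lemma massOf_le_one_of_isAntichain {A : Set (List ℕ)} (hA : IsAntichain (· <:+ ·) A) :
    massOf x A ≤ 1 := by
  refine massOf_le_of_forall_length_le fun n => ?_
  have hsub : IsAntichain (· <:+ ·) {v ∈ A | v.length ≤ n} := hA.subset fun _ h => h.1
  calc massOf x {v ∈ A | v.length ≤ n}
      = massOf x (descendants {v ∈ A | v.length ≤ n} n) :=
        (massOf_descendants_of_isAntichain x hsub fun _ h => h.2).symm
    _ ≤ massOf x {u | u.length = n} := massOf_mono (descendants_subset _ _)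
    _ = 1 := massOf_setOf_length_eq x n

/-! ### Blocks present at a given time -/

/-- All the clocks are positive. -/
def ClockPos (x : Realization) : Prop := ∀ u, 0 < (x u).1

lemma ClockPos.subtree (h : ClockPos x) (v : List ℕ) : ClockPos (subtree v x) := fun _ => h _

lemma birth_nonneg (h : ClockPos x) : ∀ u, 0 ≤ birth α x u
  | [] => le_rfl
  | _ :: u => add_nonneg (birth_nonneg h u)
      (mul_nonneg (Real.rpow_nonneg (mass_nonneg _ _) _) (h u).le)

lemma birth_le_death (h : ClockPos x) (u : List ℕ) : birth α x u ≤ death α x u :=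
  le_add_of_nonneg_right (mul_nonneg (Real.rpow_nonneg (mass_nonneg _ _) _) (h u).le)

lemma birth_lt_death (h : ClockPos x) {u : List ℕ} (hu : 0 < mass x u) :
    birth α x u < death α x u :=
  lt_add_of_pos_right _ (mul_pos (Real.rpow_pos_of_pos hu _) (h u))

lemma death_le_death_append (h : ClockPos x) (w v : List ℕ) :
    death α x v ≤ death α x (w ++ v) := by
  induction w with
  | nil => exact le_rfl
  | cons i w ih => exact ih.trans (birth_le_death h (i :: (w ++ v)))

lemma death_le_birth_of_suffix (h : ClockPos x) {u v : List ℕ} (huv : u <:+ v) (hne : u ≠ v) :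
    death α x u ≤ birth α x v := by
  obtain ⟨w, rfl⟩ := huv
  cases w with
  | nil => simp at hne
  | cons i w => exact death_le_death_append h w u

lemma Alive.eq_of_suffix (h : ClockPos x) {t : ℝ} {u v : List ℕ} (hu : Alive α x t u)
    (hv : Alive α x t v) (huv : u <:+ v) : u = v := by
  by_contra hne
  exact absurd (hu.2.2.trans_le (death_le_birth_of_suffix h huv hne)) (not_lt.2 hv.2.1)

lemma exists_suffix_of_birth_of_not_death {p : ℝ → Prop} {u v : List ℕ} (huv : u <:+ v)
    (hu : p (birth α x u)) (hv : ¬ p (death α x v)) :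
    ∃ w, u <:+ w ∧ w <:+ v ∧ p (birth α x w) ∧ ¬ p (death α x w) := by
  obtain ⟨w, rfl⟩ := huv
  induction w with
  | nil => exact ⟨u, List.suffix_rfl, List.suffix_rfl, hu, hv⟩
  | cons i w ih =>
    by_cases hb : p (birth α x (i :: w ++ u))
    · exact ⟨_, List.suffix_append _ _, List.suffix_rfl, hb, hv⟩
    · obtain ⟨z, huz, hz, hpz⟩ := ih hb
      exact ⟨z, huz, hz.trans (List.suffix_cons _ _), hpz⟩

lemma exists_alive_suffix {t : ℝ} {u v : List ℕ} (huv : u <:+ v)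
    (hv : 0 < mass x v) (hb : birth α x u ≤ t) (hd : t < death α x v) :
    ∃ w, u <:+ w ∧ w <:+ v ∧ Alive α x t w := by
  obtain ⟨w, huw, hwv, hbw, hdw⟩ :=
    exists_suffix_of_birth_of_not_death (p := (· ≤ t)) huv hb hd.not_ge
  exact ⟨w, huw, hwv, mass_pos_of_suffix hwv hv, hbw, not_le.1 hdw⟩

lemma isAntichain_alive (h : ClockPos x) (t : ℝ) :
    IsAntichain (· <:+ ·) {u | Alive α x t u} :=
  fun _ hu _ hv hne huv => hne (Alive.eq_of_suffix h hu hv huv)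

lemma frag_eq_zero_iff {t : ℝ} : frag α x t = 0 ↔ ∀ u, ¬ Alive α x t u := by
  rw [frag, decRearr_eq_zero_iff (a := fun u : {u // Alive α x t u} => mass x u)
    fun u => mass_le_one x u.1]
  exact ⟨fun h u hu => absurd hu.1 (not_lt.2 (h ⟨u, hu⟩)), fun h u => absurd u.2 (h u.1)⟩

lemma subFrag_eq_zero_iff {t s : ℝ} {u : List ℕ} :
    subFrag α x t u s = 0 ↔ ∀ v, u <:+ v → ¬ Alive α x (t + s) v := by
  rw [subFrag, decRearr_eq_zero_iff
    (a := fun v : {v // u <:+ v ∧ Alive α x (t + s) v} => mass x v) fun u => mass_le_one x u.1]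
  exact ⟨fun h u hu hu' => absurd hu'.1 (not_lt.2 (h ⟨u, hu, hu'⟩)),
    fun h u => absurd u.2.2 (h u.1 u.2.1)⟩

lemma alive_append_iff {t : ℝ} {v : List ℕ} (hv : 0 < mass x v) (w : List ℕ) :
    Alive α x t (w ++ v) ↔ Alive α (subtree v x) ((t - birth α x v) * mass x v ^ α) w := by
  have hp : 0 < mass x v ^ (-α) := Real.rpow_pos_of_pos hv _
  have hinv : mass x v ^ α = (mass x v ^ (-α))⁻¹ := by rw [Real.rpow_neg hv.le, inv_inv]
  unfold Alive
  rw [mass_append, birth_append, death_append, hinv, ← div_eq_mul_inv, le_div_iff₀ hp,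
    div_lt_iff₀ hp]
  refine and_congr (mul_pos_iff_of_pos_left hv) (and_congr ?_ ?_) <;> constructor <;> intro h <;>
    linarith

/-! ### Extinction times -/

/-- The supremum of the times at which blocks of positive mass split; this is the extinction time
when these times are bounded. Blocks of mass zero contribute the value `0`. -/
def lifetime (α : ℝ) (x : Realization) : ℝ :=
  open Classical in ⨆ w, if 0 < mass x w then death α x w else 0

/-- The time at which the block `u` is reduced to dust. -/
def dustTime (α : ℝ) (x : Realization) (u : List ℕ) : ℝ :=
  birth α x u + mass x u ^ (-α) * lifetime α (subtree u x)

/-- The times at which blocks of positive mass split are bounded. -/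
def BddDeathTimes (α : ℝ) (x : Realization) : Prop :=
  ∃ C, ∀ w, 0 < mass x w → death α x w ≤ C

lemma BddDeathTimes.subtree (h : BddDeathTimes α x) {v : List ℕ} (hv : 0 < mass x v) :
    BddDeathTimes α (subtree v x) := by
  obtain ⟨C, hC⟩ := h
  refine ⟨(C - birth α x v) / mass x v ^ (-α), fun w hw => ?_⟩
  rw [le_div_iff₀ (Real.rpow_pos_of_pos hv _)]
  have := hC (w ++ v) (by rw [mass_append]; positivity)
  rw [death_append] at this
  linarith

lemma death_le_lifetime (h : BddDeathTimes α x) {w : List ℕ} (hw : 0 < mass x w) :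
    death α x w ≤ lifetime α x := by
  classical
  obtain ⟨C, hC⟩ := h
  refine le_trans ?_ (le_ciSup ⟨max C 0, ?_⟩ w)
  · simp [hw]
  · rintro _ ⟨w, rfl⟩
    dsimp only
    split_ifs with h
    · exact (hC w h).trans (le_max_left _ _)
    · exact le_max_right _ _

lemma lifetime_pos (hc : ClockPos x) (h : BddDeathTimes α x) : 0 < lifetime α x := by
  have := death_le_lifetime h (w := []) (by simp [mass])
  exact lt_of_lt_of_le (by simpa [death, birth, mass] using hc []) this

lemma lifetime_le (hc : ClockPos x) {C : ℝ} (hC : ∀ w, 0 < mass x w → death α x w ≤ C) :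
    lifetime α x ≤ C := by
  classical
  refine ciSup_le fun w => ?_
  split_ifs with h
  · exact hC w h
  · exact ((birth_nonneg hc []).trans (birth_le_death hc [])).trans (hC [] (by simp [mass]))

@[simp] lemma dustTime_nil : dustTime α x [] = lifetime α x := by
  simp [dustTime, birth, mass]

lemma dustTime_append (x : Realization) (w v : List ℕ) :
    dustTime α x (w ++ v) = birth α x v + mass x v ^ (-α) * dustTime α (subtree v x) w := by
  rw [dustTime, dustTime, birth_append, mass_append,
    Real.mul_rpow (mass_nonneg _ _) (mass_nonneg _ _), subtree_subtree]
  ring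

lemma death_le_dustTime (h : BddDeathTimes α x) {u v : List ℕ} (huv : u <:+ v) (hv : 0 < mass x v) :
    death α x v ≤ dustTime α x u := by
  obtain ⟨w, rfl⟩ := huv
  have hu := mass_pos_of_suffix (List.suffix_append w u) hv
  rw [death_append, dustTime]
  have := death_le_lifetime (h.subtree hu) (w := w)
    (by rwa [mass_append, mul_pos_iff_of_pos_left hu] at hv)
  have : 0 < mass x u ^ (-α) := Real.rpow_pos_of_pos hu _
  gcongr

lemma dustTime_le (hc : ClockPos x) {u : List ℕ} (hu : 0 < mass x u) {C : ℝ}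
    (hC : ∀ v, u <:+ v → 0 < mass x v → death α x v ≤ C) : dustTime α x u ≤ C := by
  have hp : 0 < mass x u ^ (-α) := Real.rpow_pos_of_pos hu _
  have : lifetime α (subtree u x) ≤ (C - birth α x u) / mass x u ^ (-α) := by
    refine lifetime_le (hc.subtree u) fun w hw => ?_
    rw [le_div_iff₀ hp]
    have := hC (w ++ u) (List.suffix_append _ _) (by rw [mass_append]; positivity)
    rw [death_append] at this
    linarith
  rw [le_div_iff₀ hp] at this
  rw [dustTime]
  linarith

lemma dustTime_le_dustTime (hc : ClockPos x) (h : BddDeathTimes α x) {u v : List ℕ} (huv : u <:+ v)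
    (hv : 0 < mass x v) : dustTime α x v ≤ dustTime α x u :=
  dustTime_le hc hv fun _ hw hm => death_le_dustTime h (huv.trans hw) hm

lemma exists_alive_iff_lt_dustTime (hc : ClockPos x) (h : BddDeathTimes α x) {u : List ℕ}
    (hu : 0 < mass x u) {t : ℝ} (ht : birth α x u ≤ t) :
    (∃ v, u <:+ v ∧ Alive α x t v) ↔ t < dustTime α x u := by
  constructor
  · rintro ⟨v, hv, hm, -, hd⟩
    exact hd.trans_le (death_le_dustTime h hv hm)
  · intro hlt
    by_contra! hno
    refine absurd (dustTime_le hc hu fun v huv hv => ?_) (not_le.2 hlt)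
    by_contra! hd
    obtain ⟨w, hw, -, ha⟩ := exists_alive_suffix huv hv ht hd
    exact hno w hw ha

lemma sInf_setOf_le_and {c : ℝ} {p : ℝ → Prop} (hc : 0 ≤ c)
    (hp : ∀ s, 0 ≤ s → (p s ↔ c ≤ s)) : sInf {s | 0 ≤ s ∧ p s} = c := by
  have : {s | 0 ≤ s ∧ p s} = Set.Ici c := by
    ext s
    exact ⟨fun hs => (hp s hs.1).1 hs.2, fun hs => ⟨hc.trans hs, (hp s (hc.trans hs)).2 hs⟩⟩
  rw [this, csInf_Ici]

lemma extinction_eq_lifetime (hc : ClockPos x) (h : BddDeathTimes α x) :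
    extinction α x = lifetime α x := by
  refine sInf_setOf_le_and (lifetime_pos hc h).le fun s hs => ?_
  rw [frag_eq_zero_iff, ← not_lt, ← dustTime_nil,
    ← exists_alive_iff_lt_dustTime hc h (by simp [mass]) (by simpa [birth] using hs)]
  simp

lemma subExtinction_eq (hc : ClockPos x) (h : BddDeathTimes α x) {t : ℝ} {u : List ℕ}
    (hu : Alive α x t u) : subExtinction α x t u = dustTime α x u - t := by
  have le_dustTime : t ≤ dustTime α x u :=
    hu.2.2.le.trans (death_le_dustTime h List.suffix_rfl hu.1)
  refine sInf_setOf_le_and (sub_nonneg.2 le_dustTime) fun s hs => ?_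
  rw [subFrag_eq_zero_iff, sub_le_iff_le_add', ← not_lt,
    ← exists_alive_iff_lt_dustTime hc h hu.1 (by linarith [hu.2.1])]
  push Not
  rfl

end Tree

section Spine

variable {α : ℝ} {x : Realization}

/-! ### Regular realizations -/

/-- The time between the first split and the reduction to dust of the `i`-th sub-block. -/
def childLifetime (α : ℝ) (x : Realization) (i : ℕ) : ℝ :=
  ((x []).2 : ℕ → ℝ) i ^ (-α) * lifetime α (subtree [i] x)

/-- The total mass, for the product weights, of the pairs of blocks of generation `n` that are born
within time `δ` of each other. It controls the mass of the blocks born in a time interval of length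
`δ`. -/
def pairMass (α : ℝ) (x : Realization) (n : ℕ) (δ : ℝ) : ℝ≥0∞ :=
  ∑' p : Lev n × Lev n, {p : Lev n × Lev n | |birth α x p.1.1 - birth α x p.2.1| < δ}.indicator
    (fun p => ENNReal.ofReal (mass x p.1.1) * ENNReal.ofReal (mass x p.2.1)) p

/-- The almost sure properties of a fragmentation on which the spine decomposition relies, stated
for the first block: in particular, no two of its sub-blocks turn to dust simultaneously, and the
birth times of the blocks of a high generation do not concentrate. -/
structure IsRegularAtRoot (α : ℝ) (x : Realization) : Prop where
  clock_pos : 0 < (x []).1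
  lt_one : ∀ i, ((x []).2 : ℕ → ℝ) i < 1
  bdd : BddDeathTimes α x
  mass_tendsto : Tendsto (mass x) cofinite (𝓝 0)
  lifetime_tendsto : Tendsto (fun v => mass x v ^ (-α) * lifetime α (subtree v x)) cofinite (𝓝 0)
  childLifetime_ne : ∀ i j, i ≠ j → 0 < ((x []).2 : ℕ → ℝ) i → 0 < ((x []).2 : ℕ → ℝ) j →
    childLifetime α x i ≠ childLifetime α x j
  pairMass_lt : ∀ η : ℝ≥0∞, 0 < η → ∃ δ : ℝ, 0 < δ ∧ ∃ᶠ n in atTop, pairMass α x n δ < η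

/-- A realization in which the fragmentation of every block is regular. -/
def IsRegular (α : ℝ) (x : Realization) : Prop := ∀ v, IsRegularAtRoot α (subtree v x)

lemma IsRegular.toSubtree (h : IsRegular α x) (v : List ℕ) : IsRegular α (subtree v x) :=
  fun u => by rw [subtree_subtree]; exact h _

lemma IsRegular.isRegularAtRoot (h : IsRegular α x) : IsRegularAtRoot α x := by simpa using h []

lemma IsRegular.clockPos (h : IsRegular α x) : ClockPos x := fun u => by
  simpa [subtree] using (h u).clock_pos

lemma IsRegular.bdd (h : IsRegular α x) : BddDeathTimes α x := h.isRegularAtRoot.bdd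

lemma IsRegular.lifetime_pos (h : IsRegular α x) : 0 < lifetime α x :=
  Fragmentation.lifetime_pos h.clockPos h.bdd

lemma IsRegular.extinction_eq (h : IsRegular α x) : extinction α x = lifetime α x :=
  extinction_eq_lifetime h.clockPos h.bdd

/-! ### The spine -/

/-- The index of the sub-block of the first block that is the last to be reduced to dust, the
smallest such index in case of a tie. -/
def lastChild (α : ℝ) (x : Realization) : ℕ :=
  sInf {i | ∀ j, childLifetime α x j ≤ childLifetime α x i}

/-- The labels of the successive last fragments. -/
def spine (α : ℝ) (x : Realization) : ℕ → List ℕ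
  | 0 => []
  | n + 1 => lastChild α (subtree (spine α x n) x) :: spine α x n

lemma IsRegular.childLifetime_pos (h : IsRegular α x) {i : ℕ} (hi : 0 < ((x []).2 : ℕ → ℝ) i) :
    0 < childLifetime α x i :=
  mul_pos (Real.rpow_pos_of_pos hi _) (h.toSubtree [i]).lifetime_pos

lemma mass_singleton (x : Realization) (i : ℕ) : mass x [i] = ((x []).2 : ℕ → ℝ) i := by
  simp [mass]

lemma dustTime_singleton (x : Realization) (i : ℕ) :
    dustTime α x [i] = (x []).1 + childLifetime α x i := by
  simp [dustTime, childLifetime, birth, mass]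

lemma dustTime_cons (x : Realization) (i : ℕ) (u : List ℕ) :
    dustTime α x (i :: u) = birth α x u + mass x u ^ (-α) *
      ((x u).1 + childLifetime α (subtree u x) i) := by
  have := dustTime_append (α := α) x [i] u
  rw [dustTime_singleton] at this
  simpa [subtree_apply] using this

lemma IsRegular.childLifetime_le_lastChild (h : IsRegular α x) (j : ℕ) :
    childLifetime α x j ≤ childLifetime α x (lastChild α x) := by
  have htendsto : Tendsto (childLifetime α x) cofinite (𝓝 0) := by
    refine (h.isRegularAtRoot.lifetime_tendsto.comp
      (List.singleton_injective (α := ℕ)).tendsto_cofinite).congr fun i => ?_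
    simp [childLifetime, mass]
  obtain ⟨i₀, hi₀⟩ := (x []).2.exists_pos
  have hne : {i | ∀ j, childLifetime α x j ≤ childLifetime α x i}.Nonempty := by
    refine continuous_of_discreteTopology.exists_forall_ge' i₀ ?_
    rw [cocompact_eq_cofinite]
    exact htendsto.eventually_le_const (h.childLifetime_pos hi₀)
  exact Nat.sInf_mem hne j

lemma IsRegular.dislocation_lastChild_pos (hα : α < 0) (h : IsRegular α x) :
    0 < ((x []).2 : ℕ → ℝ) (lastChild α x) := by
  obtain ⟨i₀, hi₀⟩ := (x []).2.exists_pos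
  have lifetime_lastChild_pos :=
    (h.childLifetime_pos hi₀).trans_le (h.childLifetime_le_lastChild i₀)
  refine lt_of_le_of_ne (UnitMassSeq.nonneg _ _) fun h0 => ?_
  rw [childLifetime, ← h0, Real.zero_rpow (by linarith), zero_mul] at lifetime_lastChild_pos
  exact lt_irrefl _ lifetime_lastChild_pos

lemma IsRegular.childLifetime_lt_lastChild (hα : α < 0) (h : IsRegular α x) {j : ℕ}
    (hj : j ≠ lastChild α x) :
    childLifetime α x j < childLifetime α x (lastChild α x) := by
  have hb := h.dislocation_lastChild_pos hα
  rcases (UnitMassSeq.nonneg (x []).2 j).eq_or_lt with h0 | h0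
  · rw [childLifetime, ← h0, Real.zero_rpow (by linarith), zero_mul]
    exact h.childLifetime_pos hb
  · exact lt_of_le_of_ne (h.childLifetime_le_lastChild j)
      (h.isRegularAtRoot.childLifetime_ne _ _ hj h0 hb)

lemma IsRegular.lifetime_eq (hα : α < 0) (h : IsRegular α x) :
    lifetime α x = (x []).1 + childLifetime α x (lastChild α x) := by
  have hb : 0 < mass x [lastChild α x] := by
    rw [mass_singleton]; exact h.dislocation_lastChild_pos hα
  refine le_antisymm (lifetime_le h.clockPos fun w hw => ?_) ?_
  · induction w using List.reverseRecOn with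
    | nil =>
      simpa [death, birth, mass] using
        (h.childLifetime_pos (h.dislocation_lastChild_pos hα)).le
    | append_singleton w i _ =>
      refine (death_le_dustTime h.bdd (List.suffix_append w [i]) hw).trans ?_
      rw [dustTime_singleton]
      gcongr
      exact h.childLifetime_le_lastChild i
  · rw [← dustTime_singleton, ← dustTime_nil]
    exact dustTime_le_dustTime h.clockPos h.bdd List.nil_suffix hb

lemma IsRegular.dustTime_lastChild (hα : α < 0) (h : IsRegular α x) (u : List ℕ) :
    dustTime α x (lastChild α (subtree u x) :: u) = dustTime α x u := by
  rw [dustTime_cons, dustTime, (h.toSubtree u).lifetime_eq hα]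
  simp [subtree_apply]

lemma IsRegular.dustTime_cons_lt (hα : α < 0) (h : IsRegular α x) {u : List ℕ}
    (hu : 0 < mass x u) {i : ℕ} (hi : i ≠ lastChild α (subtree u x)) :
    dustTime α x (i :: u) < dustTime α x u := by
  rw [← h.dustTime_lastChild hα u, dustTime_cons, dustTime_cons]
  have := (h.toSubtree u).childLifetime_lt_lastChild hα hi
  have : 0 < mass x u ^ (-α) := Real.rpow_pos_of_pos hu _
  gcongr

@[simp] lemma length_spine (α : ℝ) (x : Realization) (n : ℕ) : (spine α x n).length = n := by
  induction n with
  | zero => rfl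
  | succ n ih => simp [spine, ih]

lemma spine_suffix (α : ℝ) (x : Realization) {n k : ℕ} (h : n ≤ k) :
    spine α x n <:+ spine α x k := by
  induction k, h using Nat.le_induction with
  | base => exact List.suffix_rfl
  | succ k _ ih => exact ih.trans (List.suffix_cons _ _)

lemma IsRegular.mass_spine_pos (hα : α < 0) (h : IsRegular α x) (n : ℕ) :
    0 < mass x (spine α x n) := by
  induction n with
  | zero => simp [spine, mass]
  | succ n ih =>
    have := (h.toSubtree (spine α x n)).dislocation_lastChild_pos hα
    exact mul_pos ih (by simpa [subtree_apply] using this)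

lemma IsRegular.dustTime_spine (hα : α < 0) (h : IsRegular α x) (n : ℕ) :
    dustTime α x (spine α x n) = lifetime α x := by
  induction n with
  | zero => simp [spine]
  | succ n ih => rw [spine, h.dustTime_lastChild hα, ih]

lemma IsRegular.dustTime_le_lifetime (h : IsRegular α x) {u : List ℕ} (hu : 0 < mass x u) :
    dustTime α x u ≤ lifetime α x := by
  rw [← dustTime_nil]
  exact dustTime_le_dustTime h.clockPos h.bdd List.nil_suffix hu

lemma IsRegular.eq_spine (hα : α < 0) (h : IsRegular α x) {u : List ℕ} (hu : 0 < mass x u)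
    (hd : dustTime α x u = lifetime α x) : u = spine α x u.length := by
  induction u with
  | nil => rfl
  | cons i u ih =>
    have hu' : 0 < mass x u := mass_pos_of_suffix (List.suffix_cons _ _) hu
    have dustTime_le : dustTime α x (i :: u) ≤ dustTime α x u :=
      dustTime_le_dustTime h.clockPos h.bdd (List.suffix_cons _ _) hu
    have u_eq := ih hu' (le_antisymm (h.dustTime_le_lifetime hu') (hd ▸ dustTime_le))
    have hi : i = lastChild α (subtree u x) := by
      by_contra hi
      have := h.dustTime_cons_lt hα hu' hi
      have := h.dustTime_le_lifetime hu'
      linarith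
    rw [List.length_cons, spine, ← u_eq, ← hi]

/-- The birth time of the `n`-th last fragment. -/
def spineTime (α : ℝ) (x : Realization) (n : ℕ) : ℝ := birth α x (spine α x n)

lemma spineTime_zero : spineTime α x 0 = 0 := rfl

lemma IsRegular.strictMono_spineTime (hα : α < 0) (h : IsRegular α x) :
    StrictMono (spineTime α x) :=
  strictMono_nat_of_lt_succ fun n => birth_lt_death h.clockPos (h.mass_spine_pos hα n)

lemma IsRegular.spineTime_nonneg (h : IsRegular α x) (n : ℕ) : 0 ≤ spineTime α x n :=
  birth_nonneg h.clockPos _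

lemma IsRegular.lifetime_sub_spineTime (hα : α < 0) (h : IsRegular α x) (n : ℕ) :
    lifetime α x - spineTime α x n =
      mass x (spine α x n) ^ (-α) * lifetime α (subtree (spine α x n) x) := by
  rw [← h.dustTime_spine hα n, dustTime, spineTime]
  ring

lemma IsRegular.spineTime_lt_lifetime (hα : α < 0) (h : IsRegular α x) (n : ℕ) :
    spineTime α x n < lifetime α x := by
  rw [← sub_pos, h.lifetime_sub_spineTime hα]
  exact mul_pos (Real.rpow_pos_of_pos (h.mass_spine_pos hα n) _) (h.toSubtree _).lifetime_pos

lemma IsRegular.tendsto_spineTime (hα : α < 0) (h : IsRegular α x) :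
    Tendsto (spineTime α x) atTop (𝓝 (lifetime α x)) := by
  have hinj : Function.Injective (spine α x) := fun n k hnk => by
    simpa using congrArg List.length hnk
  have remaining_tendsto := h.isRegularAtRoot.lifetime_tendsto.comp hinj.tendsto_cofinite
  rw [Nat.cofinite_eq_atTop] at remaining_tendsto
  have lifetime_sub_tendsto : Tendsto (fun n => lifetime α x - spineTime α x n) atTop (𝓝 0) :=
    remaining_tendsto.congr fun n => (h.lifetime_sub_spineTime hα n).symm
  simpa using lifetime_sub_tendsto.const_sub (lifetime α x)

lemma IsRegular.exists_spineTime (hα : α < 0) (h : IsRegular α x) {t : ℝ} (h0 : 0 ≤ t)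
    (ht : t < lifetime α x) : ∃ n, spineTime α x n ≤ t ∧ t < spineTime α x (n + 1) := by
  classical
  have hex : ∃ n, t < spineTime α x n :=
    ((h.tendsto_spineTime hα).eventually_const_lt ht).exists
  obtain ⟨n, hn⟩ : ∃ n, Nat.find hex = n + 1 := by
    refine Nat.exists_eq_succ_of_ne_zero fun hz => ?_
    have := Nat.find_spec hex
    rw [hz, spineTime_zero] at this
    linarith
  exact ⟨n, not_lt.1 (Nat.find_min hex (by omega)), hn ▸ Nat.find_spec hex⟩

lemma IsRegular.alive_spine_iff (hα : α < 0) (h : IsRegular α x) {t : ℝ} {n : ℕ} :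
    Alive α x t (spine α x n) ↔ spineTime α x n ≤ t ∧ t < spineTime α x (n + 1) :=
  ⟨fun ha => ha.2, fun ha => ⟨h.mass_spine_pos hα n, ha⟩⟩

lemma IsRegular.spineTime_unique (hα : α < 0) (h : IsRegular α x) {t : ℝ} {n k : ℕ}
    (hn : spineTime α x n ≤ t ∧ t < spineTime α x (n + 1))
    (hk : spineTime α x k ≤ t ∧ t < spineTime α x (k + 1)) : n = k := by
  have n_lt := (h.strictMono_spineTime hα).lt_iff_lt.1 (hn.1.trans_lt hk.2)
  have k_lt := (h.strictMono_spineTime hα).lt_iff_lt.1 (hk.1.trans_lt hn.2)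
  omega

lemma IsRegular.isLast_iff (hα : α < 0) (h : IsRegular α x) {t : ℝ} {n : ℕ}
    (hn : spineTime α x n ≤ t ∧ t < spineTime α x (n + 1)) (u : List ℕ) :
    IsLast α x t u ↔ u = spine α x n := by
  have hs : Alive α x t (spine α x n) := (h.alive_spine_iff hα).2 hn
  have hle_spine : ∀ v, Alive α x t v →
      subExtinction α x t v ≤ subExtinction α x t (spine α x n) := by
    intro v hv
    rw [subExtinction_eq h.clockPos h.bdd hv, subExtinction_eq h.clockPos h.bdd hs,
      h.dustTime_spine hα]
    linarith [h.dustTime_le_lifetime hv.1]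
  constructor
  · rintro ⟨hu, hmax⟩
    have spine_le := hmax _ hs
    rw [subExtinction_eq h.clockPos h.bdd hu, subExtinction_eq h.clockPos h.bdd hs,
      h.dustTime_spine hα] at spine_le
    have u_eq := h.eq_spine hα hu.1 (le_antisymm (h.dustTime_le_lifetime hu.1) (by linarith))
    rw [u_eq, h.alive_spine_iff hα] at hu
    rw [u_eq, h.spineTime_unique hα hu hn]
  · rintro rfl
    exact ⟨hs, hle_spine⟩

lemma IsRegular.lastWellDefined (hα : α < 0) (h : IsRegular α x) : LastWellDefined α x := by
  intro t h0 ht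
  rw [h.extinction_eq] at ht
  obtain ⟨n, hn⟩ := h.exists_spineTime hα h0 ht
  exact ⟨spine α x n, (h.isLast_iff hα hn _).2 rfl, fun u hu => (h.isLast_iff hα hn u).1 hu⟩

lemma IsRegular.lastLabel_eq (hα : α < 0) (h : IsRegular α x) {t : ℝ} {n : ℕ}
    (hn : spineTime α x n ≤ t ∧ t < spineTime α x (n + 1)) : lastLabel α x t = spine α x n := by
  have hex : ∃ u, IsLast α x t u := ⟨_, (h.isLast_iff hα hn _).2 rfl⟩
  rw [lastLabel, dif_pos hex]
  exact (h.isLast_iff hα hn _).1 hex.choose_spec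

lemma IsRegular.lastFrag_eq (hα : α < 0) (h : IsRegular α x) {t : ℝ} {n : ℕ}
    (hn : spineTime α x n ≤ t ∧ t < spineTime α x (n + 1)) :
    lastFrag α x t = mass x (spine α x n) := by
  rw [lastFrag, if_pos, h.lastLabel_eq hα hn]
  exact ⟨h.lastWellDefined hα, h.extinction_eq ▸ hn.2.trans (h.spineTime_lt_lifetime hα _)⟩

lemma IsRegular.strictAnti_mass_spine (hα : α < 0) (h : IsRegular α x) :
    StrictAnti fun n => mass x (spine α x n) := by
  refine strictAnti_nat_of_succ_lt fun n => ?_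
  refine mul_lt_of_lt_one_right (h.mass_spine_pos hα n) ?_
  simpa [subtree_apply] using (h (spine α x n)).lt_one (lastChild α (subtree (spine α x n) x))

lemma IsRegular.spineTime_self (hα : α < 0) (h : IsRegular α x) (n : ℕ) :
    spineTime α x n ≤ spineTime α x n ∧ spineTime α x n < spineTime α x (n + 1) :=
  ⟨le_rfl, h.strictMono_spineTime hα n.lt_succ_self⟩

lemma IsRegular.lastFrag_lt_mass_spine_iff (hα : α < 0) (h : IsRegular α x) {t : ℝ} {n : ℕ}
    (hn : spineTime α x n ≤ t) :
    lastFrag α x t < mass x (spine α x n) ↔ spineTime α x (n + 1) ≤ t := by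
  constructor
  · intro hlt
    by_contra! ht
    exact hlt.ne (h.lastFrag_eq hα ⟨hn, ht⟩)
  · intro ht
    by_cases hl : t < lifetime α x
    · obtain ⟨k, hk⟩ := h.exists_spineTime hα ((h.spineTime_nonneg _).trans ht) hl
      rw [h.lastFrag_eq hα hk]
      refine h.strictAnti_mass_spine hα ?_
      have := (h.strictMono_spineTime hα).lt_iff_lt.1 (ht.trans_lt hk.2)
      omega
    · rw [lastFrag, if_neg fun hh => hl (h.extinction_eq ▸ hh.2)]
      exact h.mass_spine_pos hα n

lemma IsRegular.setOf_lastFrag_lt_mass_spine (hα : α < 0) (h : IsRegular α x) (n : ℕ) :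
    {t | spineTime α x n ≤ t ∧ lastFrag α x t < mass x (spine α x n)} =
      Set.Ici (spineTime α x (n + 1)) := by
  ext t
  refine ⟨fun ⟨hn, hlt⟩ => (h.lastFrag_lt_mass_spine_iff hα hn).1 hlt, fun ht => ?_⟩
  have hn := (h.strictMono_spineTime hα n.lt_succ_self).le.trans ht
  exact ⟨hn, (h.lastFrag_lt_mass_spine_iff hα hn).2 ht⟩

lemma IsRegular.splitTime_eq (hα : α < 0) (h : IsRegular α x) (n : ℕ) :
    splitTime α x n = spineTime α x n := by
  induction n with
  | zero => rfl
  | succ n ih =>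
    rw [splitTime, ih, h.lastFrag_eq hα (h.spineTime_self hα n)]
    rw [h.setOf_lastFrag_lt_mass_spine hα, csInf_Ici]

lemma IsRegular.lastFrag_splitTime (hα : α < 0) (h : IsRegular α x) (n : ℕ) :
    lastFrag α x (splitTime α x n) = mass x (spine α x n) := by
  rw [h.splitTime_eq hα, h.lastFrag_eq hα (h.spineTime_self hα n)]

lemma IsRegular.chainZ_eq (hα : α < 0) (h : IsRegular α x) (n : ℕ) :
    chainZ α x n = mass x (spine α x n) ^ α * (lifetime α x - spineTime α x n) := by
  rw [chainZ, h.lastFrag_splitTime hα, h.extinction_eq, h.splitTime_eq hα]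

lemma IsRegular.chainΘ_succ (hα : α < 0) (h : IsRegular α x) (n : ℕ) :
    chainΘ α x (n + 1) = mass x (spine α x (n + 1)) / mass x (spine α x n) := by
  rw [chainΘ, h.lastFrag_splitTime hα, h.lastFrag_splitTime hα]

/-- The index, among all sub-blocks of a block, of the `m`-th sibling of its sub-block `i`. -/
def siblingIndex (i m : ℕ) : ℕ := if m < i then m else m + 1

lemma siblingIndex_ne (i m : ℕ) : siblingIndex i m ≠ i := by
  unfold siblingIndex; split_ifs <;> omega

lemma siblingIndex_injective (i : ℕ) : Function.Injective (siblingIndex i) := by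
  intro m k h
  unfold siblingIndex at h
  split_ifs at h <;> omega

lemma exists_siblingIndex {i j : ℕ} (h : j ≠ i) : ∃ m, siblingIndex i m = j := by
  rcases lt_or_gt_of_ne h with h | h
  · exact ⟨j, by simp [siblingIndex, h]⟩
  · exact ⟨j - 1, by unfold siblingIndex; split_ifs <;> omega⟩

/-- The `m`-th block that splits off when the `n`-th last fragment splits. -/
def siblingLabel (α : ℝ) (x : Realization) (n m : ℕ) : List ℕ :=
  siblingIndex (lastChild α (subtree (spine α x n) x)) m :: spine α x n

lemma IsRegular.chainΔ_succ (hα : α < 0) (h : IsRegular α x) (n m : ℕ) :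
    chainΔ α x (n + 1) m = mass x (siblingLabel α x n m) / mass x (spine α x n) := by
  rw [chainΔ, h.lastFrag_splitTime hα, h.splitTime_eq hα,
    h.lastLabel_eq hα (h.spineTime_self hα _)]
  rfl

lemma IsRegular.prod_chainΘ (hα : α < 0) (h : IsRegular α x) (n : ℕ) :
    ∏ j ∈ Finset.range (n + 1), chainΘ α x j = mass x (spine α x n) := by
  induction n with
  | zero => simp [chainΘ, spine, mass]
  | succ n ih =>
    rw [Finset.prod_range_succ, ih, h.chainΘ_succ hα, mul_div_cancel₀ _ (h.mass_spine_pos hα n).ne']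

lemma IsRegular.prod_chainY (hα : α < 0) (h : IsRegular α x) (n : ℕ) :
    ∏ j ∈ Finset.range (n + 1), chainY α x j ^ α = lifetime α x - spineTime α x n := by
  have hpow : ∀ z : ℝ, 0 ≤ z → (z ^ (1 / α)) ^ α = z := fun z hz => by
    rw [← Real.rpow_mul hz, one_div_mul_cancel hα.ne, Real.rpow_one]
  induction n with
  | zero =>
    rw [Finset.prod_range_one, chainY, hpow _ (h.extinction_eq ▸ h.lifetime_pos.le),
      h.extinction_eq, spineTime_zero, sub_zero]
  | succ n ih =>
    have remaining_pos := sub_pos.2 (h.spineTime_lt_lifetime hα n)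
    have remaining_succ_pos := sub_pos.2 (h.spineTime_lt_lifetime hα (n + 1))
    rw [Finset.prod_range_succ, ih, chainY, h.extinction_eq, h.splitTime_eq hα, h.splitTime_eq hα,
      hpow _ (by positivity), mul_div_cancel₀ _ remaining_pos.ne']

/-! ### The number of splits of the last fragment up to a time before extinction -/

/-- The number `N_ε`, meaningful for `ε ≤ lifetime α x`. -/
def spineCount (α ε : ℝ) (x : Realization) : ℕ :=
  sInf {n | lifetime α x - ε < spineTime α x (n + 1)}

lemma IsRegular.spineTime_le_iff (hα : α < 0) (h : IsRegular α x) {ε : ℝ} (hε : 0 < ε)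
    (hl : ε ≤ lifetime α x) (n : ℕ) :
    spineTime α x n ≤ lifetime α x - ε ↔ n ≤ spineCount α ε x := by
  obtain ⟨k, hk⟩ := h.exists_spineTime hα (t := lifetime α x - ε) (by linarith) (by linarith)
  have hc : spineCount α ε x = k := by
    refine le_antisymm (Nat.sInf_le hk.2) (le_csInf ⟨k, hk.2⟩ fun n hn => ?_)
    have := (h.strictMono_spineTime hα).lt_iff_lt.1 (hk.1.trans_lt hn)
    omega
  rw [hc]
  constructor
  · intro hn
    have := (h.strictMono_spineTime hα).lt_iff_lt.1 (hn.trans_lt hk.2)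
    omega
  · intro hn
    exact ((h.strictMono_spineTime hα).monotone hn).trans hk.1

lemma IsRegular.Neps_eq (hα : α < 0) (h : IsRegular α x) {ε : ℝ} (hε : 0 < ε)
    (hl : ε ≤ lifetime α x) : Neps α x ε = ((spineCount α ε x : ℕ∞) : WithBot ℕ∞) := by
  have : {n | splitTime α x n ≤ extinction α x - ε} = Set.Iic (spineCount α ε x) := by
    ext n
    change splitTime α x n ≤ extinction α x - ε ↔ n ≤ _
    rw [h.extinction_eq, h.splitTime_eq hα, h.spineTime_le_iff hα hε hl]
  rw [Neps, this]
  refine IsLUB.sSup_eq (IsGreatest.isLUB ⟨⟨_, Set.self_mem_Iic, rfl⟩, ?_⟩)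
  rintro _ ⟨n, hn, rfl⟩
  have hn' : n ≤ spineCount α ε x := hn
  change ((n : ℕ∞) : WithBot ℕ∞) ≤ ((spineCount α ε x : ℕ∞) : WithBot ℕ∞)
  exact_mod_cast hn'

lemma IsRegular.Neps_eq_bot (hα : α < 0) (h : IsRegular α x) {ε : ℝ} (hl : lifetime α x < ε) :
    Neps α x ε = ⊥ := by
  have : {n | splitTime α x n ≤ extinction α x - ε} = ∅ := by
    ext n
    change splitTime α x n ≤ extinction α x - ε ↔ False
    rw [h.extinction_eq, h.splitTime_eq hα]
    simp only [iff_false, not_le]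
    linarith [h.spineTime_nonneg n]
  rw [Neps, this, Set.image_empty, sSup_empty]

lemma IsRegular.Neps_ne_bot_iff (hα : α < 0) (h : IsRegular α x) {ε : ℝ} (hε : 0 < ε) :
    Neps α x ε ≠ ⊥ ↔ ε ≤ lifetime α x := by
  constructor
  · intro hne
    by_contra! hl
    exact hne (h.Neps_eq_bot hα hl)
  · intro hl
    rw [h.Neps_eq hα hε hl]
    exact WithBot.coe_ne_bot

lemma IsRegular.Neps_ne_top (hα : α < 0) (h : IsRegular α x) {ε : ℝ} (hε : 0 < ε) :
    Neps α x ε ≠ ((⊤ : ℕ∞) : WithBot ℕ∞) := by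
  by_cases hl : ε ≤ lifetime α x
  · rw [h.Neps_eq hα hε hl]
    exact fun hh => ENat.natCast_ne_top _ (WithBot.coe_injective hh)
  · rw [h.Neps_eq_bot hα (not_le.1 hl)]
    exact WithBot.bot_ne_coe

lemma IsRegular.NepsInt_eq (hα : α < 0) (h : IsRegular α x) {ε : ℝ} (hε : 0 < ε)
    (hl : ε ≤ lifetime α x) : NepsInt α x ε = spineCount α ε x := by
  rw [NepsInt, h.Neps_eq hα hε hl]
  rfl

end Spine

section Convergence

/-! ### Convergence of rearrangements -/

lemma tendsto_l1Dist_of_tendsto {β : Type*} {F : Filter β} {b : β → ℕ → ℝ} {l : ℕ → ℝ}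
    (hb : ∀ s, IsMassSeq (b s)) (hl : IsMassSeq l)
    (h : ∀ k, Tendsto (fun s => b s k) F (𝓝 (l k)))
    (hsum : Tendsto (fun s => ∑' k, b s k) F (𝓝 (∑' k, l k))) :
    Tendsto (fun s => l1Dist (b s) l) F (𝓝 0) := by
  have hpos : ∀ s, Summable fun k => max (l k - b s k) 0 := fun s =>
    hl.2.2.of_nonneg_of_le (fun k => le_max_right _ _)
      fun k => max_le (sub_le_self _ ((hb s).2.1 k)) (hl.2.1 k)
  -- The defect `(l - b s)⁺` is dominated by `l`, unlike `|b s - l|`.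
  have hdist : ∀ s, l1Dist (b s) l =
      ∑' k, b s k - ∑' k, l k + 2 * ∑' k, max (l k - b s k) 0 := by
    intro s
    rw [← (hb s).2.2.tsum_sub hl.2.2, ← tsum_mul_left,
      ← ((hb s).2.2.sub hl.2.2).tsum_add ((hpos s).mul_left 2)]
    refine tsum_congr fun k => ?_
    rcases le_total (b s k) (l k) with h | h
    · rw [abs_of_nonpos (sub_nonpos.2 h), max_eq_left (sub_nonneg.2 h)]; ring
    · rw [abs_of_nonneg (sub_nonneg.2 h), max_eq_right (sub_nonpos.2 h)]; ring
  have hdefect : Tendsto (fun s => ∑' k, max (l k - b s k) 0) F (𝓝 (∑' _ : ℕ, (0 : ℝ))) := by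
    refine tendsto_tsum_of_dominated_convergence hl.2.2 (fun k => ?_) (.of_forall fun s k => ?_)
    · simpa using ((h k).const_sub (l k)).max (tendsto_const_nhds (x := (0 : ℝ)))
    · rw [Real.norm_of_nonneg (le_max_right _ _)]
      exact max_le (sub_le_self _ ((hb s).2.1 k)) (hl.2.1 k)
  simp_rw [hdist]
  simpa using (hsum.sub_const (∑' k, l k)).add (hdefect.const_mul 2)

variable {β ι : Type*} {F : Filter β} {A : β → Set ι} {A₀ : Set ι} {m : ι → ℝ} {M : ℝ}

lemma eventually_decRearr_le_iff (hmM : ∀ u, m u ≤ M) (hm : Tendsto m cofinite (𝓝 0))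
    (hA : ∀ u, ∀ᶠ s in F, u ∈ A s ↔ u ∈ A₀) (k : ℕ) {y : ℝ} (hy : 0 < y) :
    ∀ᶠ s in F, decRearr (fun u : A s => m u) k ≤ y ↔ decRearr (fun u : A₀ => m u) k ≤ y := by
  have hfin : {u | y < m u}.Finite := by
    simpa [eventually_cofinite] using hm.eventually_le_const hy
  filter_upwards [(eventually_all_finite hfin).2 fun u _ => hA u] with s hs
  have hset : {u | u ∈ A s ∧ y < m u} = {u | u ∈ A₀ ∧ y < m u} :=
    Set.ext fun u => and_congr_left (hs u)
  rw [decRearr_le_iff (a := fun u : A s => m u) (fun u => hmM u.1) hy.le,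
    decRearr_le_iff (a := fun u : A₀ => m u) (fun u => hmM u.1) hy.le,
    encard_subtype_and (· ∈ A s) (y < m ·), encard_subtype_and (· ∈ A₀) (y < m ·), hset]

lemma tendsto_decRearr_of_eventually (hmM : ∀ u, m u ≤ M) (hm : Tendsto m cofinite (𝓝 0))
    (hA : ∀ u, ∀ᶠ s in F, u ∈ A s ↔ u ∈ A₀) (k : ℕ) :
    Tendsto (fun s => decRearr (fun u : A s => m u) k) F
      (𝓝 (decRearr (fun u : A₀ => m u) k)) := by
  have h0 := decRearr_nonneg (fun u : A₀ => m u) k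
  refine tendsto_order.2 ⟨fun y hy => ?_, fun y hy => ?_⟩
  · rcases lt_or_ge y 0 with hneg | hnonneg
    · exact .of_forall fun s => hneg.trans_le (decRearr_nonneg _ k)
    · obtain ⟨z, hyz, hz⟩ := exists_between hy
      filter_upwards [eventually_decRearr_le_iff hmM hm hA k (hnonneg.trans_lt hyz)] with s hs
      exact hyz.trans (not_le.1 (hs.not.2 (not_le.2 hz)))
  · obtain ⟨z, hz, hzy⟩ := exists_between hy
    filter_upwards [eventually_decRearr_le_iff hmM hm hA k (h0.trans_lt hz)] with s hs
    exact (hs.2 hz.le).trans_lt hzy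

lemma eventually_lt_tsum_subtype {f : ι → ℝ≥0∞} (hA : ∀ u, ∀ᶠ s in F, u ∈ A s ↔ u ∈ A₀)
    {C : ℝ≥0∞} (hC : C < ∑' u : A₀, f u) : ∀ᶠ s in F, C < ∑' u : A s, f u := by
  simp_rw [tsum_subtype _ f] at hC ⊢
  rw [ENNReal.tsum_eq_iSup_sum, lt_iSup_iff] at hC
  obtain ⟨S, hS⟩ := hC
  filter_upwards [(eventually_all_finset S).2 fun u _ => hA u] with s hs
  refine (hS.trans_eq (Finset.sum_congr rfl fun u hu => ?_)).trans_le (ENNReal.sum_le_tsum S)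
  by_cases hu₀ : u ∈ A₀
  · rw [Set.indicator_of_mem hu₀, Set.indicator_of_mem ((hs u hu).2 hu₀)]
  · rw [Set.indicator_of_notMem hu₀, Set.indicator_of_notMem ((hs u hu).not.2 hu₀)]

end Convergence

section PathRegularity

variable {α : ℝ} {x : Realization}

lemma eventually_lt_massOf {β : Type*} {F : Filter β} {A : β → Set (List ℕ)} {A₀ : Set (List ℕ)}
    (hA : ∀ u, ∀ᶠ s in F, u ∈ A s ↔ u ∈ A₀) {C : ℝ≥0∞} (hC : C < massOf x A₀) :
    ∀ᶠ s in F, C < massOf x (A s) :=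
  eventually_lt_tsum_subtype (f := fun u => ENNReal.ofReal (mass x u)) hA hC

lemma isMassSeq_decRearr_mass {A : Set (List ℕ)} (h : massOf x A ≤ 1) :
    IsMassSeq (decRearr fun u : A => mass x u) :=
  isMassSeq_decRearr (fun u => mass_le_one x u.1) (h.trans_lt ENNReal.one_lt_top).ne

lemma tsum_decRearr_mass (A : Set (List ℕ)) :
    ∑' k, decRearr (fun u : A => mass x u) k = (massOf x A).toReal := by
  rw [massOf, ← tsum_ofReal_decRearr (a := fun u : A => mass x u) fun u => mass_le_one x u.1,
    ENNReal.tsum_toReal_eq fun _ => ENNReal.ofReal_ne_top]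
  exact tsum_congr fun k => (ENNReal.toReal_ofReal (decRearr_nonneg _ _)).symm

lemma tendsto_l1Dist_decRearr_mass {β : Type*} {F : Filter β}
    (hm : Tendsto (mass x) cofinite (𝓝 0)) {A : β → Set (List ℕ)} {A₀ : Set (List ℕ)}
    (hA : ∀ u, ∀ᶠ s in F, u ∈ A s ↔ u ∈ A₀) (hle : ∀ s, massOf x (A s) ≤ 1)
    (hle₀ : massOf x A₀ ≤ 1) (hmass : Tendsto (fun s => massOf x (A s)) F (𝓝 (massOf x A₀))) :
    Tendsto (fun s => l1Dist (decRearr fun u : A s => mass x u)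
      (decRearr fun u : A₀ => mass x u)) F (𝓝 0) := by
  refine tendsto_l1Dist_of_tendsto (fun s => isMassSeq_decRearr_mass (hle s))
    (isMassSeq_decRearr_mass hle₀)
    (fun k => tendsto_decRearr_of_eventually (mass_le_one x) hm hA k) ?_
  simp_rw [tsum_decRearr_mass]
  exact (ENNReal.tendsto_toReal (hle₀.trans_lt ENNReal.one_lt_top).ne).comp hmass

/-! ### Path regularity -/

/-- The block `u` is present just before time `t`. -/
def AliveLeft (α : ℝ) (x : Realization) (t : ℝ) (u : List ℕ) : Prop :=
  0 < mass x u ∧ birth α x u < t ∧ t ≤ death α x u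

lemma isAntichain_aliveLeft (h : ClockPos x) (t : ℝ) :
    IsAntichain (· <:+ ·) {u | AliveLeft α x t u} := by
  rintro u ⟨-, -, hu⟩ v ⟨-, hv, -⟩ hne huv
  exact (hv.trans_le hu).not_ge (death_le_birth_of_suffix h huv hne)

lemma exists_aliveLeft_suffix {t : ℝ} {u v : List ℕ} (huv : u <:+ v) (hv : 0 < mass x v)
    (hu : birth α x u < t) (ht : t ≤ death α x v) :
    ∃ w, u <:+ w ∧ w <:+ v ∧ AliveLeft α x t w := by
  obtain ⟨w, huw, hwv, hbirth, hdeath⟩ :=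
    exists_suffix_of_birth_of_not_death (p := (· < t)) huv hu (not_lt.2 ht)
  exact ⟨w, huw, hwv, mass_pos_of_suffix hwv hv, hbirth, not_lt.1 hdeath⟩

lemma massOf_alive_le_one (h : ClockPos x) (t : ℝ) : massOf x {u | Alive α x t u} ≤ 1 :=
  massOf_le_one_of_isAntichain (isAntichain_alive h t)

lemma massOf_aliveLeft_le_one (h : ClockPos x) (t : ℝ) : massOf x {u | AliveLeft α x t u} ≤ 1 :=
  massOf_le_one_of_isAntichain (isAntichain_aliveLeft h t)

lemma isMassSeq_frag (h : ClockPos x) (t : ℝ) : IsMassSeq (frag α x t) :=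
  isMassSeq_decRearr_mass (massOf_alive_le_one h t)

lemma massOf_alive_antitone (h : ClockPos x) {t s : ℝ} (h0 : 0 ≤ t) (hts : t ≤ s) :
    massOf x {u | Alive α x s u} ≤ massOf x {u | Alive α x t u} := by
  refine massOf_le_of_forall_length_le fun n => ?_
  have hanti : IsAntichain (· <:+ ·) {u ∈ {u | Alive α x s u} | u.length ≤ n} :=
    (isAntichain_alive h s).subset fun _ hu => hu.1
  rw [← massOf_descendants_of_isAntichain x hanti fun _ hu => hu.2]
  refine (massOf_mono ?_).trans (massOf_descendants_le x {u | Alive α x t u} n)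
  rintro u ⟨hlen, v, ⟨hv, -⟩, hvu⟩
  obtain ⟨w, -, hwv, hw⟩ := exists_alive_suffix (α := α) List.nil_suffix hv.1 h0
    (hts.trans_lt hv.2.2)
  exact ⟨hlen, w, hw, hwv.trans hvu⟩

lemma massOf_sq_le_pairMass {s t δ : ℝ} (h : t - s ≤ δ) (n : ℕ) :
    massOf x {u | u.length = n ∧ s < birth α x u ∧ birth α x u < t} ^ 2 ≤ pairMass α x n δ := by
  set A := {u : List ℕ | u.length = n ∧ s < birth α x u ∧ birth α x u < t}
  let toLev : A × A → Lev n × Lev n := fun p => (⟨p.1, p.1.2.1⟩, ⟨p.2, p.2.2.1⟩)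
  have hinj : Function.Injective toLev := fun p q hpq => by
    simp only [toLev, Prod.mk.injEq, Subtype.mk.injEq] at hpq
    exact Prod.ext (Subtype.ext hpq.1) (Subtype.ext hpq.2)
  have hclose : ∀ p : A × A, |birth α x p.1 - birth α x p.2| < δ := fun ⟨u, v⟩ => by
    have hu := u.2.2
    have hv := v.2.2
    exact abs_lt.2 ⟨by linarith, by linarith⟩
  rw [sq, massOf, ← ENNReal.tsum_mul_right]
  simp_rw [← ENNReal.tsum_mul_left]
  rw [← ENNReal.tsum_prod]
  refine le_trans (ENNReal.tsum_le_tsum fun p => ?_)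
    (ENNReal.tsum_comp_le_tsum_of_injective hinj _)
  have hmem : toLev p ∈ {p : Lev n × Lev n | |birth α x p.1.1 - birth α x p.2.1| < δ} := hclose p
  rw [Set.indicator_of_mem hmem]

lemma descendants_alive_subset (h : ClockPos x) {s t : ℝ} (hst : s < t) {A : Set (List ℕ)}
    (hA : ∀ u ∈ A, Alive α x s u) {n : ℕ} (hn : ∀ u ∈ A, u.length < n) :
    {u ∈ descendants A n | 0 < mass x u} ⊆ descendants {u | AliveLeft α x t u} n ∪
      {u | u.length = n ∧ s < birth α x u ∧ birth α x u < t} := by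
  rintro u ⟨⟨hlen, v, hv, hvu⟩, hu⟩
  by_cases hb : birth α x u < t
  · have hne : v ≠ u := fun huv => (hn v hv).ne (huv ▸ hlen)
    exact .inr ⟨hlen, (hA v hv).2.2.trans_le (death_le_birth_of_suffix h hvu hne), hb⟩
  · obtain ⟨w, -, hwu, hw⟩ := exists_aliveLeft_suffix hvu hu ((hA v hv).2.1.trans_lt hst)
      ((not_lt.1 hb).trans (birth_le_death h u))
    exact .inl ⟨hlen, w, hw, hwu⟩

lemma IsRegularAtRoot.exists_massOf_alive_le (h : IsRegularAtRoot α x) (hc : ClockPos x) (t : ℝ)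
    {η : ℝ≥0} (hη : 0 < η) :
    ∃ δ > 0, ∀ s, t - δ < s → s < t →
      massOf x {u | Alive α x s u} ≤ massOf x {u | AliveLeft α x t u} + η := by
  obtain ⟨δ, hδ, hfreq⟩ := h.pairMass_lt ((η : ℝ≥0∞) ^ 2) (by positivity)
  refine ⟨δ, hδ, fun s hs hst => massOf_le_of_forall_length_le fun n => ?_⟩
  obtain ⟨N, hN, hpair⟩ := frequently_atTop.1 hfreq (n + 1)
  set A := {u ∈ {u | Alive α x s u} | u.length ≤ n}
  set born := {u : List ℕ | u.length = N ∧ s < birth α x u ∧ birth α x u < t}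
  have hanti : IsAntichain (· <:+ ·) A := (isAntichain_alive hc s).subset fun _ hu => hu.1
  have hlen : ∀ u ∈ A, u.length < N := fun u hu => (Nat.lt_succ_of_le hu.2).trans_le hN
  have hborn : massOf x born ≤ η :=
    (lt_of_pow_lt_pow_left' 2
      ((massOf_sq_le_pairMass (by linarith) N).trans_lt hpair)).le
  calc massOf x A
      = massOf x {u ∈ descendants A N | 0 < mass x u} := by
        rw [massOf_setOf_pos,
          massOf_descendants_of_isAntichain x hanti fun u hu => (hlen u hu).le]
    _ ≤ massOf x (descendants {u | AliveLeft α x t u} N ∪ born) :=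
        massOf_mono (descendants_alive_subset hc hst (fun _ hu => hu.1) hlen)
    _ ≤ massOf x {u | AliveLeft α x t u} + η :=
        (massOf_union_le _ _).trans (add_le_add (massOf_descendants_le x _ N) hborn)

lemma IsRegularAtRoot.tendsto_massOf_left (h : IsRegularAtRoot α x) (hc : ClockPos x) (t : ℝ)
    (hA : ∀ u, ∀ᶠ s in 𝓝[<] t, Alive α x s u ↔ AliveLeft α x t u) :
    Tendsto (fun s => massOf x {u | Alive α x s u}) (𝓝[<] t)
      (𝓝 (massOf x {u | AliveLeft α x t u})) := by
  refine tendsto_order.2 ⟨fun C hC => eventually_lt_massOf hA hC, fun C hC => ?_⟩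
  obtain ⟨η, hη, hlt⟩ := ENNReal.lt_iff_exists_add_pos_lt.1 hC
  obtain ⟨δ, hδ, hle⟩ := h.exists_massOf_alive_le hc t hη
  filter_upwards [Ioo_mem_nhdsLT (sub_lt_self t hδ)] with s hs
  exact (hle s hs.1 hs.2).trans_lt hlt

lemma tendsto_massOf_right (hc : ClockPos x) {t : ℝ} (ht : 0 ≤ t)
    (hA : ∀ u, ∀ᶠ s in 𝓝[>] t, Alive α x s u ↔ Alive α x t u) :
    Tendsto (fun s => massOf x {u | Alive α x s u}) (𝓝[>] t)
      (𝓝 (massOf x {u | Alive α x t u})) := by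
  refine tendsto_order.2 ⟨fun C hC => eventually_lt_massOf hA hC, fun C hC => ?_⟩
  filter_upwards [self_mem_nhdsWithin] with s hs
  exact (massOf_alive_antitone hc ht (le_of_lt hs)).trans_lt hC

lemma eventually_nhdsGT_le_iff {X : Type*} [LinearOrder X] [TopologicalSpace X]
    [OrderTopology X] (b t : X) : ∀ᶠ s in 𝓝[>] t, b ≤ s ↔ b ≤ t := by
  rcases le_or_gt b t with hb | hb
  · filter_upwards [self_mem_nhdsWithin] with s hs
    exact iff_of_true (hb.trans (le_of_lt hs)) hb
  · filter_upwards [Ioo_mem_nhdsGT hb] with s hs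
    exact iff_of_false (not_le.2 hs.2) (not_le.2 hb)

lemma eventually_nhdsLT_le_iff {X : Type*} [LinearOrder X] [TopologicalSpace X]
    [OrderTopology X] (b t : X) : ∀ᶠ s in 𝓝[<] t, b ≤ s ↔ b < t := by
  rcases lt_or_ge b t with hb | hb
  · filter_upwards [Ioo_mem_nhdsLT hb] with s hs
    exact iff_of_true hs.1.le hb
  · filter_upwards [self_mem_nhdsWithin] with s hs
    exact iff_of_false (not_le.2 (lt_of_lt_of_le hs hb)) (not_lt.2 hb)

lemma eventually_alive_right (t : ℝ) (u : List ℕ) :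
    ∀ᶠ s in 𝓝[>] t, Alive α x s u ↔ Alive α x t u := by
  filter_upwards [eventually_nhdsGT_le_iff (birth α x u) t,
    eventually_nhdsGT_le_iff (death α x u) t] with s hbirth hdeath
  exact and_congr_right' (and_congr hbirth (by rw [← not_le, hdeath, not_le]))

lemma eventually_alive_left (t : ℝ) (u : List ℕ) :
    ∀ᶠ s in 𝓝[<] t, Alive α x s u ↔ AliveLeft α x t u := by
  filter_upwards [eventually_nhdsLT_le_iff (birth α x u) t,
    eventually_nhdsLT_le_iff (death α x u) t] with s hbirth hdeath
  exact and_congr_right' (and_congr hbirth (by rw [← not_le, hdeath, not_lt]))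

lemma IsRegular.tendsto_frag_right (h : IsRegular α x) {t : ℝ} (ht : 0 ≤ t) :
    Tendsto (fun s => l1Dist (frag α x s) (frag α x t)) (𝓝[>] t) (𝓝 0) :=
  tendsto_l1Dist_decRearr_mass h.isRegularAtRoot.mass_tendsto (eventually_alive_right t)
    (massOf_alive_le_one h.clockPos) (massOf_alive_le_one h.clockPos t)
    (tendsto_massOf_right h.clockPos ht (eventually_alive_right t))

lemma IsRegular.exists_tendsto_frag_left (h : IsRegular α x) (t : ℝ) :
    ∃ l, IsMassSeq l ∧ Tendsto (fun s => l1Dist (frag α x s) l) (𝓝[<] t) (𝓝 0) :=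
  ⟨decRearr fun u : {u | AliveLeft α x t u} => mass x u,
    isMassSeq_decRearr_mass (massOf_aliveLeft_le_one h.clockPos t),
    tendsto_l1Dist_decRearr_mass h.isRegularAtRoot.mass_tendsto (eventually_alive_left t)
      (massOf_alive_le_one h.clockPos) (massOf_aliveLeft_le_one h.clockPos t)
      (h.isRegularAtRoot.tendsto_massOf_left h.clockPos t (eventually_alive_left t))⟩

lemma frag_eq_zero_of_lifetime_le (h : BddDeathTimes α x) {t : ℝ} (ht : lifetime α x ≤ t) :
    frag α x t = 0 :=
  frag_eq_zero_iff.2 fun _ hu => absurd (hu.2.2.trans_le ((death_le_lifetime h hu.1).trans ht))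
    (lt_irrefl _)

lemma alive_zero_iff (h : ClockPos x) {u : List ℕ} : Alive α x 0 u ↔ u = [] := by
  have hroot : Alive α x 0 [] :=
    ⟨by simp [mass], le_rfl, birth_lt_death h (u := []) (by simp [mass])⟩
  exact ⟨fun hu => (Alive.eq_of_suffix h hroot hu List.nil_suffix).symm, fun hu => hu ▸ hroot⟩

lemma frag_zero (h : ClockPos x) : frag α x 0 = oneState := by
  let : Unique {u // Alive α x 0 u} :=
    { default := ⟨[], (alive_zero_iff h).2 rfl⟩
      uniq := fun u => Subtype.ext ((alive_zero_iff h).1 u.2) }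
  exact decRearr_of_unique (a := fun u : {u // Alive α x 0 u} => mass x u) zero_le_one

lemma l1Dist_self (s : ℕ → ℝ) : l1Dist s s = 0 := by simp [l1Dist]

lemma isMassSeq_zero : IsMassSeq 0 := ⟨antitone_const, fun _ => le_rfl, summable_zero⟩

lemma revPath_of_le {c : ℝ} {r : ℝ≥0} (h : r ≤ c) : revPath α x c r = frag α x (c - r) :=
  if_pos h

lemma revPath_of_lt {c : ℝ} {r : ℝ≥0} (h : c < r) : revPath α x c r = 0 := if_neg (not_le.2 h)

lemma IsRegular.tendsto_revPath_left (h : IsRegular α x) (c : ℝ) (r : ℝ≥0) :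
    Tendsto (fun r' => l1Dist (revPath α x c r') (revPath α x c r)) (𝓝[<] r) (𝓝 0) := by
  rcases le_or_gt (r : ℝ) c with hr | hr
  · have hrev : Tendsto (fun r' : ℝ≥0 => c - (r' : ℝ)) (𝓝[<] r) (𝓝[>] (c - r)) :=
      (continuous_const.sub NNReal.continuous_coe).continuousWithinAt.tendsto_nhdsWithin
        fun _ hr' => sub_lt_sub_left (NNReal.coe_lt_coe.2 hr') c
    refine ((h.tendsto_frag_right (sub_nonneg.2 hr)).comp hrev).congr' ?_
    filter_upwards [self_mem_nhdsWithin] with r' hr'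
    have hle : (r' : ℝ) ≤ r := (NNReal.coe_lt_coe.2 hr').le
    rw [revPath_of_le hr, revPath_of_le (hle.trans hr), Function.comp_apply]
  · refine tendsto_const_nhds.congr' ?_
    filter_upwards [((NNReal.continuous_coe.tendsto r).mono_left
      nhdsWithin_le_nhds).eventually_const_lt hr] with r' hr'
    rw [revPath_of_lt hr, revPath_of_lt hr', l1Dist_self]

lemma IsRegular.exists_tendsto_revPath_right (h : IsRegular α x) (c : ℝ) (r : ℝ≥0) :
    ∃ l, IsMassSeq l ∧ Tendsto (fun r' => l1Dist (revPath α x c r') l) (𝓝[>] r) (𝓝 0) := by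
  rcases lt_or_ge (r : ℝ) c with hr | hr
  · obtain ⟨l, hl, hlim⟩ := h.exists_tendsto_frag_left (c - r)
    have hrev : Tendsto (fun r' : ℝ≥0 => c - (r' : ℝ)) (𝓝[>] r) (𝓝[<] (c - r)) :=
      (continuous_const.sub NNReal.continuous_coe).continuousWithinAt.tendsto_nhdsWithin
        fun _ hr' => sub_lt_sub_left (NNReal.coe_lt_coe.2 hr') c
    refine ⟨l, hl, (hlim.comp hrev).congr' ?_⟩
    filter_upwards [((NNReal.continuous_coe.tendsto r).mono_left
      nhdsWithin_le_nhds).eventually_lt_const hr] with r' hr'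
    rw [revPath_of_le hr'.le, Function.comp_apply]
  · refine ⟨0, isMassSeq_zero, tendsto_const_nhds.congr' ?_⟩
    filter_upwards [self_mem_nhdsWithin] with r' hr'
    rw [revPath_of_lt (hr.trans_lt (NNReal.coe_lt_coe.2 hr')), l1Dist_self]

lemma IsRegular.isRevPath (h : IsRegular α x) {c : ℝ} (hc : lifetime α x ≤ c) :
    IsRevPath c (revPath α x c) := by
  have hc0 : 0 ≤ c := h.lifetime_pos.le.trans hc
  refine ⟨fun r => ?_, ?_, ?_, fun r => revPath_of_lt, h.tendsto_revPath_left c,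
    h.exists_tendsto_revPath_right c⟩
  · unfold revPath
    split_ifs
    · exact isMassSeq_frag h.clockPos _
    · exact isMassSeq_zero
  · rw [revPath_of_le hc0, NNReal.coe_zero, sub_zero, frag_eq_zero_of_lifetime_le h.bdd hc]
  · rw [revPath_of_le (Real.coe_toNNReal c hc0).le, Real.coe_toNNReal c hc0, sub_self,
      frag_zero h.clockPos]

end PathRegularity

/-! ### Measurability -/

section Measurability

variable {α : ℝ}

lemma measurable_mass : ∀ u : List ℕ, Measurable fun x : Realization => mass x u
  | [] => measurable_const
  | i :: u => (measurable_mass u).mul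
      ((measurable_pi_apply i).comp (measurable_subtype_coe.comp
        (measurable_snd.comp (measurable_pi_apply u))))

lemma measurable_clock (u : List ℕ) : Measurable fun x : Realization => (x u).1 :=
  measurable_fst.comp (measurable_pi_apply u)

lemma measurable_birth : ∀ u : List ℕ, Measurable fun x : Realization => birth α x u
  | [] => measurable_const
  | _ :: u => (measurable_birth u).add (((measurable_mass u).pow_const _).mul (measurable_clock u))

lemma measurable_death (u : List ℕ) : Measurable fun x : Realization => death α x u :=
  measurable_birth (0 :: u)

lemma measurable_subtree (v : List ℕ) : Measurable (subtree v) :=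
  measurable_pi_lambda _ fun _ => measurable_pi_apply _

lemma measurable_lifetime : Measurable fun x : Realization => lifetime α x := by
  classical
  refine Measurable.iSup fun w => ?_
  exact Measurable.ite (measurableSet_lt measurable_const (measurable_mass w))
    (measurable_death w) measurable_const

lemma measurable_childLifetime (i : ℕ) : Measurable fun x : Realization => childLifetime α x i := by
  have : (fun x : Realization => childLifetime α x i) =
      fun x => mass x [i] ^ (-α) * lifetime α (subtree [i] x) := by
    funext x; rw [childLifetime, mass_singleton]
  rw [this]
  exact ((measurable_mass _).pow_const _).mul (measurable_lifetime.comp (measurable_subtree _))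

lemma measurable_sInf_setOf {β : Type*} [MeasurableSpace β] {p : β → ℕ → Prop}
    (hp : ∀ i, MeasurableSet {b | p b i}) : Measurable fun b => sInf {i | p b i} := by
  classical
  have exists_or : ∀ b, ∃ i, p b i ∨ ∀ j, ¬ p b j := fun b => by
    by_cases h : ∃ i, p b i
    exacts [h.imp fun _ => .inl, ⟨0, .inr (not_exists.1 h)⟩]
  have sInf_eq_find : (fun b => sInf {i | p b i}) = fun b => Nat.find (exists_or b) := by
    funext b
    by_cases h : ∃ i, p b i
    · exact (Nat.sInf_def (s := {i | p b i}) h).trans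
        (Nat.find_congr' (or_iff_left (not_forall_not.2 h)).symm)
    · have eq_empty : {i | p b i} = ∅ := Set.eq_empty_iff_forall_notMem.2 (not_exists.1 h)
      rw [(Nat.find_eq_zero _).2 (.inr (not_exists.1 h)), eq_empty, Nat.sInf_empty]
  rw [sInf_eq_find]
  have measurable_none : MeasurableSet {b | ∀ j, ¬ p b j} := by
    have : {b | ∀ j, ¬ p b j} = ⋂ j, {b | p b j}ᶜ := by ext; simp
    exact this ▸ MeasurableSet.iInter fun j => (hp j).compl
  exact measurable_find exists_or fun i => (hp i).union measurable_none

lemma measurable_lastChild : Measurable fun x : Realization => lastChild α x := by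
  refine measurable_sInf_setOf fun i => ?_
  have : {x : Realization | ∀ j, childLifetime α x j ≤ childLifetime α x i} =
      ⋂ j, {x | childLifetime α x j ≤ childLifetime α x i} := by
    ext; simp
  rw [this]
  exact MeasurableSet.iInter fun j => measurableSet_le (measurable_childLifetime j)
    (measurable_childLifetime i)

lemma measurable_of_discrete_index {β κ γ : Type*} [MeasurableSpace β] [MeasurableSpace γ]
    [Countable κ] {g : β → κ} (hg : ∀ w, MeasurableSet {b | g b = w}) {f : κ → β → γ}
    (hf : ∀ w, Measurable (f w)) : Measurable fun b => f (g b) b := by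
  intro S hS
  have : (fun b => f (g b) b) ⁻¹' S = ⋃ w, {b | g b = w} ∩ f w ⁻¹' S := by
    ext b; simp
  rw [this]
  exact MeasurableSet.iUnion fun w => (hg w).inter (hf w hS)

lemma measurable_lastChild_spine {n : ℕ}
    (hn : ∀ w, MeasurableSet {x : Realization | spine α x n = w}) :
    Measurable fun x : Realization => lastChild α (subtree (spine α x n) x) :=
  measurable_of_discrete_index (f := fun w x => lastChild α (subtree w x)) hn
    fun w => measurable_lastChild.comp (measurable_subtree w)

lemma measurableSet_spine (n : ℕ) :
    ∀ w, MeasurableSet {x : Realization | spine α x n = w} := by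
  induction n with
  | zero => intro w; simp [spine]
  | succ n ih =>
    intro w
    cases w with
    | nil => simp [spine]
    | cons i w =>
      have : {x : Realization | spine α x (n + 1) = i :: w} =
          {x | lastChild α (subtree (spine α x n) x) = i} ∩ {x | spine α x n = w} := by
        ext x; simp [spine]
      rw [this]
      exact (measurable_lastChild_spine ih (measurableSet_singleton i)).inter (ih w)

lemma measurable_spineTime (n : ℕ) : Measurable fun x : Realization => spineTime α x n :=
  measurable_of_discrete_index (f := fun w x => birth α x w) (measurableSet_spine n)
    measurable_birth

lemma measurable_mass_spine (n : ℕ) : Measurable fun x : Realization => mass x (spine α x n) :=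
  measurable_of_discrete_index (f := fun w x => mass x w) (measurableSet_spine n)
    measurable_mass

lemma measurableSet_siblingLabel (n m : ℕ) (w : List ℕ) :
    MeasurableSet {x : Realization | siblingLabel α x n m = w} := by
  cases w with
  | nil => simp [siblingLabel]
  | cons i w =>
    have : {x : Realization | siblingLabel α x n m = i :: w} =
        {x | siblingIndex (lastChild α (subtree (spine α x n) x)) m = i} ∩
          {x | spine α x n = w} := by
      ext x; simp [siblingLabel]
    rw [this]
    exact ((measurable_of_countable fun j => siblingIndex j m).comp
      (measurable_lastChild_spine (measurableSet_spine n)) (measurableSet_singleton i)).inter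
        (measurableSet_spine n w)

lemma measurable_spineCount (ε : ℝ) : Measurable fun x : Realization => spineCount α ε x :=
  measurable_sInf_setOf fun _ =>
    measurableSet_lt (measurable_lifetime.sub_const ε) (measurable_spineTime _)

lemma measurableSet_encard_le {β κ : Type*} [MeasurableSpace β] [Countable κ] {p : β → κ → Prop}
    (hp : ∀ u, MeasurableSet {b | p b u}) (k : ℕ) :
    MeasurableSet {b | {u | p b u}.encard ≤ (k : ℕ∞)} := by
  have : {b | {u | p b u}.encard ≤ (k : ℕ∞)} =
      ⋂ s : {s : Finset κ // s.card = k + 1}, ⋃ u ∈ s.1, {b | p b u}ᶜ := by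
    ext b
    simp only [Set.mem_iInter, Set.mem_iUnion, Set.mem_compl_iff]
    constructor
    · rintro h ⟨s, hs⟩
      by_contra hno
      push Not at hno
      have hsub : (s : Set κ) ⊆ {u | p b u} := fun u hu => hno u hu
      have := (Set.encard_le_encard hsub).trans h
      rw [Set.encard_coe_eq_coe_finsetCard, hs] at this
      exact absurd this (not_le.2 (by exact_mod_cast Nat.lt_succ_self k))
    · intro h
      by_contra hlt
      have hlt' : (k : ℕ∞) < {u | p b u}.encard := not_le.1 hlt
      obtain ⟨T, hT, hTc⟩ := Set.exists_subset_encard_eq (Order.add_one_le_of_lt hlt')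
      have hfin : T.Finite := Set.finite_of_encard_eq_coe (k := k + 1) (by simpa using hTc)
      have hcard : hfin.toFinset.card = k + 1 := by
        rw [hfin.encard_eq_coe_toFinset_card] at hTc
        exact_mod_cast hTc
      obtain ⟨u, hu, hnu⟩ := h ⟨hfin.toFinset, hcard⟩
      exact hnu (hT (hfin.mem_toFinset.1 hu))
  rw [this]
  exact MeasurableSet.iInter fun s => Finset.measurableSet_biUnion _ fun u _ => (hp u).compl

lemma measurable_frag {β : Type*} [MeasurableSpace β] {g : β → Realization} (hg : Measurable g)
    {t : β → ℝ} (ht : Measurable t) : Measurable fun b => frag α (g b) (t b) := by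
  refine measurable_pi_lambda _ fun k => measurable_of_Iic fun y => ?_
  rcases lt_or_ge y 0 with hy | hy
  · have : (fun b => frag α (g b) (t b) k) ⁻¹' Set.Iic y = ∅ := by
      ext b
      exact iff_of_false (not_le.2 (hy.trans_le (decRearr_nonneg _ _))) id
    rw [this]
    exact MeasurableSet.empty
  · have : (fun b => frag α (g b) (t b) k) ⁻¹' Set.Iic y =
        {b | {u | Alive α (g b) (t b) u ∧ y < mass (g b) u}.encard ≤ (k : ℕ∞)} := by
      ext b
      rw [Set.mem_preimage, Set.mem_Iic, frag,
        decRearr_le_iff (M := 1) (a := fun u : {u // Alive α (g b) (t b) u} => mass (g b) u)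
          (fun u => mass_le_one _ _) hy,
        encard_subtype_and (Alive α (g b) (t b)) (fun u => y < mass (g b) u)]
      rfl
    rw [this]
    refine measurableSet_encard_le (fun u => ?_) k
    have hm := (measurable_mass u).comp hg
    have hb := (measurable_birth (α := α) u).comp hg
    have hd := (measurable_death (α := α) u).comp hg
    exact ((measurableSet_lt measurable_const hm).inter ((measurableSet_le hb ht).inter
      (measurableSet_lt ht hd))).inter (measurableSet_lt measurable_const hm)

lemma measurable_revPath {β : Type*} [MeasurableSpace β] {g : β → Realization}
    (hg : Measurable g) {c : β → ℝ} (hc : Measurable c) :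
    Measurable fun b => revPath α (g b) (c b) := by
  refine measurable_pi_lambda _ fun r => ?_
  exact Measurable.ite (measurableSet_le measurable_const hc)
    (measurable_frag hg (hc.sub_const _)) measurable_const

lemma measurable_pairMass (n : ℕ) (δ : ℝ) :
    Measurable fun x : Realization => pairMass α x n δ := by
  refine Measurable.tsum fun p => ?_
  have hb : MeasurableSet {x : Realization | |birth α x p.1.1 - birth α x p.2.1| < δ} := by
    have := (measurable_birth (α := α) p.1.1).sub (measurable_birth (α := α) p.2.1)
    exact measurableSet_lt (continuous_abs.measurable.comp this) measurable_const
  have : (fun x : Realization => {p : Lev n × Lev n |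
      |birth α x p.1.1 - birth α x p.2.1| < δ}.indicator
      (fun p => ENNReal.ofReal (mass x p.1.1) * ENNReal.ofReal (mass x p.2.1)) p) =
      {x : Realization | |birth α x p.1.1 - birth α x p.2.1| < δ}.indicator
      (fun x => ENNReal.ofReal (mass x p.1.1) * ENNReal.ofReal (mass x p.2.1)) := by
    funext x
    by_cases h : |birth α x p.1.1 - birth α x p.2.1| < δ <;> simp [Set.indicator, h]
  rw [this]
  exact ((measurable_mass _).ennreal_ofReal.mul (measurable_mass _).ennreal_ofReal).indicator hb

end Measurability

section ProductMeasure

lemma measurePreserving_sumPiEquivProdPi_symm_infinitePi {ι κ : Type*} {E : ι ⊕ κ → Type*}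
    [∀ j, MeasurableSpace (E j)] (μ : ∀ j, Measure (E j)) [∀ j, IsProbabilityMeasure (μ j)] :
    MeasurePreserving (MeasurableEquiv.sumPiEquivProdPi E).symm
      ((Measure.infinitePi fun i => μ (.inl i)).prod (Measure.infinitePi fun k => μ (.inr k)))
      (Measure.infinitePi μ) := by
  refine ⟨MeasurableEquiv.measurable _, Measure.eq_infinitePi _ fun s t ht => ?_⟩
  have preimage_pi : (MeasurableEquiv.sumPiEquivProdPi E).symm ⁻¹' (s : Set (ι ⊕ κ)).pi t =
      ((s.toLeft : Set ι).pi fun i => t (.inl i)) ×ˢ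
        ((s.toRight : Set κ).pi fun k => t (.inr k)) := by
    ext p
    simp [Set.mem_pi, MeasurableEquiv.sumPiEquivProdPi, Equiv.sumPiEquivProdPi]
  rw [Measure.map_apply (MeasurableEquiv.measurable _)
      (MeasurableSet.pi s.countable_toSet fun j _ => ht j), preimage_pi, Measure.prod_prod,
    Measure.infinitePi_pi _ fun i _ => ht _, Measure.infinitePi_pi _ fun k _ => ht _,
    ← Finset.prod_disjSum (f := fun j => μ j (t j)), Finset.toLeft_disjSum_toRight]

lemma measurePreserving_sumElim_comp_injective {ι κ κ' E : Type*} [MeasurableSpace E]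
    (μ : Measure E) [IsProbabilityMeasure μ] {σ : ι → κ ⊕ κ'} (hσ : Function.Injective σ) :
    MeasurePreserving (fun (p : (κ → E) × (κ' → E)) u => Sum.elim p.1 p.2 (σ u))
      ((Measure.infinitePi fun _ => μ).prod (Measure.infinitePi fun _ => μ))
      (Measure.infinitePi fun _ => μ) := by
  have reindex : MeasurePreserving (fun (z : κ ⊕ κ' → E) u => z (σ u))
      (Measure.infinitePi fun _ => μ) (Measure.infinitePi fun _ => μ) :=
    ⟨by fun_prop, Measure.map_infinitePi_infinitePi_of_inj hσ⟩
  convert reindex.comp (measurePreserving_sumPiEquivProdPi_symm_infinitePi fun _ => μ) using 1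
  funext p u
  rw [Function.comp_apply]
  rcases σ u with i | i <;> rfl

end ProductMeasure

/-! ### Independent copies -/

/-- Replace the fragmentation of the block `v` of `x` by `y`. -/
def graft (v : List ℕ) (x y : Realization) : Realization := fun u =>
  if v <:+ u then y (u.take (u.length - v.length)) else x u

lemma graft_append (v w : List ℕ) (x y : Realization) : graft v x y (w ++ v) = y w := by
  simp [graft]

lemma graft_of_not_suffix {v u : List ℕ} (h : ¬ v <:+ u) (x y : Realization) :
    graft v x y u = x u := by
  simp [graft, h]

lemma subtree_graft (v : List ℕ) (x y : Realization) : subtree v (graft v x y) = y := by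
  funext w; exact graft_append v w x y

lemma subtree_graft_of_incomparable {u v : List ℕ} (huv : ¬ u <:+ v) (hvu : ¬ v <:+ u)
    (x y : Realization) : subtree u (graft v x y) = subtree u x := by
  funext w
  refine graft_of_not_suffix (fun h => ?_) _ _
  rcases List.suffix_or_suffix_of_suffix h (List.suffix_append w u) with h | h
  exacts [hvu h, huv h]

section Law

variable (ν : Measure UnitMassSeq)

/-- The law of a clock and a dislocation. -/
def nodeLaw : Measure (ℝ × UnitMassSeq) := (expMeasure 1).prod ν

/-- The law of a realization. -/
def realLaw : Measure Realization := Measure.infinitePi fun _ : List ℕ => nodeLaw ν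

instance : IsProbabilityMeasure (expMeasure 1) := isProbabilityMeasure_expMeasure one_pos

lemma measurePreserving_realLaw {Ω : Type*} [MeasurableSpace Ω] {P : Measure Ω}
    [IsProbabilityMeasure P] {X : Ω → Realization} (hX : ∀ u, Measurable fun ω => X ω u)
    (hindep : iIndepFun (fun u ω => X ω u) P) (hlaw : ∀ u, P.map (fun ω => X ω u) = nodeLaw ν) :
    MeasurePreserving X P (realLaw ν) := by
  have joint_law := (iIndepFun_iff_map_fun_eq_infinitePi_map hX).1 hindep
  rw [funext hlaw] at joint_law
  exact ⟨measurable_pi_lambda _ hX, joint_law⟩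

variable [IsProbabilityMeasure ν]

instance : IsProbabilityMeasure (nodeLaw ν) := by unfold nodeLaw; infer_instance

instance : IsProbabilityMeasure (realLaw ν) := by unfold realLaw; infer_instance

lemma measurePreserving_clock (u : List ℕ) :
    MeasurePreserving (fun x : Realization => (x u).1) (realLaw ν) (expMeasure 1) :=
  measurePreserving_fst.comp (measurePreserving_eval_infinitePi (fun _ => nodeLaw ν) u)

lemma measurePreserving_dislocation (u : List ℕ) :
    MeasurePreserving (fun x : Realization => (x u).2) (realLaw ν) ν :=
  measurePreserving_snd.comp (measurePreserving_eval_infinitePi (fun _ => nodeLaw ν) u)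

lemma measurePreserving_graft (v : List ℕ) :
    MeasurePreserving (fun p : Realization × Realization => graft v p.1 p.2)
      ((realLaw ν).prod (realLaw ν)) (realLaw ν) := by
  have injective : Function.Injective (fun u : List ℕ =>
      (if v <:+ u then Sum.inr (u.take (u.length - v.length)) else Sum.inl u :
        List ℕ ⊕ List ℕ)) := by
    intro u u' h
    by_cases hu : v <:+ u <;> by_cases hu' : v <:+ u'
    · obtain ⟨w, rfl⟩ := hu
      obtain ⟨w', rfl⟩ := hu'
      simpa using h
    · simp [hu, hu'] at h
    · simp [hu, hu'] at h
    · simpa [hu, hu'] using h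
  have graft_eq : (fun p : Realization × Realization => graft v p.1 p.2) = fun p u =>
      Sum.elim p.1 p.2 (if v <:+ u then Sum.inr (u.take (u.length - v.length)) else Sum.inl u) := by
    funext p u
    by_cases hu : v <:+ u <;> simp [graft, hu]
  rw [graft_eq]
  exact measurePreserving_sumElim_comp_injective (nodeLaw ν) injective

lemma lintegral_graft (v : List ℕ) {f : Realization → ℝ≥0∞} (hf : Measurable f) :
    ∫⁻ x, f x ∂realLaw ν = ∫⁻ x, ∫⁻ y, f (graft v x y) ∂realLaw ν ∂realLaw ν := by
  have h := measurePreserving_graft ν v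
  rw [← h.lintegral_comp hf, lintegral_prod]
  exact (hf.comp h.measurable).aemeasurable

lemma measurePreserving_subtree (v : List ℕ) :
    MeasurePreserving (subtree v) (realLaw ν) (realLaw ν) := by
  have graft_law := measurePreserving_graft ν v
  have snd_law : MeasurePreserving (Prod.snd : Realization × Realization → Realization)
      ((realLaw ν).prod (realLaw ν)) (realLaw ν) := measurePreserving_snd
  refine ⟨measurable_subtree v, ?_⟩
  conv_lhs => rw [← graft_law.map_eq]
  rw [Measure.map_map (measurable_subtree v) graft_law.measurable]
  refine Eq.trans ?_ snd_law.map_eq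
  congr 1
  funext p
  exact subtree_graft v p.1 p.2

lemma measurePreserving_update (v : List ℕ) :
    MeasurePreserving (fun p : Realization × (ℝ × UnitMassSeq) => Function.update p.1 v p.2)
      ((realLaw ν).prod (nodeLaw ν)) (realLaw ν) := by
  have injective : Function.Injective (fun u : List ℕ =>
      (if u = v then Sum.inr [] else Sum.inl u : List ℕ ⊕ List ℕ)) := by
    intro u u' h
    by_cases hu : u = v <;> by_cases hu' : u' = v <;> simp_all
  have mix_law := measurePreserving_sumElim_comp_injective (nodeLaw ν) injective
  have eval_law : MeasurePreserving (fun p : Realization × Realization => (p.1, p.2 []))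
      ((realLaw ν).prod (realLaw ν)) ((realLaw ν).prod (nodeLaw ν)) :=
    (MeasurePreserving.id _).prod (measurePreserving_eval_infinitePi (fun _ => nodeLaw ν) [])
  have measurable_update :
      Measurable fun p : Realization × (ℝ × UnitMassSeq) => Function.update p.1 v p.2 := by
    refine measurable_pi_lambda _ fun u => ?_
    by_cases hu : u = v
    · subst hu
      simpa using measurable_snd
    · simpa [hu, Function.comp_def] using
        (measurable_pi_apply (X := fun _ : List ℕ => ℝ × UnitMassSeq) u).comp measurable_fst
  refine ⟨measurable_update, ?_⟩
  rw [← eval_law.map_eq, Measure.map_map measurable_update eval_law.measurable]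
  refine Eq.trans ?_ mix_law.map_eq
  congr 1
  funext p u
  by_cases hu : u = v
  · subst hu
    simp
  · simp [hu]

lemma lintegral_update (v : List ℕ) {f : Realization → ℝ≥0∞} (hf : Measurable f) :
    ∫⁻ x, f x ∂realLaw ν =
      ∫⁻ x, ∫⁻ s, ∫⁻ e, f (Function.update x v (e, s)) ∂expMeasure 1 ∂ν ∂realLaw ν := by
  have h := measurePreserving_update ν v
  rw [← h.lintegral_comp hf, lintegral_prod]
  swap
  · exact (hf.comp h.measurable).aemeasurable
  refine lintegral_congr fun x => ?_
  rw [nodeLaw, lintegral_prod_symm]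
  exact (hf.comp (h.measurable.comp measurable_prodMk_left)).aemeasurable

end Law

/-! ### The exponential law -/

section ExponentialClock

variable {α : ℝ}

lemma expMeasure_le_volume : expMeasure 1 ≤ volume := by
  have density_le_one : gammaPDF 1 1 ≤ 1 := by
    intro e
    rcases lt_or_ge e 0 with he | he
    · rw [gammaPDF_of_neg he]; exact zero_le
    · rw [gammaPDF_of_nonneg he]
      simp only [Real.one_rpow, Real.Gamma_one, div_one, sub_self, Real.rpow_zero, one_mul,
        Pi.one_apply]
      exact ENNReal.ofReal_le_one.2 (Real.exp_le_one_iff.2 (by linarith))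
  calc expMeasure 1 = volume.withDensity (gammaPDF 1 1) := rfl
    _ ≤ volume.withDensity 1 := withDensity_mono (.of_forall density_le_one)
    _ = volume := withDensity_one

instance : NullSingletonClass (expMeasure 1) :=
  ⟨fun e => le_antisymm ((expMeasure_le_volume {e}).trans (by simp)) zero_le⟩

lemma expMeasure_ae_pos : ∀ᵐ e ∂expMeasure 1, 0 < e := by
  have measure_Iio : expMeasure 1 (Set.Iio 0) = 0 := by
    rw [expMeasure, gammaMeasure, withDensity_apply _ measurableSet_Iio]
    exact lintegral_gammaPDF_of_nonpos le_rfl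
  rw [ae_iff]
  simp only [not_lt]
  change expMeasure 1 (Set.Iic 0) = 0
  rw [← Set.Iio_union_right]
  exact measure_union_null measure_Iio (measure_singleton 0)

lemma lintegral_pow_expMeasure_lt_top (q : ℕ) :
    ∫⁻ e, ENNReal.ofReal (e ^ q) ∂expMeasure 1 < ∞ := by
  have restrict_Ioi : expMeasure 1 = (expMeasure 1).restrict (Set.Ioi 0) :=
    (Measure.restrict_eq_self_of_ae_mem expMeasure_ae_pos).symm
  have hm : Measurable (gammaPDF 1 1) := (measurable_gammaPDFReal 1 1).ennreal_ofReal
  rw [restrict_Ioi, expMeasure, gammaMeasure, restrict_withDensity measurableSet_Ioi,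
    lintegral_withDensity_eq_lintegral_mul _ hm (by fun_prop)]
  have gamma_lt_top := (Real.GammaIntegral_convergent (s := q + 1) (by positivity)).lintegral_lt_top
  refine (setLIntegral_congr_fun measurableSet_Ioi fun e (he : 0 < e) => ?_).trans_lt gamma_lt_top
  simp only [Pi.mul_apply]
  rw [gammaPDF_of_nonneg he.le, ← ENNReal.ofReal_mul (by positivity)]
  simp

lemma expMeasure_setOf_abs_lt_le (c : ℝ) {m : ℝ} (hm : 0 < m) (δ : ℝ) :
    expMeasure 1 {e | |c + m * e| < δ} ≤ ENNReal.ofReal (2 * δ / m) := by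
  refine (expMeasure_le_volume _).trans ?_
  have setOf_eq_Ioo : {e : ℝ | |c + m * e| < δ} = Set.Ioo ((-δ - c) / m) ((δ - c) / m) := by
    ext e
    change |c + m * e| < δ ↔ _ < e ∧ e < _
    rw [abs_lt, div_lt_iff₀ hm, lt_div_iff₀ hm]
    constructor <;> rintro ⟨h1, h2⟩ <;> constructor <;> linarith
  rw [setOf_eq_Ioo, Real.volume_Ioo]
  exact ENNReal.ofReal_le_ofReal (le_of_eq (by ring))

/-! ### Changing one clock -/

/-- The realizations `x` and `z` differ at most by the clock of the block `v`. -/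
def AgreeExceptClock (v : List ℕ) (x z : Realization) : Prop :=
  (∀ u, (x u).2 = (z u).2) ∧ ∀ u, u ≠ v → (x u).1 = (z u).1

lemma agreeExceptClock_update (v : List ℕ) (x : Realization) (s : UnitMassSeq) (e e' : ℝ) :
    AgreeExceptClock v (Function.update x v (e, s)) (Function.update x v (e', s)) := by
  constructor
  · intro u
    by_cases h : u = v
    · subst h; simp
    · simp [h]
  · intro u h
    simp [h]

lemma AgreeExceptClock.mass_eq {v : List ℕ} {x z : Realization} (h : AgreeExceptClock v x z) :
    ∀ u, mass z u = mass x u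
  | [] => rfl
  | i :: u => by rw [mass, mass, h.mass_eq u, h.1 u]

open Classical in
lemma AgreeExceptClock.death_eq {v : List ℕ} {x z : Realization} (h : AgreeExceptClock v x z)
    (u : List ℕ) : death α z u = death α x u +
      if v <:+ u then mass x v ^ (-α) * ((z v).1 - (x v).1) else 0 := by
  induction u with
  | nil =>
    by_cases hv : v = []
    · subst hv
      simp [death, birth, mass]
    · simp [death, birth, mass, hv, h.2 [] (Ne.symm hv)]
  | cons i u ih =>
    have death_cons : ∀ y : Realization,
        death α y (i :: u) = death α y u + mass y (i :: u) ^ (-α) * (y (i :: u)).1 := fun _ => rfl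
    rw [death_cons, death_cons, ih, h.mass_eq]
    by_cases hv : v = i :: u
    · have not_suffix : ¬ v <:+ u := fun hvu => by simpa [hv] using hvu.length_le
      subst hv
      rw [if_neg not_suffix, if_pos List.suffix_rfl]
      ring
    · simp only [List.suffix_cons_iff, hv, false_or, h.2 _ (Ne.symm hv)]
      ring

lemma AgreeExceptClock.lifetime_sub_le {x z : Realization} (h : AgreeExceptClock [] x z)
    (hx : BddDeathTimes α x) (hc : ClockPos z) :
    lifetime α z - (z []).1 ≤ lifetime α x - (x []).1 := by
  rw [sub_le_iff_le_add]
  refine lifetime_le hc fun w hw => ?_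
  rw [h.death_eq]
  rw [h.mass_eq] at hw
  have := death_le_lifetime hx hw
  simp only [List.nil_suffix, if_true, mass, Real.one_rpow, one_mul]
  linarith

end ExponentialClock

/-! ### Moments -/

section Moments

variable (ν : Measure UnitMassSeq)

/-- The mean of the `p`-th powers of the `i`-th mass of a dislocation. -/
def powMean (p : ℝ) (i : ℕ) : ℝ≥0∞ := ∫⁻ s, ENNReal.ofReal ((s : ℕ → ℝ) i ^ p) ∂ν

/-- The mean sum of the `p`-th powers of the masses of a dislocation. -/
def powSum (p : ℝ) : ℝ≥0∞ := ∑' i, powMean ν p i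

lemma measurable_coord_pow (p : ℝ) (i : ℕ) :
    Measurable fun s : UnitMassSeq => ENNReal.ofReal ((s : ℕ → ℝ) i ^ p) :=
  (((measurable_pi_apply i).comp measurable_subtype_coe).pow_const p).ennreal_ofReal

lemma ae_coord_lt_one (hν : ν {s | (s : ℕ → ℝ) = oneState} = 0) :
    ∀ᵐ s : UnitMassSeq ∂ν, ∀ i, (s : ℕ → ℝ) i < 1 := by
  have ae_ne_oneState : ∀ᵐ s : UnitMassSeq ∂ν, (s : ℕ → ℝ) ≠ oneState := by
    rw [ae_iff]; simpa using hν
  filter_upwards [ae_ne_oneState] with s hs i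
  by_contra! hi
  refine hs ?_
  have h0 : (s : ℕ → ℝ) 0 = 1 := le_antisymm (s.le_one 0) (hi.trans (s.2.1.1 (Nat.zero_le i)))
  funext j
  rcases eq_or_ne j 0 with rfl | hj
  · simp [oneState, h0]
  · have := sum_le_hasSum {0, j} (fun k _ => s.nonneg k) s.hasSum
    rw [Finset.sum_pair hj.symm, h0] at this
    rw [oneState, Pi.single_eq_of_ne hj]
    linarith [s.nonneg j]

variable [IsProbabilityMeasure ν]

lemma powSum_lt_one (hν : ν {s | (s : ℕ → ℝ) = oneState} = 0) {p : ℝ} (hp : 1 < p) :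
    powSum ν p < 1 := by
  have pow_le : ∀ s : UnitMassSeq, ∀ i, ENNReal.ofReal ((s : ℕ → ℝ) i ^ p) ≤
      ENNReal.ofReal ((s : ℕ → ℝ) i) := fun s i =>
    ENNReal.ofReal_le_ofReal (Real.rpow_le_self_of_le_one (s.nonneg i) (s.le_one i) hp.le)
  have tsum_pow_le : ∀ s : UnitMassSeq, ∑' i, ENNReal.ofReal ((s : ℕ → ℝ) i ^ p) ≤ 1 := fun s =>
    (ENNReal.tsum_le_tsum (pow_le s)).trans (UnitMassSeq.tsum_ofReal s).le
  have tsum_pow_lt : ∀ᵐ s : UnitMassSeq ∂ν, ∑' i, ENNReal.ofReal ((s : ℕ → ℝ) i ^ p) < 1 := by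
    filter_upwards [ae_coord_lt_one ν hν] with s hs
    obtain ⟨i, hi⟩ := s.exists_pos
    rw [← UnitMassSeq.tsum_ofReal s]
    refine ENNReal.tsum_lt_tsum (i := i) ((tsum_pow_le s).trans_lt ENNReal.one_lt_top).ne
      (pow_le s) ?_
    rw [ENNReal.ofReal_lt_ofReal_iff hi]
    exact Real.rpow_lt_self_of_lt_one hi (hs i) hp
  calc powSum ν p = ∫⁻ s, ∑' i, ENNReal.ofReal ((s : ℕ → ℝ) i ^ p) ∂ν :=
        (lintegral_tsum fun i => (measurable_coord_pow p i).aemeasurable).symm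
    _ < ∫⁻ _, 1 ∂ν := by
        refine lintegral_strict_mono (IsProbabilityMeasure.ne_zero ν) aemeasurable_const ?_
          tsum_pow_lt
        exact ((lintegral_mono tsum_pow_le).trans_lt (by simp)).ne
    _ = 1 := by simp

lemma lintegral_mass_pow (p : ℝ) {f : ℝ → ℝ≥0∞} (hf : Measurable f) (u : List ℕ) :
    ∫⁻ x, ENNReal.ofReal (mass x u ^ p) * f (x u).1 ∂realLaw ν =
      (u.map (powMean ν p)).prod * ∫⁻ e, f e ∂expMeasure 1 := by
  have hmeas : ∀ u : List ℕ, Measurable fun x : Realization =>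
      ENNReal.ofReal (mass x u ^ p) * f (x u).1 := fun u =>
    ((measurable_mass u).pow_const p).ennreal_ofReal.mul (hf.comp (measurable_clock u))
  induction u using List.reverseRecOn with
  | nil => simpa [mass] using (measurePreserving_clock ν []).lintegral_comp hf
  | append_singleton w i ih =>
    rw [lintegral_graft ν [i] (hmeas _)]
    have split_graft : ∀ x y : Realization,
        ENNReal.ofReal (mass (graft [i] x y) (w ++ [i]) ^ p) * f (graft [i] x y (w ++ [i])).1 =
          ENNReal.ofReal (((x []).2 : ℕ → ℝ) i ^ p) *
            (ENNReal.ofReal (mass y w ^ p) * f (y w).1) := by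
      intro x y
      have graft_root : graft [i] x y [] = x [] := graft_of_not_suffix (by simp) _ _
      rw [mass_append, subtree_graft, graft_append, mass_singleton, graft_root,
        Real.mul_rpow (UnitMassSeq.nonneg _ _) (mass_nonneg _ _),
        ENNReal.ofReal_mul (Real.rpow_nonneg (UnitMassSeq.nonneg _ _) _), mul_assoc]
    have measurable_root : Measurable fun x : Realization =>
        ENNReal.ofReal (((x []).2 : ℕ → ℝ) i ^ p) :=
      (measurable_coord_pow p i).comp (measurePreserving_dislocation ν []).measurable
    simp_rw [split_graft, lintegral_const_mul _ (hmeas w), ih]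
    rw [lintegral_mul_const _ measurable_root,
      (measurePreserving_dislocation ν []).lintegral_comp (measurable_coord_pow p i)]
    simp only [List.map_append, List.prod_append, List.map_cons, List.map_nil, List.prod_cons,
      List.prod_nil, mul_one]
    rw [powMean]
    ring

lemma tsum_lev_prod (g : ℕ → ℝ≥0∞) (n : ℕ) :
    ∑' u : Lev n, (u.1.map g).prod = (∑' i, g i) ^ n := by
  induction n with
  | zero =>
    have eq_nil : ∀ u : Lev 0, u = ⟨[], rfl⟩ := fun u => Subtype.ext (List.length_eq_zero_iff.1 u.2)
    rw [tsum_eq_single ⟨[], rfl⟩ fun u hu => absurd (eq_nil u) hu]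
    simp
  | succ n ih =>
    rw [← (levCons n).tsum_eq, ENNReal.tsum_prod']
    simp only [levCons, Equiv.coe_fn_mk, List.map_cons, List.prod_cons]
    simp_rw [ENNReal.tsum_mul_left, ih]
    rw [ENNReal.tsum_mul_right, pow_succ']

lemma tsum_list_eq_tsum_lev (f : List ℕ → ℝ≥0∞) : ∑' u, f u = ∑' n, ∑' u : Lev n, f u.1 := by
  rw [← (Equiv.sigmaFiberEquiv (List.length (α := ℕ))).tsum_eq, ENNReal.tsum_sigma']
  rfl

lemma lintegral_tsum_mass_pow (p : ℝ) {f : ℝ → ℝ≥0∞} (hf : Measurable f) (b : ℝ≥0∞) :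
    ∫⁻ x, ∑' u : List ℕ, b ^ u.length * (ENNReal.ofReal (mass x u ^ p) * f (x u).1) ∂realLaw ν =
      (∑' n : ℕ, (b * powSum ν p) ^ n) * ∫⁻ e, f e ∂expMeasure 1 := by
  have hmeas : ∀ u : List ℕ, Measurable fun x : Realization =>
      ENNReal.ofReal (mass x u ^ p) * f (x u).1 := fun u =>
    ((measurable_mass u).pow_const p).ennreal_ofReal.mul (hf.comp (measurable_clock u))
  rw [lintegral_tsum fun u => ((hmeas u).const_mul _).aemeasurable]
  simp_rw [lintegral_const_mul _ (hmeas _), lintegral_mass_pow ν p hf, ← mul_assoc]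
  rw [ENNReal.tsum_mul_right, tsum_list_eq_tsum_lev]
  congr 1
  refine tsum_congr fun n => ?_
  rw [mul_pow, powSum, ← tsum_lev_prod, ← ENNReal.tsum_mul_left]
  exact tsum_congr fun u => by rw [u.2]

lemma ae_tsum_mass_pow_lt_top {p : ℝ} {f : ℝ → ℝ≥0∞} (hf : Measurable f)
    (hfi : ∫⁻ e, f e ∂expMeasure 1 < ∞) {b : ℝ≥0∞} (hb : b * powSum ν p < 1) :
    ∀ᵐ x ∂realLaw ν,
      ∑' u : List ℕ, b ^ u.length * (ENNReal.ofReal (mass x u ^ p) * f (x u).1) < ∞ := by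
  have hmeas : ∀ u : List ℕ, Measurable fun x : Realization =>
      b ^ u.length * (ENNReal.ofReal (mass x u ^ p) * f (x u).1) := fun u =>
    (((measurable_mass u).pow_const p).ennreal_ofReal.mul
      (hf.comp (measurable_clock u))).const_mul _
  refine ae_lt_top (Measurable.tsum hmeas) ?_
  rw [lintegral_tsum_mass_pow ν p hf, ENNReal.tsum_geometric]
  refine ENNReal.mul_ne_top (ENNReal.inv_ne_top.2 ?_) hfi.ne
  exact (tsub_pos_of_lt hb).ne'

lemma ae_tendsto_mass (hν : ν {s | (s : ℕ → ℝ) = oneState} = 0) :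
    ∀ᵐ x ∂realLaw ν, Tendsto (mass x) cofinite (𝓝 0) := by
  have ae_sum_sq_lt_top := ae_tsum_mass_pow_lt_top ν (p := 2) (f := fun _ => 1) measurable_const
    (by simp) (b := 1) (by rw [one_mul]; exact powSum_lt_one ν hν (by norm_num))
  filter_upwards [ae_sum_sq_lt_top] with x hx
  simp only [one_pow, one_mul, mul_one] at hx
  have tendsto_ofReal_sq := ENNReal.tendsto_cofinite_zero_of_tsum_ne_top hx.ne
  rw [← ENNReal.ofReal_zero] at tendsto_ofReal_sq
  have tendsto_sq : Tendsto (fun u => mass x u ^ (2 : ℝ)) cofinite (𝓝 0) := by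
    have := (ENNReal.tendsto_toReal (a := ENNReal.ofReal 0) (by simp)).comp tendsto_ofReal_sq
    simpa [Function.comp_def, mass_nonneg, Real.rpow_nonneg] using this
  have tendsto_sqrt := tendsto_sq.rpow_const (p := 1 / 2) (Or.inr (by norm_num))
  refine (tendsto_sqrt.congr fun u => ?_).trans_eq ?_
  · rw [← Real.rpow_mul (mass_nonneg x u)]; norm_num
  · rw [Real.zero_rpow (by norm_num)]

end Moments

/-! ### Bounds on the time to extinction -/

section Extinction

variable {α : ℝ} {x : Realization}

lemma exists_finset_death_sub_birth_eq_sum (x : Realization) (v w : List ℕ) :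
    ∃ F : Finset (List ℕ), (∀ z ∈ F, v <:+ z ∧ z.length ≤ (w ++ v).length) ∧
      Set.InjOn List.length (F : Set (List ℕ)) ∧
      death α x (w ++ v) - birth α x v = ∑ z ∈ F, mass x z ^ (-α) * (x z).1 := by
  induction w with
  | nil =>
    refine ⟨{v}, by simp, by simp, ?_⟩
    simp [death]
  | cons i w ih =>
    obtain ⟨F, hF, hinj, hsum⟩ := ih
    have hnot : ∀ z ∈ F, z.length ≠ (i :: w ++ v).length := fun z hz => by
      have := (hF z hz).2
      simp only [List.cons_append, List.length_cons]
      omega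
    have hmem : i :: w ++ v ∉ F := fun h => hnot _ h rfl
    refine ⟨insert (i :: w ++ v) F, ?_, ?_, ?_⟩
    · intro z hz
      rcases Finset.mem_insert.1 hz with rfl | hz
      · exact ⟨List.suffix_append _ _, le_rfl⟩
      · exact ⟨(hF z hz).1, (hF z hz).2.trans (by simp)⟩
    · rw [Finset.coe_insert, Set.injOn_insert (by simpa using hmem)]
      refine ⟨hinj, ?_⟩
      rintro ⟨z, hz, hzl⟩
      exact hnot z hz hzl
    · rw [Finset.sum_insert hmem, ← hsum]
      have death_cons : death α x (i :: w ++ v) = death α x (w ++ v) +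
        mass x (i :: w ++ v) ^ (-α) * (x (i :: w ++ v)).1 := rfl
      rw [death_cons]
      ring

lemma le_add_pow_succ_div {z δ : ℝ} (hz : 0 ≤ z) (hδ : 0 < δ) (k : ℕ) :
    z ≤ δ + z ^ (k + 1) / δ ^ k := by
  rcases le_or_gt z δ with h | h
  · exact h.trans (le_add_of_nonneg_right (by positivity))
  · have : z ≤ z ^ (k + 1) / δ ^ k := by
      rw [le_div_iff₀ (by positivity), pow_succ']
      exact mul_le_mul_of_nonneg_left (pow_le_pow_left₀ hδ.le h.le k) hz
    linarith

/-- The `(k + 1)`-st power of the life span of the block `u`, penalized by `r ^ (-|u|)`: summability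
of these weights over all blocks bounds the sum of the life spans along any line of descent. -/
def blockWeight (α r : ℝ) (k : ℕ) (x : Realization) (u : List ℕ) : ℝ :=
  (mass x u ^ (-α) * (x u).1 / r ^ u.length) ^ (k + 1)

lemma blockWeight_nonneg (hc : ClockPos x) {r : ℝ} (hr : 0 < r) (k : ℕ) (u : List ℕ) :
    0 ≤ blockWeight α r k x u := by
  have := (hc u).le
  have := mass_nonneg x u
  rw [blockWeight]
  positivity

lemma death_sub_birth_le (hc : ClockPos x) {r : ℝ} (hr : 0 < r) (hr1 : r < 1) {k : ℕ}
    {δ B : ℝ} (hδ : 0 < δ) {v : List ℕ}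
    (hB : ∀ F : Finset (List ℕ), (∀ z ∈ F, v <:+ z) → ∑ z ∈ F, blockWeight α r k x z ≤ B)
    (w : List ℕ) : death α x (w ++ v) - birth α x v ≤ δ * (1 - r)⁻¹ + B / δ ^ k := by
  obtain ⟨F, hF, hinj, hsum⟩ := exists_finset_death_sub_birth_eq_sum (α := α) x v w
  rw [hsum]
  have hterm : ∀ z ∈ F, mass x z ^ (-α) * (x z).1 ≤
      δ * r ^ z.length + blockWeight α r k x z / δ ^ k := by
    intro z _
    have hy : 0 ≤ mass x z ^ (-α) * (x z).1 :=
      mul_nonneg (Real.rpow_nonneg (mass_nonneg _ _) _) (hc z).le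
    have hrz : 0 < r ^ z.length := by positivity
    have le_split := le_add_pow_succ_div (div_nonneg hy hrz.le) hδ k
    rw [div_le_iff₀ hrz, add_mul] at le_split
    refine le_split.trans
      (add_le_add_right (mul_le_of_le_one_right ?_ (pow_le_one₀ hr.le hr1.le)) _)
    have := div_nonneg hy hrz.le
    positivity
  refine (Finset.sum_le_sum hterm).trans ?_
  rw [Finset.sum_add_distrib, ← Finset.mul_sum, ← Finset.sum_div]
  have sum_pow_length_le : ∑ z ∈ F, r ^ z.length ≤ (1 - r)⁻¹ := by
    rw [← tsum_geometric_of_lt_one hr.le hr1, ← Finset.sum_image (f := fun n => r ^ n) hinj]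
    exact (summable_geometric_of_lt_one hr.le hr1).sum_le_tsum _ fun n _ => by positivity
  have sum_weight_le := hB F fun z hz => (hF z hz).1
  gcongr

lemma bddDeathTimes_of_summable (hc : ClockPos x) {r : ℝ} (hr : 0 < r) (hr1 : r < 1) {k : ℕ}
    (hs : Summable (blockWeight α r k x)) : BddDeathTimes α x := by
  refine ⟨1 * (1 - r)⁻¹ + (∑' z, blockWeight α r k x z) / 1 ^ k, fun w _ => ?_⟩
  have := death_sub_birth_le (α := α) hc hr hr1 (k := k) one_pos (v := [])
    (fun F _ => hs.sum_le_tsum F fun z _ => blockWeight_nonneg hc hr k z) w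
  simpa [birth] using this

lemma lifetime_nonneg (hc : ClockPos x) : 0 ≤ lifetime α x := by
  refine Real.iSup_nonneg fun w => ?_
  split_ifs
  · exact (birth_nonneg hc w).trans (birth_le_death hc w)
  · exact le_rfl

lemma rpow_mul_lifetime_subtree_le (hα : α < 0) (hc : ClockPos x) {r : ℝ} (hr : 0 < r)
    (hr1 : r < 1) {k : ℕ} {δ B : ℝ} (hδ : 0 < δ) (hB0 : 0 ≤ B) {v : List ℕ}
    (hB : ∀ F : Finset (List ℕ), (∀ z ∈ F, v <:+ z) → ∑ z ∈ F, blockWeight α r k x z ≤ B) :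
    mass x v ^ (-α) * lifetime α (subtree v x) ≤ δ * (1 - r)⁻¹ + B / δ ^ k := by
  rcases (mass_nonneg x v).eq_or_lt with mass_zero | mass_pos
  · rw [← mass_zero, Real.zero_rpow (by linarith), zero_mul]
    have : 0 < 1 - r := by linarith
    positivity
  · have := dustTime_le (α := α) hc mass_pos
      (C := birth α x v + (δ * (1 - r)⁻¹ + B / δ ^ k)) (by
        rintro _ ⟨w, rfl⟩ _
        linarith [death_sub_birth_le hc hr hr1 hδ hB w])
    rw [dustTime] at this
    linarith

lemma finite_setOf_suffix_mem {ι : Type*} (S : Finset (List ι)) :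
    {v | ∃ z ∈ S, v <:+ z}.Finite := by
  have : {v | ∃ z ∈ S, v <:+ z} = ⋃ z ∈ S, {v | v <:+ z} := by
    ext v; simp
  rw [this]
  refine Set.Finite.biUnion S.finite_toSet fun z _ => ?_
  exact (List.finite_toSet z.tails).subset fun v hv => (List.mem_tails v z).2 hv

lemma tendsto_rpow_mul_lifetime_of_summable (hα : α < 0) (hc : ClockPos x) {r : ℝ} (hr : 0 < r)
    (hr1 : r < 1) {k : ℕ} (hs : Summable (blockWeight α r k x)) :
    Tendsto (fun v => mass x v ^ (-α) * lifetime α (subtree v x)) cofinite (𝓝 0) := by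
  refine tendsto_order.2 ⟨fun a ha => .of_forall fun v => ha.trans_le ?_, fun a ha => ?_⟩
  · exact mul_nonneg (Real.rpow_nonneg (mass_nonneg _ _) _) (lifetime_nonneg (hc.subtree v))
  have hr' : 0 < 1 - r := by linarith
  have hδ : 0 < a / 3 * (1 - r) := by positivity
  have hB : 0 < a / 3 * (a / 3 * (1 - r)) ^ k := by positivity
  obtain ⟨S, hS⟩ := summable_iff_vanishing_norm.1 hs _ hB
  filter_upwards [(finite_setOf_suffix_mem S).compl_mem_cofinite] with v hv
  have sum_weight_le : ∀ F : Finset (List ℕ), (∀ z ∈ F, v <:+ z) →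
      ∑ z ∈ F, blockWeight α r k x z ≤ a / 3 * (a / 3 * (1 - r)) ^ k := fun F hF => by
    refine (le_abs_self _).trans (hS F (Finset.disjoint_left.2 fun z hz hzS => ?_)).le
    exact hv ⟨z, hzS, hF z hz⟩
  refine (rpow_mul_lifetime_subtree_le hα hc hr hr1 hδ hB.le sum_weight_le).trans_lt ?_
  rw [mul_div_cancel_right₀ _ (by positivity), mul_inv_cancel_right₀ hr'.ne']
  linarith

section AlmostSure

variable (ν : Measure UnitMassSeq) [IsProbabilityMeasure ν]

lemma ae_clockPos : ∀ᵐ x ∂realLaw ν, ClockPos x :=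
  ae_all_iff.2 fun u =>
    (measurePreserving_clock ν u).quasiMeasurePreserving.ae expMeasure_ae_pos

lemma exists_ofReal_inv_pow_mul_powSum_lt_one (hν : ν {s | (s : ℕ → ℝ) = oneState} = 0)
    {q : ℝ} {k : ℕ} (hq : 1 < q) :
    ∃ r : ℝ, 0 < r ∧ r < 1 ∧ ENNReal.ofReal (r ^ (k + 1))⁻¹ * powSum ν q < 1 := by
  obtain ⟨c, powSum_lt, hc1⟩ := ENNReal.lt_iff_exists_nnreal_btwn.1 (powSum_lt_one ν hν hq)
  have hc0 : 0 < c := by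
    have : (0 : ℝ≥0∞) < c := bot_le.trans_lt powSum_lt
    exact_mod_cast this
  refine ⟨(c : ℝ) ^ (((k + 1 : ℕ) : ℝ)⁻¹), Real.rpow_pos_of_pos (by exact_mod_cast hc0) _,
    Real.rpow_lt_one c.2 (by exact_mod_cast hc1) (by positivity), ?_⟩
  rw [Real.rpow_inv_natCast_pow c.coe_nonneg (by omega),
    ENNReal.ofReal_inv_of_pos (by exact_mod_cast hc0), ENNReal.ofReal_coe_nnreal, mul_comm,
    ← div_eq_mul_inv]
  exact ENNReal.div_lt_of_lt_mul (by simpa using powSum_lt)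

lemma exists_ae_summable_blockWeight (hα : α < 0) (hν : ν {s | (s : ℕ → ℝ) = oneState} = 0) :
    ∃ (k : ℕ) (r : ℝ), 0 < r ∧ r < 1 ∧ ∀ᵐ x ∂realLaw ν, Summable (blockWeight α r k x) := by
  obtain ⟨k, hk⟩ := exists_nat_gt (1 / (-α))
  have hq : 1 < -α * ((k + 1 : ℕ) : ℝ) := by
    rw [div_lt_iff₀ (by linarith)] at hk
    push_cast
    nlinarith
  obtain ⟨r, hr0, hr1, hr⟩ := exists_ofReal_inv_pow_mul_powSum_lt_one ν hν (k := k) hq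
  refine ⟨k, r, hr0, hr1, ?_⟩
  filter_upwards [ae_tsum_mass_pow_lt_top ν (f := fun e => ENNReal.ofReal (e ^ (k + 1)))
    (by fun_prop) (lintegral_pow_expMeasure_lt_top (k + 1)) hr, ae_clockPos ν] with x hx hc
  refine (ENNReal.summable_toReal hx.ne).congr fun u => ?_
  have hm := mass_nonneg x u
  have he := (hc u).le
  rw [ENNReal.toReal_mul, ENNReal.toReal_mul, ENNReal.toReal_pow,
    ENNReal.toReal_ofReal (by positivity), ENNReal.toReal_ofReal (by positivity),
    ENNReal.toReal_ofReal (by positivity), blockWeight, div_pow, mul_pow, ← pow_mul,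
    mul_comm u.length, pow_mul, Real.rpow_mul hm, Real.rpow_natCast, inv_pow, div_eq_inv_mul]

lemma ae_bddDeathTimes (hα : α < 0) (hν : ν {s | (s : ℕ → ℝ) = oneState} = 0) :
    ∀ᵐ x ∂realLaw ν, BddDeathTimes α x := by
  obtain ⟨k, r, hr0, hr1, hs⟩ := exists_ae_summable_blockWeight ν hα hν
  filter_upwards [hs, ae_clockPos ν] with x hs hc
  exact bddDeathTimes_of_summable hc hr0 hr1 hs

lemma ae_tendsto_rpow_mul_lifetime (hα : α < 0) (hν : ν {s | (s : ℕ → ℝ) = oneState} = 0) :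
    ∀ᵐ x ∂realLaw ν,
      Tendsto (fun v => mass x v ^ (-α) * lifetime α (subtree v x)) cofinite (𝓝 0) := by
  obtain ⟨k, r, hr0, hr1, hs⟩ := exists_ae_summable_blockWeight ν hα hν
  filter_upwards [hs, ae_clockPos ν] with x hs hc
  exact tendsto_rpow_mul_lifetime_of_summable hα hc hr0 hr1 hs

/-! ### Conditioning on all but one coordinate -/

lemma ae_update {p : Realization → Prop} (h : ∀ᵐ x ∂realLaw ν, p x) (v : List ℕ) :
    ∀ᵐ x ∂realLaw ν, ∀ᵐ s ∂ν, ∀ᵐ e ∂expMeasure 1, p (Function.update x v (e, s)) := by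
  have swap_law : MeasurePreserving (fun q : Realization × (UnitMassSeq × ℝ) => (q.1, q.2.swap))
      ((realLaw ν).prod (ν.prod (expMeasure 1))) ((realLaw ν).prod (nodeLaw ν)) :=
    (MeasurePreserving.id _).prod Measure.measurePreserving_swap
  have ae_prod := ((measurePreserving_update ν v).comp swap_law).quasiMeasurePreserving.ae h
  filter_upwards [Measure.ae_ae_of_ae_prod ae_prod] with x hx
  exact Measure.ae_ae_of_ae_prod hx

lemma ae_of_ae_update {p : Realization → Prop} (hp : MeasurableSet {x | p x}) (v : List ℕ)
    (h : ∀ᵐ x ∂realLaw ν, ∀ᵐ s ∂ν, ∀ᵐ e ∂expMeasure 1, p (Function.update x v (e, s))) :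
    ∀ᵐ x ∂realLaw ν, p x := by
  rw [ae_iff, ← lintegral_indicator_one (by exact hp.compl), lintegral_update ν v
    (measurable_one.indicator (by exact hp.compl))]
  refine lintegral_eq_zero_of_ae_eq_zero ?_
  filter_upwards [h] with x hx
  refine lintegral_eq_zero_of_ae_eq_zero ?_
  filter_upwards [hx] with s hs
  refine lintegral_eq_zero_of_ae_eq_zero ?_
  filter_upwards [hs] with e he
  exact Set.indicator_of_notMem (by simpa using he) _

lemma ae_graft {p : Realization → Prop} (h : ∀ᵐ x ∂realLaw ν, p x) (v : List ℕ) :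
    ∀ᵐ x ∂realLaw ν, ∀ᵐ y ∂realLaw ν, p (graft v x y) :=
  Measure.ae_ae_of_ae_prod ((measurePreserving_graft ν v).quasiMeasurePreserving.ae h)

lemma ae_of_ae_graft {p : Realization → Prop} (hp : MeasurableSet {x | p x}) (v : List ℕ)
    (h : ∀ᵐ x ∂realLaw ν, ∀ᵐ y ∂realLaw ν, p (graft v x y)) : ∀ᵐ x ∂realLaw ν, p x := by
  rw [ae_iff, ← lintegral_indicator_one (by exact hp.compl), lintegral_graft ν v
    (measurable_one.indicator (by exact hp.compl))]
  refine lintegral_eq_zero_of_ae_eq_zero ?_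
  filter_upwards [h] with x hx
  refine lintegral_eq_zero_of_ae_eq_zero ?_
  filter_upwards [hx] with y hy
  exact Set.indicator_of_notMem (by simpa using hy) _

/-! ### No ties -/

lemma ae_lifetime_ne (hα : α < 0) (hν : ν {s | (s : ℕ → ℝ) = oneState} = 0) (c : ℝ) :
    ∀ᵐ x ∂realLaw ν, lifetime α x ≠ c := by
  have hset : MeasurableSet {x : Realization | lifetime α x ≠ c} :=
    measurable_lifetime (measurableSet_singleton c).compl
  refine ae_of_ae_update ν hset [] ?_
  filter_upwards [ae_update ν ((ae_clockPos ν).and (ae_bddDeathTimes ν hα hν)) []] with x hx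
  filter_upwards [hx] with s hs
  obtain ⟨e₀, hc₀, hb₀⟩ := hs.exists
  -- The lifetime minus the first clock does not depend on the latter, which has a diffuse law.
  have clock_ne : ∀ᵐ e ∂expMeasure 1,
      e ≠ c - (lifetime α (Function.update x [] (e₀, s)) - e₀) := by
    rw [ae_iff]
    simp
  filter_upwards [hs, clock_ne] with e ⟨hc, hb⟩ hne hlife
  refine hne ?_
  have sub_le := (agreeExceptClock_update [] x s e e₀).lifetime_sub_le hb hc₀
  have le_sub := (agreeExceptClock_update [] x s e₀ e).lifetime_sub_le hb₀ hc
  simp only [Function.update_self] at sub_le le_sub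
  linarith

lemma ae_childLifetime_ne (hα : α < 0) (hν : ν {s | (s : ℕ → ℝ) = oneState} = 0) {i j : ℕ}
    (hij : i ≠ j) : ∀ᵐ x ∂realLaw ν, 0 < ((x []).2 : ℕ → ℝ) i →
      childLifetime α x i ≠ childLifetime α x j := by
  have hm : Measurable fun x : Realization => ((x []).2 : ℕ → ℝ) i := by
    simpa only [mass_singleton] using measurable_mass [i]
  have hset : MeasurableSet {x : Realization | 0 < ((x []).2 : ℕ → ℝ) i →
      childLifetime α x i ≠ childLifetime α x j} := by
    refine MeasurableSet.imp (measurableSet_lt measurable_const hm) ?_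
    exact (measurableSet_eq_fun (measurable_childLifetime i) (measurable_childLifetime j)).compl
  refine ae_of_ae_graft ν hset [i] (.of_forall fun x => ?_)
  filter_upwards [ae_lifetime_ne ν hα hν (childLifetime α x j / ((x []).2 : ℕ → ℝ) i ^ (-α))]
    with y hy
  have graft_root : graft [i] x y [] = x [] := graft_of_not_suffix (by simp) _ _
  have subtree_other : subtree [j] (graft [i] x y) = subtree [j] x :=
    subtree_graft_of_incomparable (fun h => hij (by simpa using (h.eq_of_length rfl).symm))
      (fun h => hij (by simpa using h.eq_of_length rfl)) _ _
  rw [graft_root]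
  intro hpos heq
  rw [childLifetime, childLifetime, graft_root, subtree_graft, subtree_other] at heq
  refine hy ?_
  rw [eq_div_iff (Real.rpow_pos_of_pos hpos _).ne', mul_comm, heq, childLifetime]

end AlmostSure

end Extinction

/-! ### No mass is reduced to dust at a single time -/

section PairGaps

variable {α : ℝ}

/-- A bound for the probability that the death of a block of mass `m` falls within `δ` of a given
time. -/
def gapBound (α δ m : ℝ) : ℝ≥0∞ := min 1 (ENNReal.ofReal (2 * δ / m ^ (-α)))

lemma measurable_gapBound (δ : ℝ) : Measurable (gapBound α δ) := by
  unfold gapBound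
  exact measurable_const.min (((measurable_id.pow_const _).const_div _).ennreal_ofReal)

lemma gapBound_le_one (δ m : ℝ) : gapBound α δ m ≤ 1 := min_le_left _ _

lemma tendsto_gapBound (m : ℝ) :
    Tendsto (fun j : ℕ => gapBound α (1 / ((j : ℝ) + 1)) m) atTop (𝓝 0) := by
  have ratio_tendsto : Tendsto (fun j : ℕ => ENNReal.ofReal (2 * (1 / ((j : ℝ) + 1)) / m ^ (-α)))
      atTop (𝓝 (ENNReal.ofReal (2 * 0 / m ^ (-α)))) :=
    ENNReal.tendsto_ofReal
      ((tendsto_one_div_add_atTop_nhds_zero_nat.const_mul 2).div_const _)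
  rw [mul_zero, zero_div, ENNReal.ofReal_zero] at ratio_tendsto
  exact tendsto_of_tendsto_of_tendsto_of_le_of_le tendsto_const_nhds ratio_tendsto
    (fun _ => zero_le) fun _ => min_le_right _ _

lemma lintegral_indicator_abs_lt_le (c δ : ℝ) {m : ℝ} {M : ℝ≥0∞} (hm : 0 ≤ m)
    (hM : m = 0 → M = 0) :
    ∫⁻ e, M * {e | |c + m ^ (-α) * e| < δ}.indicator 1 e ∂expMeasure 1 ≤ M * gapBound α δ m := by
  have measurableSet_gap : MeasurableSet {e | |c + m ^ (-α) * e| < δ} :=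
    measurableSet_lt (by fun_prop) measurable_const
  rw [lintegral_const_mul _ (measurable_one.indicator measurableSet_gap),
    lintegral_indicator_one measurableSet_gap]
  rcases hm.eq_or_lt with hm | hm
  · rw [hM hm.symm, zero_mul, zero_mul]
  · gcongr
    exact le_min prob_le_one (expMeasure_setOf_abs_lt_le _ (Real.rpow_pos_of_pos hm _) δ)

lemma tsum_mass_mul_indicator_add (x : Realization) {k : ℕ} (u : Lev k) (c : ℝ≥0∞) :
    ∑' u' : Lev k, ENNReal.ofReal (mass x u'.1) * (({u} : Set (Lev k)).indicator 1 u' + c) =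
      ENNReal.ofReal (mass x u.1) + c := by
  simp_rw [mul_add]
  rw [ENNReal.tsum_add, ENNReal.tsum_mul_right, tsum_lev_mass, one_mul, tsum_eq_single u]
  · simp
  · intro u' hu'
    simp [hu']

lemma tsum_pair_mass_mul_indicator_add (x : Realization) (l k : ℕ) (δ : ℝ) :
    ∑' p : (Lev l × Lev k) × (Lev l × Lev k),
      ENNReal.ofReal (mass x (p.1.1.1 ++ p.1.2.1)) * ENNReal.ofReal (mass x (p.2.1.1 ++ p.2.2.1)) *
        (({p.1.2} : Set (Lev k)).indicator 1 p.2.2 + gapBound α δ (mass x p.1.2.1)) =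
      (∑' u : Lev k, ENNReal.ofReal (mass x u.1 ^ (2 : ℝ))) +
        ∑' u : Lev k, ENNReal.ofReal (mass x u.1) * gapBound α δ (mass x u.1) := by
  rw [ENNReal.tsum_prod', ENNReal.tsum_prod', ENNReal.tsum_comm, ← ENNReal.tsum_add]
  refine tsum_congr fun u => ?_
  have sum_over_second (v : Lev l) : ∑' q : Lev l × Lev k,
      ENNReal.ofReal (mass x (v.1 ++ u.1)) * ENNReal.ofReal (mass x (q.1.1 ++ q.2.1)) *
        (({u} : Set (Lev k)).indicator 1 q.2 + gapBound α δ (mass x u.1)) =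
      ENNReal.ofReal (mass x (v.1 ++ u.1)) *
        (ENNReal.ofReal (mass x u.1) + gapBound α δ (mass x u.1)) := by
    simp_rw [mul_assoc]
    rw [ENNReal.tsum_mul_left, ENNReal.tsum_prod', ENNReal.tsum_comm,
      ← tsum_mass_mul_indicator_add x u]
    congr 1
    refine tsum_congr fun u' => ?_
    simp only
    rw [ENNReal.tsum_mul_right, tsum_lev_mass_append]
  simp_rw [sum_over_second]
  rw [ENNReal.tsum_mul_right, tsum_lev_mass_append, mul_add, Real.rpow_two, sq,
    ENNReal.ofReal_mul (mass_nonneg _ _)]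

lemma pairMass_add_eq_tsum (x : Realization) (l k : ℕ) (δ : ℝ) :
    pairMass α x (l + k) δ = ∑' p : (Lev l × Lev k) × (Lev l × Lev k),
      {x : Realization | |birth α x (p.1.1.1 ++ p.1.2.1) - birth α x (p.2.1.1 ++ p.2.2.1)| <
        δ}.indicator (fun x => ENNReal.ofReal (mass x (p.1.1.1 ++ p.1.2.1)) *
          ENNReal.ofReal (mass x (p.2.1.1 ++ p.2.2.1))) x := by
  rw [pairMass, ← ((levAppend l k).prodCongr (levAppend l k)).tsum_eq]
  refine tsum_congr fun p => ?_
  simp only [Set.indicator]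
  rfl

section AlmostSure

variable (ν : Measure UnitMassSeq) [IsProbabilityMeasure ν]

lemma measurable_pair_indicator (v v' : List ℕ) (δ : ℝ) :
    Measurable fun x : Realization => {x : Realization | |birth α x v - birth α x v'| < δ}.indicator
      (fun x => ENNReal.ofReal (mass x v) * ENNReal.ofReal (mass x v')) x := by
  refine Measurable.indicator
    ((measurable_mass _).ennreal_ofReal.mul (measurable_mass _).ennreal_ofReal) ?_
  have := (measurable_birth (α := α) v).sub (measurable_birth (α := α) v')
  exact measurableSet_lt (continuous_abs.measurable.comp this) measurable_const

lemma birth_sub_birth_update {u v v' : List ℕ} (hu : u <:+ v) (hu' : ¬ u <:+ v') (i j : ℕ)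
    (x : Realization) (e : ℝ) (s : UnitMassSeq) :
    birth α (Function.update x u (e, s)) (i :: v) -
        birth α (Function.update x u (e, s)) (j :: v') =
      birth α (Function.update x u (0, s)) (i :: v) -
        birth α (Function.update x u (0, s)) (j :: v') +
        mass (Function.update x u (0, s)) u ^ (-α) * e := by
  have agree := agreeExceptClock_update u x s 0 e
  have death_v := agree.death_eq (α := α) v
  have death_v' := agree.death_eq (α := α) v'
  simp only [if_pos hu, if_neg hu', Function.update_self, sub_zero, add_zero] at death_v death_v'
  change death α _ v - death α _ v' = death α _ v - death α _ v' + _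
  rw [death_v, death_v']
  ring

lemma lintegral_pair_le {u u' v v' : List ℕ} (hlen : u.length = u'.length) (hne : u ≠ u')
    (hu : u <:+ v) (hu' : u' <:+ v') (i j : ℕ) (δ : ℝ) :
    ∫⁻ x, {x : Realization | |birth α x (i :: v) - birth α x (j :: v')| < δ}.indicator
      (fun x => ENNReal.ofReal (mass x (i :: v)) * ENNReal.ofReal (mass x (j :: v'))) x
        ∂realLaw ν ≤
      ∫⁻ x, ENNReal.ofReal (mass x (i :: v)) * ENNReal.ofReal (mass x (j :: v')) *
        gapBound α δ (mass x u) ∂realLaw ν := by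
  have not_suffix : ¬ u <:+ v' := fun h => hne (eq_of_suffix_of_suffix_of_length_eq h hu' hlen)
  have measurable_bound : Measurable fun x : Realization => ENNReal.ofReal (mass x (i :: v)) *
      ENNReal.ofReal (mass x (j :: v')) * gapBound α δ (mass x u) :=
    ((measurable_mass _).ennreal_ofReal.mul (measurable_mass _).ennreal_ofReal).mul
      ((measurable_gapBound δ).comp (measurable_mass u))
  rw [lintegral_update ν u (measurable_pair_indicator _ _ _),
    lintegral_update ν u measurable_bound]
  refine lintegral_mono fun x => lintegral_mono fun s => ?_
  let z : ℝ → Realization := fun e => Function.update x u (e, s)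
  have agree (e : ℝ) : AgreeExceptClock u (z 0) (z e) := agreeExceptClock_update u x s 0 e
  have mass_z (e : ℝ) (w : List ℕ) : mass (z e) w = mass (z 0) w := (agree e).mass_eq w
  have mass_eq_zero (mass_u : mass (z 0) u = 0) : mass (z 0) (i :: v) = 0 := by
    obtain ⟨w, rfl⟩ := hu
    exact le_antisymm ((mass_append_le (z 0) (i :: w) u).trans mass_u.le) (mass_nonneg _ _)
  set M := ENNReal.ofReal (mass (z 0) (i :: v)) * ENNReal.ofReal (mass (z 0) (j :: v'))
  calc (∫⁻ e, {x : Realization | |birth α x (i :: v) - birth α x (j :: v')| < δ}.indicator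
      (fun x => ENNReal.ofReal (mass x (i :: v)) * ENNReal.ofReal (mass x (j :: v'))) (z e)
        ∂expMeasure 1)
      = ∫⁻ e, M * {e | |(birth α (z 0) (i :: v) - birth α (z 0) (j :: v')) +
          mass (z 0) u ^ (-α) * e| < δ}.indicator 1 e ∂expMeasure 1 :=
      lintegral_congr fun e => by
        simp only [Set.indicator, Set.mem_ofPred_eq, z,
          birth_sub_birth_update hu not_suffix i j x e s, mass_z e, M, Pi.one_apply,
          mul_ite, mul_one, mul_zero]
    _ ≤ M * gapBound α δ (mass (z 0) u) :=
      lintegral_indicator_abs_lt_le _ _ (mass_nonneg _ _) fun mass_u => by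
        simp [M, mass_eq_zero mass_u]
    _ = ∫⁻ _, M * gapBound α δ (mass (z 0) u) ∂expMeasure 1 := by simp
    _ = ∫⁻ e, ENNReal.ofReal (mass (z e) (i :: v)) * ENNReal.ofReal (mass (z e) (j :: v')) *
        gapBound α δ (mass (z e) u) ∂expMeasure 1 :=
      lintegral_congr fun e => by simp only [mass_z e, M]

lemma lintegral_pairMass_le_lintegral_tsum (l k : ℕ) (δ : ℝ) :
    ∫⁻ x, pairMass α x (l + 1 + k) δ ∂realLaw ν ≤
      ∫⁻ x, ∑' p : (Lev (l + 1) × Lev k) × (Lev (l + 1) × Lev k),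
        ENNReal.ofReal (mass x (p.1.1.1 ++ p.1.2.1)) *
          ENNReal.ofReal (mass x (p.2.1.1 ++ p.2.2.1)) *
          (({p.1.2} : Set (Lev k)).indicator 1 p.2.2 + gapBound α δ (mass x p.1.2.1))
        ∂realLaw ν := by
  have measurable_term (p : (Lev (l + 1) × Lev k) × (Lev (l + 1) × Lev k)) :
      Measurable fun x : Realization =>
        ENNReal.ofReal (mass x (p.1.1.1 ++ p.1.2.1)) *
          ENNReal.ofReal (mass x (p.2.1.1 ++ p.2.2.1)) *
          (({p.1.2} : Set (Lev k)).indicator 1 p.2.2 + gapBound α δ (mass x p.1.2.1)) :=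
    ((measurable_mass _).ennreal_ofReal.mul (measurable_mass _).ennreal_ofReal).mul
      (measurable_const.add ((measurable_gapBound δ).comp (measurable_mass _)))
  simp_rw [pairMass_add_eq_tsum]
  rw [lintegral_tsum fun p => (measurable_pair_indicator _ _ _).aemeasurable,
    lintegral_tsum fun p => (measurable_term p).aemeasurable]
  refine ENNReal.tsum_le_tsum fun p => ?_
  obtain ⟨⟨⟨v, hv⟩, ⟨u, hu⟩⟩, ⟨⟨v', hv'⟩, ⟨u', hu'⟩⟩⟩ := p
  obtain ⟨i, v, rfl⟩ := List.exists_cons_of_length_eq_add_one hv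
  obtain ⟨j, v', rfl⟩ := List.exists_cons_of_length_eq_add_one hv'
  by_cases huu : u = u'
  · subst huu
    refine lintegral_mono fun x => ?_
    refine (Set.indicator_le_self _ _ _).trans (le_mul_of_one_le_right zero_le ?_)
    simp
  · refine (lintegral_pair_le ν (hu.trans hu'.symm) huu (List.suffix_append v u)
      (List.suffix_append v' u') i j δ).trans (lintegral_mono fun x => ?_)
    simp only [List.cons_append]
    gcongr
    exact le_add_self

lemma lintegral_pairMass_le (l k : ℕ) (δ : ℝ) :
    ∫⁻ x, pairMass α x (l + 1 + k) δ ∂realLaw ν ≤ powSum ν 2 ^ k +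
      ∫⁻ x, ∑' u : Lev k, ENNReal.ofReal (mass x u.1) * gapBound α δ (mass x u.1) ∂realLaw ν := by
  refine (lintegral_pairMass_le_lintegral_tsum ν l k δ).trans (le_of_eq ?_)
  have measurable_sq (u : Lev k) :
      Measurable fun x : Realization => ENNReal.ofReal (mass x u.1 ^ (2 : ℝ)) :=
    ((measurable_mass _).pow_const _).ennreal_ofReal
  have lintegral_sq (u : Lev k) : ∫⁻ x, ENNReal.ofReal (mass x u.1 ^ (2 : ℝ)) ∂realLaw ν =
      (u.1.map (powMean ν 2)).prod := by
    simpa using lintegral_mass_pow ν 2 (f := fun _ => 1) measurable_const u.1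
  simp_rw [tsum_pair_mass_mul_indicator_add]
  rw [lintegral_add_left (Measurable.tsum measurable_sq),
    lintegral_tsum fun u => (measurable_sq u).aemeasurable]
  simp_rw [lintegral_sq]
  rw [tsum_lev_prod, powSum]

lemma tendsto_lintegral_gapBound (k : ℕ) :
    Tendsto (fun j : ℕ => ∫⁻ x, ∑' u : Lev k, ENNReal.ofReal (mass x u.1) *
      gapBound α (1 / ((j : ℝ) + 1)) (mass x u.1) ∂realLaw ν) atTop (𝓝 0) := by
  have hterm : ∀ (x : Realization) (δ : ℝ) (u : Lev k),
      ENNReal.ofReal (mass x u.1) * gapBound α δ (mass x u.1) ≤ ENNReal.ofReal (mass x u.1) :=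
    fun x δ u => mul_le_of_le_one_right zero_le (gapBound_le_one _ _)
  have hm : ∀ δ : ℝ, Measurable fun x : Realization => ∑' u : Lev k, ENNReal.ofReal (mass x u.1) *
      gapBound α δ (mass x u.1) := fun δ => Measurable.tsum fun u =>
    (measurable_mass _).ennreal_ofReal.mul ((measurable_gapBound δ).comp (measurable_mass _))
  have key := tendsto_lintegral_of_dominated_convergence (μ := realLaw ν)
    (F := fun (j : ℕ) (x : Realization) => ∑' u : Lev k, ENNReal.ofReal (mass x u.1) *
      gapBound α (1 / ((j : ℝ) + 1)) (mass x u.1)) (f := 0) (fun _ => 1) (fun j => hm _)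
    (fun j => .of_forall fun x => ?_) (by simp) (.of_forall fun x => ?_)
  · simpa using key
  · exact (ENNReal.tsum_le_tsum (hterm x _)).trans (tsum_lev_mass x k).le
  · let _ : MeasurableSpace (Lev k) := ⊤
    simp_rw [← lintegral_count]
    have := tendsto_lintegral_of_dominated_convergence (μ := (Measure.count : Measure (Lev k)))
      (F := fun (j : ℕ) (u : Lev k) => ENNReal.ofReal (mass x u.1) *
        gapBound α (1 / ((j : ℝ) + 1)) (mass x u.1)) (f := 0)
      (fun u => ENNReal.ofReal (mass x u.1)) (fun j => measurable_from_top)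
      (fun j => .of_forall fun u => hterm x _ u) (by rw [lintegral_count, tsum_lev_mass]; simp)
      (.of_forall fun u => ?_)
    · simpa using this
    · have := ENNReal.Tendsto.const_mul (a := ENNReal.ofReal (mass x u.1))
        (tendsto_gapBound (α := α) (mass x u.1)) (Or.inr ENNReal.ofReal_ne_top)
      simpa using this

lemma mul_realLaw_le_liminf_pairMass_le (η : ℝ≥0∞) (k : ℕ) (δ : ℝ) :
    η * realLaw ν {x | η ≤ liminf (fun n => pairMass α x n δ) atTop} ≤ powSum ν 2 ^ k +
      ∫⁻ x, ∑' u : Lev k, ENNReal.ofReal (mass x u.1) * gapBound α δ (mass x u.1) ∂realLaw ν :=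
  calc
    _ ≤ ∫⁻ x, liminf (fun n => pairMass α x n δ) atTop ∂realLaw ν :=
      mul_meas_ge_le_lintegral (Measurable.liminf fun n => measurable_pairMass n _) η
    _ ≤ liminf (fun n => ∫⁻ x, pairMass α x n δ ∂realLaw ν) atTop :=
      lintegral_liminf_le fun n => measurable_pairMass n _
    _ ≤ _ := by
      refine liminf_le_of_frequently_le' (Eventually.frequently ?_)
      filter_upwards [eventually_ge_atTop (k + 1)] with n hn
      obtain ⟨l, rfl⟩ : ∃ l, n = l + 1 + k := ⟨n - (k + 1), by omega⟩
      exact lintegral_pairMass_le ν l k _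

lemma ae_exists_frequently_pairMass_lt (hν : ν {s | (s : ℕ → ℝ) = oneState} = 0) {η : ℝ≥0∞}
    (hη : 0 < η) : ∀ᵐ x ∂realLaw ν, ∃ δ : ℝ, 0 < δ ∧ ∃ᶠ n in atTop, pairMass α x n δ < η := by
  set bad : Set Realization :=
    {x | ∀ j : ℕ, η ≤ liminf (fun n => pairMass α x n (1 / ((j : ℝ) + 1))) atTop}
  have mul_bad_le_pow (k : ℕ) : η * realLaw ν bad ≤ powSum ν 2 ^ k := by
    have tendsto_bound := (tendsto_lintegral_gapBound (α := α) ν k).const_add (powSum ν 2 ^ k)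
    rw [add_zero] at tendsto_bound
    refine ge_of_tendsto' tendsto_bound fun j => le_trans ?_
      (mul_realLaw_le_liminf_pairMass_le (α := α) ν η k _)
    gcongr
    exact fun x hx => hx j
  have mul_bad_le_zero : η * realLaw ν bad ≤ 0 :=
    ge_of_tendsto' (ENNReal.tendsto_pow_atTop_nhds_zero_of_lt_one
      (powSum_lt_one ν hν (by norm_num))) mul_bad_le_pow
  have bad_null : realLaw ν bad = 0 :=
    (mul_eq_zero.1 (le_antisymm mul_bad_le_zero zero_le)).resolve_left hη.ne'
  rw [ae_iff]
  refine measure_mono_null (fun x hx => ?_) bad_null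
  intro j
  by_contra! hlt
  refine hx ⟨1 / ((j : ℝ) + 1), by positivity, ?_⟩
  exact frequently_lt_of_liminf_lt (by isBoundedDefault) hlt

lemma ae_isRegularAtRoot (hα : α < 0) (hν : ν {s | (s : ℕ → ℝ) = oneState} = 0) :
    ∀ᵐ x ∂realLaw ν, IsRegularAtRoot α x := by
  have ae_lt_one : ∀ᵐ x ∂realLaw ν, ∀ i, ((x []).2 : ℕ → ℝ) i < 1 :=
    (measurePreserving_dislocation ν []).quasiMeasurePreserving.ae (ae_coord_lt_one ν hν)
  have ae_no_ties : ∀ᵐ x ∂realLaw ν, ∀ i j, i ≠ j → 0 < ((x []).2 : ℕ → ℝ) i →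
      childLifetime α x i ≠ childLifetime α x j := by
    simp only [ae_all_iff]
    exact fun i j hij => ae_childLifetime_ne ν hα hν hij
  have ae_gaps : ∀ᵐ x ∂realLaw ν, ∀ m : ℕ, ∃ δ : ℝ, 0 < δ ∧
      ∃ᶠ n in atTop, pairMass α x n δ < (m : ℝ≥0∞)⁻¹ :=
    ae_all_iff.2 fun m => ae_exists_frequently_pairMass_lt ν hν (by simp)
  filter_upwards [ae_clockPos ν, ae_lt_one, ae_bddDeathTimes ν hα hν, ae_tendsto_mass ν hν,
    ae_tendsto_rpow_mul_lifetime ν hα hν, ae_no_ties, ae_gaps]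
    with x hclock hlt hbdd hmass hlifetime hties hgaps
  refine ⟨hclock [], hlt, hbdd, hmass, hlifetime, fun i j hij hi _ => hties i j hij hi,
    fun η hη => ?_⟩
  obtain ⟨m, hm⟩ := ENNReal.exists_inv_nat_lt hη.ne'
  obtain ⟨δ, hδ, hfreq⟩ := hgaps m
  exact ⟨δ, hδ, hfreq.mono fun n hn => hn.trans hm⟩

lemma ae_isRegular (hα : α < 0) (hν : ν {s | (s : ℕ → ℝ) = oneState} = 0) :
    ∀ᵐ x ∂realLaw ν, IsRegular α x :=
  ae_all_iff.2 fun v =>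
    (measurePreserving_subtree ν v).quasiMeasurePreserving.ae (ae_isRegularAtRoot ν hα hν)

end AlmostSure

end PairGaps

/-! ### Changing the fragmentation of a sibling of the spine -/

section Siblings

variable {α : ℝ} {x : Realization}

/-- The time that is left, in the units of the `m`-th block that splits off at the `n`-th split of
the last fragment. -/
def siblingTime (α : ℝ) (x : Realization) (n m : ℕ) : ℝ :=
  mass x (siblingLabel α x n m) ^ α * (lifetime α x - spineTime α x (n + 1))

/-- The time-reversed fragmentation of the `m`-th block that splits off at the `n`-th split of
the last fragment. -/
def siblingPath (α : ℝ) (x : Realization) (n m : ℕ) : ℝ≥0 → ℕ → ℝ :=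
  revPath α (subtree (siblingLabel α x n m) x) (siblingTime α x n m)

lemma birth_siblingLabel (n m : ℕ) :
    birth α x (siblingLabel α x n m) = spineTime α x (n + 1) := rfl

lemma length_siblingLabel (n m : ℕ) : (siblingLabel α x n m).length = n + 1 := by
  simp [siblingLabel]

lemma siblingLabel_ne_spine (n m : ℕ) : siblingLabel α x n m ≠ spine α x (n + 1) := by
  intro h
  rw [siblingLabel, spine] at h
  exact siblingIndex_ne _ _ (List.cons.inj h).1

lemma not_siblingLabel_suffix_spine (n m k : ℕ) : ¬ siblingLabel α x n m <:+ spine α x k := by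
  intro h
  have hlen := h.length_le
  rw [length_siblingLabel, length_spine] at hlen
  exact siblingLabel_ne_spine n m <| eq_of_suffix_of_suffix_of_length_eq h
    (spine_suffix α x hlen) (by rw [length_siblingLabel, length_spine])

lemma not_spine_suffix_siblingLabel {n k : ℕ} (hk : n < k) (m : ℕ) :
    ¬ spine α x k <:+ siblingLabel α x n m := by
  intro h
  have hlen := h.length_le
  rw [length_spine, length_siblingLabel] at hlen
  obtain rfl : k = n + 1 := by omega
  exact siblingLabel_ne_spine n m
    (h.eq_of_length (by rw [length_siblingLabel, length_spine])).symm

lemma not_siblingLabel_suffix_siblingLabel {n m n' m' : ℕ} (h : (n, m) ≠ (n', m')) :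
    ¬ siblingLabel α x n m <:+ siblingLabel α x n' m' := by
  intro hs
  rw [siblingLabel.eq_def α x n' m', List.suffix_cons_iff] at hs
  rcases hs with hs | hs
  · obtain rfl : n = n' := by
      simpa [length_siblingLabel] using congrArg List.length hs
    rw [siblingLabel] at hs
    exact h (by rw [siblingIndex_injective _ (List.cons.inj hs).1])
  · exact not_siblingLabel_suffix_spine _ _ _ hs

lemma IsRegular.lifetime_sibling_lt (hα : α < 0) (h : IsRegular α x) {n m : ℕ}
    (hm : 0 < mass x (siblingLabel α x n m)) :
    lifetime α (subtree (siblingLabel α x n m) x) < siblingTime α x n m := by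
  have dust_lt : dustTime α x (siblingLabel α x n m) < dustTime α x (spine α x n) :=
    h.dustTime_cons_lt hα (h.mass_spine_pos hα n) (siblingIndex_ne _ _)
  rw [h.dustTime_spine hα, dustTime, birth_siblingLabel, Real.rpow_neg hm.le] at dust_lt
  rw [siblingTime, ← inv_mul_lt_iff₀ (Real.rpow_pos_of_pos hm _)]
  linarith

/-- The realizations `x` and `z` differ at most in the fragmentation of the block `v`. -/
def AgreeOff (v : List ℕ) (x z : Realization) : Prop := ∀ u, ¬ v <:+ u → z u = x u

lemma agreeOff_graft (v : List ℕ) (x y y' : Realization) :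
    AgreeOff v (graft v x y) (graft v x y') := fun u hu => by
  rw [graft_of_not_suffix hu, graft_of_not_suffix hu]

lemma not_suffix_of_not_suffix_cons {v u : List ℕ} {i : ℕ} (h : ¬ v <:+ i :: u) : ¬ v <:+ u :=
  fun hu => h (hu.trans (List.suffix_cons _ _))

lemma AgreeOff.mass_eq {v : List ℕ} {x z : Realization} (h : AgreeOff v x z) :
    ∀ {u : List ℕ}, ¬ v <:+ u → mass z u = mass x u
  | [], _ => rfl
  | i :: u, hu => by
    have hu' := not_suffix_of_not_suffix_cons hu
    rw [mass, mass, h.mass_eq hu', h u hu']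

lemma AgreeOff.birth_eq {v : List ℕ} {x z : Realization} (h : AgreeOff v x z) :
    ∀ {u : List ℕ}, ¬ v <:+ u → birth α z u = birth α x u
  | [], _ => rfl
  | i :: u, hu => by
    have hu' := not_suffix_of_not_suffix_cons hu
    rw [birth, birth, h.birth_eq hu', h.mass_eq hu', h u hu']

lemma AgreeOff.death_eq {v : List ℕ} {x z : Realization} (h : AgreeOff v x z) {u : List ℕ}
    (hu : ¬ v <:+ u) : death α z u = death α x u := by
  rw [death, death, h.birth_eq hu, h.mass_eq hu, h u hu]

lemma AgreeOff.mass_cons_eq {v : List ℕ} {x z : Realization} (h : AgreeOff v x z) {u : List ℕ}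
    (hu : ¬ v <:+ u) (i : ℕ) : mass z (i :: u) = mass x (i :: u) := by
  rw [mass, mass, h.mass_eq hu, h u hu]

lemma AgreeOff.subtree_eq {v : List ℕ} {x z : Realization} (h : AgreeOff v x z) {u : List ℕ}
    (hvu : ¬ v <:+ u) (huv : ¬ u <:+ v) : subtree u z = subtree u x := by
  funext w
  refine h _ fun hw => ?_
  rcases List.suffix_or_suffix_of_suffix hw (List.suffix_append w u) with h | h
  exacts [hvu h, huv h]

/-- `z` is obtained from `x` by changing the fragmentation of the block that splits off the spine at
the index `(n, m)`, in such a way that the block is still not the last to be reduced to dust. -/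
structure SiblingChange (α : ℝ) (n m : ℕ) (x z : Realization) : Prop where
  isRegular : IsRegular α x
  isRegular' : IsRegular α z
  pos : 0 < mass x (siblingLabel α x n m)
  agree : AgreeOff (siblingLabel α x n m) x z
  lt : lifetime α (subtree (siblingLabel α x n m) z) < siblingTime α x n m

namespace SiblingChange

variable {n m : ℕ} {z : Realization}

lemma dustTime_spine_eq (hα : α < 0) (h : SiblingChange α n m x z) {k : ℕ} (hk : n < k) :
    dustTime α z (spine α x k) = lifetime α x := by
  have hns := not_siblingLabel_suffix_spine (α := α) (x := x) n m k
  rw [dustTime, h.agree.birth_eq hns, h.agree.mass_eq hns,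
    h.agree.subtree_eq hns (not_spine_suffix_siblingLabel hk m), ← dustTime,
    h.isRegular.dustTime_spine hα]

lemma lifetime_eq (hα : α < 0) (h : SiblingChange α n m x z) : lifetime α z = lifetime α x := by
  have hns := not_siblingLabel_suffix_spine (α := α) (x := x) n m
  have dustTime_siblingLabel_lt : dustTime α z (siblingLabel α x n m) < lifetime α x := by
    have hlt := h.lt
    rw [siblingTime, ← inv_mul_lt_iff₀ (Real.rpow_pos_of_pos h.pos _),
      ← Real.rpow_neg h.pos.le] at hlt
    have birth_eq : birth α z (siblingLabel α x n m) = spineTime α x (n + 1) :=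
      h.agree.death_eq (hns n)
    have mass_eq : mass z (siblingLabel α x n m) = mass x (siblingLabel α x n m) :=
      h.agree.mass_cons_eq (hns n) _
    rw [dustTime, birth_eq, mass_eq]
    linarith
  refine le_antisymm (lifetime_le h.isRegular'.clockPos fun w hw => ?_) ?_
  · by_cases hv : siblingLabel α x n m <:+ w
    · exact (death_le_dustTime h.isRegular'.bdd hv hw).trans dustTime_siblingLabel_lt.le
    · rw [h.agree.death_eq hv]
      rw [h.agree.mass_eq hv] at hw
      exact death_le_lifetime h.isRegular.bdd hw
  · rw [← h.dustTime_spine_eq hα n.lt_succ_self]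
    refine h.isRegular'.dustTime_le_lifetime ?_
    rw [h.agree.mass_eq (hns _)]
    exact h.isRegular.mass_spine_pos hα _

lemma spine_eq (hα : α < 0) (h : SiblingChange α n m x z) (k : ℕ) : spine α z k = spine α x k := by
  have spine_eq_of_lt (k : ℕ) (hk : n < k) : spine α z k = spine α x k := by
    have mass_pos : 0 < mass z (spine α x k) := by
      rw [h.agree.mass_eq (not_siblingLabel_suffix_spine n m k)]
      exact h.isRegular.mass_spine_pos hα _
    simpa using (h.isRegular'.eq_spine hα mass_pos
      ((h.dustTime_spine_eq hα hk).trans (h.lifetime_eq hα).symm)).symm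
  rcases lt_or_ge n k with hk | hk
  · exact spine_eq_of_lt k hk
  · refine eq_of_suffix_of_suffix_of_length_eq (w := spine α x (n + 1)) ?_
      (spine_suffix α x (by omega)) (by simp)
    rw [← spine_eq_of_lt _ n.lt_succ_self]
    exact spine_suffix α z (by omega)

lemma mass_spine_eq (hα : α < 0) (h : SiblingChange α n m x z) (k : ℕ) :
    mass z (spine α z k) = mass x (spine α x k) := by
  rw [h.spine_eq hα, h.agree.mass_eq (not_siblingLabel_suffix_spine n m k)]

lemma spineTime_eq (hα : α < 0) (h : SiblingChange α n m x z) (k : ℕ) :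
    spineTime α z k = spineTime α x k := by
  rw [spineTime, spineTime, h.spine_eq hα, h.agree.birth_eq (not_siblingLabel_suffix_spine n m k)]

lemma siblingLabel_eq (hα : α < 0) (h : SiblingChange α n m x z) (n' m' : ℕ) :
    siblingLabel α z n' m' = siblingLabel α x n' m' := by
  have cons_eq := h.spine_eq hα (n' + 1)
  rw [spine, spine] at cons_eq
  rw [siblingLabel, siblingLabel, (List.cons.inj cons_eq).1, (List.cons.inj cons_eq).2]

lemma mass_siblingLabel_eq (hα : α < 0) (h : SiblingChange α n m x z) (n' m' : ℕ) :
    mass z (siblingLabel α z n' m') = mass x (siblingLabel α x n' m') := by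
  rw [h.siblingLabel_eq hα]
  exact h.agree.mass_cons_eq (not_siblingLabel_suffix_spine n m n') _

lemma siblingTime_eq (hα : α < 0) (h : SiblingChange α n m x z) (n' m' : ℕ) :
    siblingTime α z n' m' = siblingTime α x n' m' := by
  rw [siblingTime, siblingTime, h.mass_siblingLabel_eq hα, h.lifetime_eq hα, h.spineTime_eq hα]

lemma spineCount_eq (hα : α < 0) (h : SiblingChange α n m x z) (ε : ℝ) :
    spineCount α ε z = spineCount α ε x := by
  simp_rw [spineCount, h.lifetime_eq hα, h.spineTime_eq hα]

lemma siblingPath_eq (hα : α < 0) (h : SiblingChange α n m x z) {n' m' : ℕ}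
    (hne : (n', m') ≠ (n, m)) : siblingPath α z n' m' = siblingPath α x n' m' := by
  rw [siblingPath, siblingPath, h.siblingTime_eq hα, h.siblingLabel_eq hα,
    h.agree.subtree_eq (not_siblingLabel_suffix_siblingLabel hne.symm)
      (not_siblingLabel_suffix_siblingLabel hne)]

lemma chain_eq (hα : α < 0) (h : SiblingChange α n m x z) : chain α z = chain α x := by
  funext k
  have hΘ : chainΘ α z k = chainΘ α x k := by
    cases k with
    | zero => rfl
    | succ k =>
      rw [h.isRegular'.chainΘ_succ hα, h.isRegular.chainΘ_succ hα, h.mass_spine_eq hα,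
        h.mass_spine_eq hα]
  have hΔ : chainΔ α z k = chainΔ α x k := by
    funext j
    cases k with
    | zero => rfl
    | succ k =>
      rw [h.isRegular'.chainΔ_succ hα, h.isRegular.chainΔ_succ hα, h.mass_spine_eq hα,
        h.mass_siblingLabel_eq hα]
  have hZ : chainZ α z k = chainZ α x k := by
    rw [h.isRegular'.chainZ_eq hα, h.isRegular.chainZ_eq hα, h.mass_spine_eq hα, h.lifetime_eq hα,
      h.spineTime_eq hα]
  rw [chain, chain, hΘ, hΔ, hZ]

end SiblingChange

/-- The function `f` vanishes if the `(n, m)`-th block that splits off the spine has no mass, and it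
does not depend on the fragmentation of this block. -/
def SiblingInvariant (α : ℝ) (n m : ℕ) (f : Realization → ℝ≥0∞) : Prop :=
  (∀ z, IsRegular α z → f z ≠ 0 → 0 < mass z (siblingLabel α z n m)) ∧
    ∀ x z, SiblingChange α n m x z → f z = f x

lemma SiblingInvariant.mul {n m : ℕ} {f g : Realization → ℝ≥0∞} (hf : SiblingInvariant α n m f)
    (hg : ∀ x z, SiblingChange α n m x z → g z = g x) : SiblingInvariant α n m fun z => f z * g z :=
  ⟨fun z hz h0 => hf.1 z hz (left_ne_zero_of_mul h0), fun x z h => by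
    simp only [hf.2 x z h, hg x z h]⟩

lemma siblingChange_graft {n m : ℕ} {f : Realization → ℝ≥0∞} (hinv : SiblingInvariant α n m f)
    {v : List ℕ} (hv : ∀ z, IsRegular α z → f z ≠ 0 → siblingLabel α z n m = v)
    {y y' : Realization} (hy : IsRegular α (graft v x y)) (hne : f (graft v x y) ≠ 0)
    (hy' : IsRegular α (graft v x y'))
    (hlt : lifetime α y' < siblingTime α (graft v x y) n m) :
    SiblingChange α n m (graft v x y) (graft v x y') where
  isRegular := hy
  isRegular' := hy'
  pos := hinv.1 _ hy hne
  agree := by rw [hv _ hy hne]; exact agreeOff_graft v x y y'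
  lt := by rwa [hv _ hy hne, subtree_graft]

lemma SiblingChange.siblingPath_graft (hα : α < 0) {n m : ℕ} {v : List ℕ} {z y : Realization}
    (h : SiblingChange α n m z (graft v x y)) (hv : siblingLabel α z n m = v) :
    siblingPath α (graft v x y) n m = revPath α y (siblingTime α z n m) := by
  rw [siblingPath, h.siblingTime_eq hα, h.siblingLabel_eq hα, hv, subtree_graft]

lemma SiblingInvariant.graft_eq_zero (hα : α < 0) {n m : ℕ} {f : Realization → ℝ≥0∞}
    (hinv : SiblingInvariant α n m f) {v : List ℕ}
    (hv : ∀ z, IsRegular α z → f z ≠ 0 → siblingLabel α z n m = v) {y y' : Realization}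
    (hy : IsRegular α (graft v x y)) (hne : f (graft v x y) ≠ 0)
    (hy' : IsRegular α (graft v x y'))
    (hle : siblingTime α (graft v x y) n m ≤ lifetime α y') : f (graft v x y') = 0 := by
  by_contra hne'
  have lifetime_lt := hy.lifetime_sibling_lt hα (hinv.1 _ hy hne)
  have lifetime_lt' := hy'.lifetime_sibling_lt hα (hinv.1 _ hy' hne')
  rw [hv _ hy hne, subtree_graft] at lifetime_lt
  rw [hv _ hy' hne', subtree_graft] at lifetime_lt'
  have change := siblingChange_graft hinv hv hy' hne' hy
    ((lifetime_lt.trans_le hle).trans lifetime_lt')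
  exact (hle.trans_lt lifetime_lt').ne (change.siblingTime_eq hα n m)

lemma SiblingInvariant.graft_mul_indicator_siblingPath (hα : α < 0) {n m : ℕ}
    {f : Realization → ℝ≥0∞} (hinv : SiblingInvariant α n m f) {v : List ℕ}
    (hv : ∀ z, IsRegular α z → f z ≠ 0 → siblingLabel α z n m = v) {y₀ y : Realization}
    (hy₀ : IsRegular α (graft v x y₀)) (hne : f (graft v x y₀) ≠ 0)
    (hy : IsRegular α (graft v x y)) (B : Set (ℝ≥0 → ℕ → ℝ)) :
    f (graft v x y) * B.indicator 1 (siblingPath α (graft v x y) n m) =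
      f (graft v x y₀) * ({y | lifetime α y < siblingTime α (graft v x y₀) n m} ∩
        {y | revPath α y (siblingTime α (graft v x y₀) n m) ∈ B}).indicator 1 y := by
  rcases lt_or_ge (lifetime α y) (siblingTime α (graft v x y₀) n m) with hlt | hge
  · have change := siblingChange_graft hinv hv hy₀ hne hy hlt
    rw [hinv.2 _ _ change, change.siblingPath_graft hα (hv _ hy₀ hne)]
    by_cases hyB : revPath α y (siblingTime α (graft v x y₀) n m) ∈ B
    · rw [Set.indicator_of_mem hyB, Set.indicator_of_mem (by exact ⟨hlt, hyB⟩)]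
      rfl
    · rw [Set.indicator_of_notMem hyB, Set.indicator_of_notMem fun hmem => hyB hmem.2]
  · rw [hinv.graft_eq_zero hα hv hy₀ hne hy hge, zero_mul,
      Set.indicator_of_notMem fun hmem => not_lt.2 hge hmem.1, mul_zero]

/-! ### Measurability -/

lemma measurable_mass_siblingLabel (n m : ℕ) :
    Measurable fun x : Realization => mass x (siblingLabel α x n m) :=
  measurable_of_discrete_index (f := fun w x => mass x w) (measurableSet_siblingLabel n m)
    measurable_mass

lemma measurable_siblingTime (n m : ℕ) : Measurable fun x : Realization => siblingTime α x n m :=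
  ((measurable_mass_siblingLabel n m).pow_const _).mul
    (measurable_lifetime.sub (measurable_spineTime _))

lemma measurable_siblingPath (n m : ℕ) : Measurable fun x : Realization => siblingPath α x n m :=
  measurable_revPath (measurable_pi_lambda _ fun u =>
    measurable_of_discrete_index (f := fun w (x : Realization) => x (u ++ w))
      (measurableSet_siblingLabel n m) fun _ => measurable_pi_apply _) (measurable_siblingTime n m)

lemma lintegral_eq_tsum_lintegral_fiber {β κ : Type*} [MeasurableSpace β] {μ : Measure β}
    [Countable κ] {g : β → κ} (hg : ∀ w, MeasurableSet {z | g z = w}) (F : β → ℝ≥0∞) :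
    ∫⁻ z, F z ∂μ = ∑' w, ∫⁻ z, {z | g z = w}.indicator 1 z * F z ∂μ := by
  have iUnion_fiber : ⋃ w, {z | g z = w} = Set.univ := Set.eq_univ_of_forall fun z => by simp
  have disjoint_fiber : Pairwise (Function.onFun Disjoint fun w => {z | g z = w}) :=
    fun w w' hne => Set.disjoint_left.2 fun z hz hz' => hne (hz.symm.trans hz')
  rw [← setLIntegral_univ, ← iUnion_fiber, lintegral_iUnion hg disjoint_fiber]
  refine tsum_congr fun w => ?_
  rw [← lintegral_indicator (hg w)]
  refine lintegral_congr fun z => ?_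
  rw [← Set.indicator_mul_left, Pi.one_def]
  simp only [one_mul]

/-! ### The conditional law of the fragmentation of a sibling -/

section Law

variable (ν : Measure UnitMassSeq)

/-- The law of the time-reversal, from time `c`, of the fragmentation conditioned to become extinct
before time `c`. -/
def revLaw (α c : ℝ) (B : Set (ℝ≥0 → ℕ → ℝ)) : ℝ≥0∞ :=
  (realLaw ν {x | lifetime α x < c})⁻¹ *
    realLaw ν ({x | lifetime α x < c} ∩ {x | revPath α x c ∈ B})

lemma SiblingInvariant.graft_mul_revLaw_siblingTime (hα : α < 0) {n m : ℕ}
    {f : Realization → ℝ≥0∞} (hinv : SiblingInvariant α n m f) {v : List ℕ}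
    (hv : ∀ z, IsRegular α z → f z ≠ 0 → siblingLabel α z n m = v) {y₀ y : Realization}
    (hy₀ : IsRegular α (graft v x y₀)) (hne : f (graft v x y₀) ≠ 0)
    (hy : IsRegular α (graft v x y)) (B : Set (ℝ≥0 → ℕ → ℝ)) :
    f (graft v x y) * revLaw ν α (siblingTime α (graft v x y) n m) B =
      f (graft v x y₀) * revLaw ν α (siblingTime α (graft v x y₀) n m) B *
        {y | lifetime α y < siblingTime α (graft v x y₀) n m}.indicator 1 y := by
  rcases lt_or_ge (lifetime α y) (siblingTime α (graft v x y₀) n m) with hlt | hge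
  · have change := siblingChange_graft hinv hv hy₀ hne hy hlt
    rw [hinv.2 _ _ change, change.siblingTime_eq hα, Set.indicator_of_mem (by exact hlt),
      Pi.one_apply, mul_one]
  · rw [hinv.graft_eq_zero hα hv hy₀ hne hy hge, zero_mul,
      Set.indicator_of_notMem (by exact not_lt.2 hge), mul_zero]

variable [IsProbabilityMeasure ν]

lemma measurable_revLaw {B : Set (ℝ≥0 → ℕ → ℝ)} (hB : MeasurableSet B) :
    Measurable fun c => revLaw ν α c B := by
  have measurableSet_lifetime_lt : MeasurableSet {p : ℝ × Realization | lifetime α p.2 < p.1} :=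
    measurableSet_lt (measurable_lifetime.comp measurable_snd) measurable_fst
  have measurableSet_revPath_mem : MeasurableSet {p : ℝ × Realization | revPath α p.2 p.1 ∈ B} :=
    measurable_revPath measurable_snd measurable_fst hB
  exact (measurable_measure_prodMk_left measurableSet_lifetime_lt).inv.mul
    (measurable_measure_prodMk_left (measurableSet_lifetime_lt.inter measurableSet_revPath_mem))

lemma mul_revLaw (c : ℝ) (B : Set (ℝ≥0 → ℕ → ℝ)) :
    realLaw ν {x | lifetime α x < c} * revLaw ν α c B =
      realLaw ν ({x | lifetime α x < c} ∩ {x | revPath α x c ∈ B}) := by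
  rw [revLaw, ← mul_assoc]
  by_cases h0 : realLaw ν {x | lifetime α x < c} = 0
  · rw [h0, zero_mul, zero_mul, measure_mono_null Set.inter_subset_left h0]
  · rw [ENNReal.mul_inv_cancel h0 (measure_ne_top _ _), one_mul]

lemma measurable_mul_indicator_siblingPath {n m : ℕ} {B : Set (ℝ≥0 → ℕ → ℝ)}
    (hB : MeasurableSet B) {f : Realization → ℝ≥0∞} (hf : Measurable f) :
    Measurable fun z => f z * B.indicator 1 (siblingPath α z n m) :=
  hf.mul ((measurable_one.indicator hB).comp (measurable_siblingPath n m))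

lemma measurable_mul_revLaw_siblingTime {n m : ℕ} {B : Set (ℝ≥0 → ℕ → ℝ)}
    (hB : MeasurableSet B) {f : Realization → ℝ≥0∞} (hf : Measurable f) :
    Measurable fun z => f z * revLaw ν α (siblingTime α z n m) B :=
  hf.mul ((measurable_revLaw ν hB).comp (measurable_siblingTime n m))

lemma lintegral_graft_sibling (hα : α < 0) {n m : ℕ} {B : Set (ℝ≥0 → ℕ → ℝ)}
    (hB : MeasurableSet B) {f : Realization → ℝ≥0∞} (hinv : SiblingInvariant α n m f)
    {v : List ℕ} (hv : ∀ z, IsRegular α z → f z ≠ 0 → siblingLabel α z n m = v)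
    (hx : ∀ᵐ y ∂realLaw ν, IsRegular α (graft v x y)) :
    ∫⁻ y, f (graft v x y) * B.indicator 1 (siblingPath α (graft v x y) n m) ∂realLaw ν =
      ∫⁻ y, f (graft v x y) * revLaw ν α (siblingTime α (graft v x y) n m) B ∂realLaw ν := by
  by_cases hex : ∃ y, IsRegular α (graft v x y) ∧ f (graft v x y) ≠ 0
  · obtain ⟨y₀, hy₀, hne⟩ := hex
    set c₀ := siblingTime α (graft v x y₀) n m
    have measurableSet_lt_c₀ : MeasurableSet {y : Realization | lifetime α y < c₀} :=
      measurableSet_lt measurable_lifetime measurable_const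
    have measurableSet_mem_B : MeasurableSet {y : Realization | revPath α y c₀ ∈ B} :=
      measurable_revPath measurable_id measurable_const hB
    rw [lintegral_congr_ae
        (hx.mono fun y hy => hinv.graft_mul_indicator_siblingPath hα hv hy₀ hne hy B),
      lintegral_congr_ae
        (hx.mono fun y hy => hinv.graft_mul_revLaw_siblingTime ν hα hv hy₀ hne hy B),
      lintegral_const_mul _
        (measurable_one.indicator (measurableSet_lt_c₀.inter measurableSet_mem_B)),
      lintegral_const_mul _ (measurable_one.indicator measurableSet_lt_c₀),
      lintegral_indicator_one (measurableSet_lt_c₀.inter measurableSet_mem_B),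
      lintegral_indicator_one measurableSet_lt_c₀, ← mul_revLaw, mul_assoc,
      mul_comm (revLaw ν α c₀ B)]
  · push Not at hex
    refine lintegral_congr_ae ?_
    filter_upwards [hx] with y hy
    rw [hex y hy, zero_mul, zero_mul]

lemma lintegral_sibling_of_label (hα : α < 0) (hν : ν {s | (s : ℕ → ℝ) = oneState} = 0) {n m : ℕ}
    {B : Set (ℝ≥0 → ℕ → ℝ)} (hB : MeasurableSet B) {f : Realization → ℝ≥0∞} (hf : Measurable f)
    (hinv : SiblingInvariant α n m f) {v : List ℕ}
    (hv : ∀ z, IsRegular α z → f z ≠ 0 → siblingLabel α z n m = v) :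
    ∫⁻ z, f z * B.indicator 1 (siblingPath α z n m) ∂realLaw ν =
      ∫⁻ z, f z * revLaw ν α (siblingTime α z n m) B ∂realLaw ν := by
  rw [lintegral_graft ν v (measurable_mul_indicator_siblingPath hB hf),
    lintegral_graft ν v (measurable_mul_revLaw_siblingTime ν hB hf)]
  refine lintegral_congr_ae ?_
  filter_upwards [ae_graft ν (ae_isRegular ν hα hν) v] with x hx
  exact lintegral_graft_sibling ν hα hB hinv hv hx

lemma lintegral_sibling (hα : α < 0) (hν : ν {s | (s : ℕ → ℝ) = oneState} = 0) {n m : ℕ}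
    {B : Set (ℝ≥0 → ℕ → ℝ)} (hB : MeasurableSet B) {f : Realization → ℝ≥0∞} (hf : Measurable f)
    (hinv : SiblingInvariant α n m f) :
    ∫⁻ z, f z * B.indicator 1 (siblingPath α z n m) ∂realLaw ν =
      ∫⁻ z, f z * revLaw ν α (siblingTime α z n m) B ∂realLaw ν := by
  have measurableSet_label := measurableSet_siblingLabel (α := α) n m
  rw [lintegral_eq_tsum_lintegral_fiber measurableSet_label,
    lintegral_eq_tsum_lintegral_fiber measurableSet_label
      fun z => f z * revLaw ν α (siblingTime α z n m) B]
  refine tsum_congr fun v => ?_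
  simp_rw [← mul_assoc]
  refine lintegral_sibling_of_label ν hα hν hB
    ((measurable_one.indicator (measurableSet_label v)).mul hf)
    ⟨fun z hz hne => hinv.1 z hz (right_ne_zero_of_mul hne), fun x z h => ?_⟩ (v := v)
    fun z _ hne => ?_
  · simp only [Set.indicator, Set.mem_ofPred_eq, h.siblingLabel_eq hα, Pi.one_apply, hinv.2 x z h]
  · by_contra hlabel
    exact left_ne_zero_of_mul hne (Set.indicator_of_notMem (by exact hlabel) _)

lemma lintegral_prod_sibling (hα : α < 0) (hν : ν {s | (s : ℕ → ℝ) = oneState} = 0) {ι : Type*}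
    (s : Finset ι) {e : ι → ℕ × ℕ} (he : Set.InjOn e s) {B : ι → Set (ℝ≥0 → ℕ → ℝ)}
    (hB : ∀ p, MeasurableSet (B p)) {f : Realization → ℝ≥0∞} (hf : Measurable f)
    (hinv : ∀ p ∈ s, SiblingInvariant α (e p).1 (e p).2 f) :
    ∫⁻ z, f z * ∏ p ∈ s, (B p).indicator 1 (siblingPath α z (e p).1 (e p).2) ∂realLaw ν =
      ∫⁻ z, f z * ∏ p ∈ s, revLaw ν α (siblingTime α z (e p).1 (e p).2) (B p) ∂realLaw ν := by
  classical
  induction s using Finset.induction_on generalizing f with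
  | empty => simp
  | insert a s ha ih =>
    have hne : ∀ p ∈ s, e p ≠ e a := fun p hp hpa =>
      ha (he (by simp [hp]) (by simp) hpa ▸ hp)
    have measurable_path : Measurable fun z => (B a).indicator (1 : (ℝ≥0 → ℕ → ℝ) → ℝ≥0∞)
        (siblingPath α z (e a).1 (e a).2) :=
      (measurable_one.indicator (hB a)).comp (measurable_siblingPath _ _)
    have induction_step := ih (he.mono (by simp)) (hf.mul measurable_path) (fun p hp =>
      (hinv p (Finset.mem_insert_of_mem hp)).mul fun x z h => by
        rw [h.siblingPath_eq hα (by simpa using (hne p hp).symm)])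
    have measurable_laws : Measurable fun z =>
        ∏ p ∈ s, revLaw ν α (siblingTime α z (e p).1 (e p).2) (B p) :=
      Finset.measurable_prod s fun p _ =>
        (measurable_revLaw ν (hB p)).comp (measurable_siblingTime _ _)
    have replace_path := lintegral_sibling ν hα hν (hB a) (hf.mul measurable_laws)
      ((hinv a (Finset.mem_insert_self _ _)).mul fun x z h => by
        simp only [h.siblingTime_eq hα])
    calc _ = ∫⁻ z, f z * (B a).indicator 1 (siblingPath α z (e a).1 (e a).2) *
          ∏ p ∈ s, (B p).indicator 1 (siblingPath α z (e p).1 (e p).2) ∂realLaw ν := by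
          refine lintegral_congr fun z => ?_
          rw [Finset.prod_insert ha, mul_assoc]
      _ = _ := induction_step
      _ = ∫⁻ z, f z * (∏ p ∈ s, revLaw ν α (siblingTime α z (e p).1 (e p).2) (B p)) *
          (B a).indicator 1 (siblingPath α z (e a).1 (e a).2) ∂realLaw ν := by
          refine lintegral_congr fun z => ?_
          simp only [Pi.mul_apply]
          ring
      _ = _ := replace_path
      _ = _ := by
          refine lintegral_congr fun z => ?_
          simp only [Pi.mul_apply]
          rw [Finset.prod_insert ha]
          ring

end Law

end Siblings

/-! ### The chain and the re-centering, in terms of the spine -/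

section Recentering

variable {α ε : ℝ} {x : Realization}

/-- The ratio of the masses of consecutive blocks of the spine. -/
def spineRatio (α : ℝ) (x : Realization) : ℕ → ℝ
  | 0 => 1
  | n + 1 => mass x (spine α x (n + 1)) / mass x (spine α x n)

/-- The relative masses of the siblings of a block of the spine. -/
def spineSibling (α : ℝ) (x : Realization) : ℕ → ℕ → ℝ
  | 0, _ => 0
  | n + 1, m => mass x (siblingLabel α x n m) / mass x (spine α x n)

/-- The chain of the rescaled remaining lifetimes, mass ratios and relative sibling masses, in terms
of the spine. -/
def spineChain (α : ℝ) (x : Realization) : ℕ → ℝ × ℝ × (ℕ → ℝ) := fun n =>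
  (mass x (spine α x n) ^ α * (lifetime α x - spineTime α x n), spineRatio α x n,
    spineSibling α x n)

lemma IsRegular.chain_eq (hα : α < 0) (h : IsRegular α x) : chain α x = spineChain α x := by
  funext n
  have chainΘ_eq : chainΘ α x n = spineRatio α x n := by
    cases n with
    | zero => rfl
    | succ n => exact h.chainΘ_succ hα n
  have chainΔ_eq : chainΔ α x n = spineSibling α x n := by
    funext m
    cases n with
    | zero => rfl
    | succ n => exact h.chainΔ_succ hα n m
  rw [chain, spineChain, chainΘ_eq, chainΔ_eq, h.chainZ_eq hα]

lemma measurable_spineChain : Measurable fun x : Realization => spineChain α x := by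
  refine measurable_pi_lambda _ fun n => ?_
  refine (((measurable_mass_spine n).pow_const _).mul
    (measurable_lifetime.sub (measurable_spineTime n))).prodMk (Measurable.prodMk ?_ ?_)
  · cases n with
    | zero => exact measurable_const
    | succ n => exact (measurable_mass_spine _).div (measurable_mass_spine n)
  · refine measurable_pi_lambda _ fun m => ?_
    cases n with
    | zero => exact measurable_const
    | succ n => exact (measurable_mass_siblingLabel n m).div (measurable_mass_spine n)

/-- The generation, shifted by `-1`, of the blocks that split off at the time `T_{N_ε + i}`. -/
def siblingLevel (α ε : ℝ) (x : Realization) (i : ℤ) : ℕ := ((spineCount α ε x : ℤ) + i - 1).toNat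

/-- The property of being an index of a block that splits off the spine, in terms of the spine. -/
def IsSiblingIndex (α ε : ℝ) (x : Realization) (i : ℤ) (m : ℕ) : Prop :=
  ε ≤ lifetime α x ∧ 1 ≤ (spineCount α ε x : ℤ) + i ∧
    0 < mass x (siblingLabel α x (siblingLevel α ε x i) m)

lemma IsRegular.shift_eq (hα : α < 0) (h : IsRegular α x) (hε : 0 < ε) (hl : ε ≤ lifetime α x)
    {i : ℤ} (hi : 1 ≤ (spineCount α ε x : ℤ) + i) :
    (NepsInt α x ε + i).toNat = siblingLevel α ε x i + 1 := by
  rw [h.NepsInt_eq hα hε hl, siblingLevel]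
  omega

lemma IsRegular.shiftΔ_eq (hα : α < 0) (h : IsRegular α x) (hε : 0 < ε) (hl : ε ≤ lifetime α x)
    {i : ℤ} (hi : 1 ≤ (spineCount α ε x : ℤ) + i) (m : ℕ) :
    shiftΔ α x ε i m = mass x (siblingLabel α x (siblingLevel α ε x i) m) /
      mass x (spine α x (siblingLevel α ε x i)) := by
  rw [shiftΔ, h.shift_eq hα hε hl hi, h.chainΔ_succ hα]

lemma IsRegular.isIndex_iff (hα : α < 0) (h : IsRegular α x) (hε : 0 < ε) (i : ℤ) (m : ℕ) :
    IsIndex α x ε i m ↔ IsSiblingIndex α ε x i m := by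
  rw [IsIndex, IsSiblingIndex, h.Neps_ne_bot_iff hα hε]
  refine and_congr_right fun hl => ?_
  have one_le_iff : -NepsInt α x ε + 1 ≤ i ↔ 1 ≤ (spineCount α ε x : ℤ) + i := by
    rw [h.NepsInt_eq hα hε hl]
    omega
  rw [one_le_iff]
  refine and_congr_right fun hi => ?_
  rw [h.shiftΔ_eq hα hε hl hi, div_pos_iff_of_pos_right (h.mass_spine_pos hα _)]

lemma IsRegular.condTime_eq (hα : α < 0) (h : IsRegular α x) (hε : 0 < ε) {i : ℤ} {m : ℕ}
    (hi : IsSiblingIndex α ε x i m) :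
    condTime α x ε i m = siblingTime α x (siblingLevel α ε x i) m := by
  obtain ⟨hl, one_le, sibling_pos⟩ := hi
  have parent_pos := h.mass_spine_pos hα (siblingLevel α ε x i)
  have child_pos := h.mass_spine_pos hα (siblingLevel α ε x i + 1)
  have parent_ne := (Real.rpow_pos_of_pos parent_pos α).ne'
  have child_ne := (Real.rpow_pos_of_pos child_pos α).ne'
  rw [condTime, h.shiftΔ_eq hα hε hl one_le, h.shift_eq hα hε hl one_le, h.chainΘ_succ hα,
    h.chainZ_eq hα, siblingTime, Real.div_rpow sibling_pos.le parent_pos.le,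
    Real.div_rpow child_pos.le parent_pos.le, Real.rpow_neg child_pos.le,
    Real.rpow_neg parent_pos.le]
  field_simp

lemma measurableSet_isSiblingIndex (i : ℤ) (m : ℕ) :
    MeasurableSet {x : Realization | IsSiblingIndex α ε x i m} := by
  refine (measurableSet_le measurable_const measurable_lifetime).inter (MeasurableSet.inter ?_ ?_)
  · exact measurable_spineCount ε (MeasurableSet.of_discrete (s := {n : ℕ | 1 ≤ (n : ℤ) + i}))
  · exact measurableSet_lt measurable_const
      (measurable_of_discrete_index (g := fun x => spineCount α ε x)
        (f := fun N x => mass x (siblingLabel α x ((N : ℤ) + i - 1).toNat m))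
        (fun N => measurable_spineCount ε (measurableSet_singleton N))
        fun _ => measurable_mass_siblingLabel _ m)

/-- The time-reversed fragmentation of a block that splits off from the spine, as a function of the
re-centered index. -/
def shiftPath (α ε : ℝ) (x : Realization) (i : ℤ) (m : ℕ) : ℝ≥0 → ℕ → ℝ :=
  siblingPath α x (siblingLevel α ε x i) m

lemma measurable_shiftPath (i : ℤ) (m : ℕ) :
    Measurable fun x : Realization => shiftPath α ε x i m :=
  measurable_of_discrete_index (g := fun x => spineCount α ε x)
    (f := fun N x => siblingPath α x ((N : ℤ) + i - 1).toNat m)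
    (fun N => measurable_spineCount ε (measurableSet_singleton N))
    fun _ => measurable_siblingPath _ m

/-- The time left to a block that splits off from the spine, as a function of the re-centered
index. -/
def shiftTime (α ε : ℝ) (x : Realization) (i : ℤ) (m : ℕ) : ℝ :=
  siblingTime α x (siblingLevel α ε x i) m

lemma measurable_shiftTime (i : ℤ) (m : ℕ) :
    Measurable fun x : Realization => shiftTime α ε x i m :=
  measurable_of_discrete_index (g := fun x => spineCount α ε x)
    (f := fun N x => siblingTime α x ((N : ℤ) + i - 1).toNat m)
    (fun N => measurable_spineCount ε (measurableSet_singleton N))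
    fun _ => measurable_siblingTime _ m

lemma IsRegular.isRevPath_shiftPath (hα : α < 0) (h : IsRegular α x) {i : ℤ} {m : ℕ}
    (hi : IsSiblingIndex α ε x i m) : IsRevPath (shiftTime α ε x i m) (shiftPath α ε x i m) :=
  (h.toSubtree _).isRevPath (h.lifetime_sibling_lt hα hi.2.2).le

/-! ### Conditional independence -/

section Law

variable (ν : Measure UnitMassSeq)

/-- The event that the chain lies in `A` and that the elements of `s` are indices of blocks that
split off from the spine. -/
def indexEvent (α ε : ℝ) (s : Finset (ℤ × ℕ)) (A : Set (ℕ → ℝ × ℝ × (ℕ → ℝ))) : Set Realization :=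
  {x | spineChain α x ∈ A ∧ ∀ p ∈ s, IsSiblingIndex α ε x p.1 p.2}

lemma measurableSet_indexEvent (s : Finset (ℤ × ℕ)) {A : Set (ℕ → ℝ × ℝ × (ℕ → ℝ))}
    (hA : MeasurableSet A) : MeasurableSet (indexEvent α ε s A) := by
  have eq_inter : indexEvent α ε s A =
      {x | spineChain α x ∈ A} ∩ ⋂ p ∈ s, {x | IsSiblingIndex α ε x p.1 p.2} := by
    ext x; simp [indexEvent]
  rw [eq_inter]
  exact (measurable_spineChain hA).inter
    (Finset.measurableSet_biInter _ fun p _ => measurableSet_isSiblingIndex p.1 p.2)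

lemma measurableSet_shiftPath_mem (s : Finset (ℤ × ℕ)) {B : ℤ × ℕ → Set (ℝ≥0 → ℕ → ℝ)}
    (hB : ∀ p, MeasurableSet (B p)) :
    MeasurableSet {x : Realization | ∀ p ∈ s, shiftPath α ε x p.1 p.2 ∈ B p} := by
  rw [show {x : Realization | ∀ p ∈ s, shiftPath α ε x p.1 p.2 ∈ B p} =
      ⋂ p ∈ s, {x | shiftPath α ε x p.1 p.2 ∈ B p} by ext; simp]
  exact Finset.measurableSet_biInter _ fun p _ => measurable_shiftPath p.1 p.2 (hB p)

lemma SiblingChange.mem_indexEvent_iff (hα : α < 0) {n m : ℕ} {x z : Realization}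
    (h : SiblingChange α n m x z) (s : Finset (ℤ × ℕ)) (A : Set (ℕ → ℝ × ℝ × (ℕ → ℝ))) :
    z ∈ indexEvent α ε s A ↔ x ∈ indexEvent α ε s A := by
  change (_ ∧ _) ↔ (_ ∧ _)
  rw [← h.isRegular.chain_eq hα, ← h.isRegular'.chain_eq hα, h.chain_eq hα]
  simp only [IsSiblingIndex, siblingLevel, h.spineCount_eq hα, h.lifetime_eq hα,
    h.mass_siblingLabel_eq hα]

/-- The event `indexEvent`, on which moreover the re-centering index `N_ε` is `N`. -/
def countIndexEvent (α ε : ℝ) (N : ℕ) (s : Finset (ℤ × ℕ)) (A : Set (ℕ → ℝ × ℝ × (ℕ → ℝ))) :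
    Set Realization :=
  {x | spineCount α ε x = N} ∩ indexEvent α ε s A

lemma measurableSet_countIndexEvent (N : ℕ) (s : Finset (ℤ × ℕ))
    {A : Set (ℕ → ℝ × ℝ × (ℕ → ℝ))} (hA : MeasurableSet A) :
    MeasurableSet (countIndexEvent α ε N s A) :=
  (measurable_spineCount ε (measurableSet_singleton N)).inter (measurableSet_indexEvent s hA)

lemma siblingInvariant_countIndexEvent (hα : α < 0) (N : ℕ) {s : Finset (ℤ × ℕ)}
    (A : Set (ℕ → ℝ × ℝ × (ℕ → ℝ))) {p : ℤ × ℕ} (hp : p ∈ s) :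
    SiblingInvariant α ((N : ℤ) + p.1 - 1).toNat p.2
      ((countIndexEvent α ε N s A).indicator 1) := by
  refine ⟨fun z _ hz => ?_, fun x z h => Set.indicator_eq_indicator (and_congr ?_ ?_) rfl⟩
  · obtain ⟨count_eq, hz⟩ := Set.mem_of_indicator_ne_zero hz
    have sibling_pos := (hz.2 p hp).2.2
    rwa [siblingLevel, count_eq] at sibling_pos
  · change spineCount α ε z = N ↔ spineCount α ε x = N
    rw [h.spineCount_eq hα]
  · exact h.mem_indexEvent_iff hα s A

lemma injOn_level {N : ℕ} {s : Finset (ℤ × ℕ)} (hs : ∀ p ∈ s, 1 ≤ (N : ℤ) + p.1) :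
    Set.InjOn (fun p : ℤ × ℕ => (((N : ℤ) + p.1 - 1).toNat, p.2)) s := by
  rintro p hp q hq hpq
  have hp₁ := hs p hp
  have hq₁ := hs q hq
  obtain ⟨level_eq, rank_eq⟩ := Prod.ext_iff.1 hpq
  dsimp only at level_eq
  exact Prod.ext (by omega) rank_eq

lemma lintegral_countIndexEvent_mul_prod (μ : Measure Realization) (N : ℕ) (s : Finset (ℤ × ℕ))
    (A : Set (ℕ → ℝ × ℝ × (ℕ → ℝ))) (Φ : ℤ × ℕ → Realization → ℕ → ℝ≥0∞) :
    ∫⁻ z, (countIndexEvent α ε N s A).indicator 1 z *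
        ∏ p ∈ s, Φ p z (siblingLevel α ε z p.1) ∂μ =
      ∫⁻ z, (countIndexEvent α ε N s A).indicator 1 z *
        ∏ p ∈ s, Φ p z ((N : ℤ) + p.1 - 1).toNat ∂μ := by
  refine lintegral_congr fun z => ?_
  by_cases hz : z ∈ countIndexEvent α ε N s A
  · simp only [siblingLevel, show spineCount α ε z = N from hz.1]
  · rw [Set.indicator_of_notMem hz, zero_mul, zero_mul]

variable [IsProbabilityMeasure ν]

lemma lintegral_shiftPath_of_count (hα : α < 0) (hν : ν {s | (s : ℕ → ℝ) = oneState} = 0)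
    (N : ℕ) (s : Finset (ℤ × ℕ)) {A : Set (ℕ → ℝ × ℝ × (ℕ → ℝ))} (hA : MeasurableSet A)
    {B : ℤ × ℕ → Set (ℝ≥0 → ℕ → ℝ)} (hB : ∀ p, MeasurableSet (B p)) :
    ∫⁻ z, (countIndexEvent α ε N s A).indicator 1 z *
        ∏ p ∈ s, (B p).indicator 1 (shiftPath α ε z p.1 p.2) ∂realLaw ν =
      ∫⁻ z, (countIndexEvent α ε N s A).indicator 1 z *
        ∏ p ∈ s, revLaw ν α (shiftTime α ε z p.1 p.2) (B p) ∂realLaw ν := by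
  by_cases hs : ∀ p ∈ s, 1 ≤ (N : ℤ) + p.1
  · calc _ = _ := lintegral_countIndexEvent_mul_prod _ N s A fun p z n =>
          (B p).indicator 1 (siblingPath α z n p.2)
      _ = _ := lintegral_prod_sibling ν hα hν s (injOn_level hs) hB
          (measurable_one.indicator (measurableSet_countIndexEvent N s hA))
          fun p hp => siblingInvariant_countIndexEvent hα N A hp
      _ = _ := (lintegral_countIndexEvent_mul_prod _ N s A fun p z n =>
          revLaw ν α (siblingTime α z n p.2) (B p)).symm
  · have eq_empty : countIndexEvent α ε N s A = ∅ :=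
      Set.eq_empty_of_forall_notMem fun z ⟨count_eq, hz⟩ =>
        hs fun p hp => (show spineCount α ε z = N from count_eq) ▸ (hz.2 p hp).2.1
    simp only [eq_empty, Set.indicator_empty, zero_mul]

lemma lintegral_shiftPath (hα : α < 0) (hν : ν {s | (s : ℕ → ℝ) = oneState} = 0)
    (s : Finset (ℤ × ℕ)) {A : Set (ℕ → ℝ × ℝ × (ℕ → ℝ))} (hA : MeasurableSet A)
    {B : ℤ × ℕ → Set (ℝ≥0 → ℕ → ℝ)} (hB : ∀ p, MeasurableSet (B p)) :
    ∫⁻ z, (indexEvent α ε s A).indicator 1 z *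
        ∏ p ∈ s, (B p).indicator 1 (shiftPath α ε z p.1 p.2) ∂realLaw ν =
      ∫⁻ z, (indexEvent α ε s A).indicator 1 z *
        ∏ p ∈ s, revLaw ν α (shiftTime α ε z p.1 p.2) (B p) ∂realLaw ν := by
  have measurableSet_count (N : ℕ) : MeasurableSet {z : Realization | spineCount α ε z = N} :=
    measurable_spineCount ε (measurableSet_singleton N)
  rw [lintegral_eq_tsum_lintegral_fiber measurableSet_count,
    lintegral_eq_tsum_lintegral_fiber measurableSet_count]
  refine tsum_congr fun N => ?_
  have eq_of_count := lintegral_shiftPath_of_count (ε := ε) ν hα hν N s hA hB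
  simpa only [countIndexEvent, Set.inter_indicator_one, Pi.mul_apply, mul_assoc] using eq_of_count

lemma measure_shiftPath (hα : α < 0) (hν : ν {s | (s : ℕ → ℝ) = oneState} = 0)
    (s : Finset (ℤ × ℕ)) {A : Set (ℕ → ℝ × ℝ × (ℕ → ℝ))} (hA : MeasurableSet A)
    {B : ℤ × ℕ → Set (ℝ≥0 → ℕ → ℝ)} (hB : ∀ p, MeasurableSet (B p)) :
    realLaw ν (indexEvent α ε s A ∩ {x | ∀ p ∈ s, shiftPath α ε x p.1 p.2 ∈ B p}) =
      ∫⁻ x in indexEvent α ε s A, ∏ p ∈ s, revLaw ν α (shiftTime α ε x p.1 p.2) (B p)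
        ∂realLaw ν := by
  have measurableSet_index := measurableSet_indexEvent (α := α) (ε := ε) s hA
  have measurableSet_path := measurableSet_shiftPath_mem (α := α) (ε := ε) s hB
  rw [← lintegral_indicator_one (measurableSet_index.inter measurableSet_path),
    ← lintegral_indicator measurableSet_index]
  refine Eq.trans ?_ ((lintegral_shiftPath (ε := ε) ν hα hν s hA hB).trans ?_)
  · refine lintegral_congr fun z => ?_
    by_cases hz : z ∈ indexEvent α ε s A
    · by_cases hzB : ∀ p ∈ s, shiftPath α ε z p.1 p.2 ∈ B p
      · rw [Set.indicator_of_mem (by exact ⟨hz, hzB⟩), Set.indicator_of_mem hz,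
          Finset.prod_congr rfl fun p hp => Set.indicator_of_mem (hzB p hp) _]
        simp
      · rw [Set.indicator_of_notMem fun hmem => hzB hmem.2]
        push Not at hzB
        obtain ⟨p, hp, hpB⟩ := hzB
        rw [Finset.prod_eq_zero hp (Set.indicator_of_notMem hpB _), mul_zero]
    · rw [Set.indicator_of_notMem hz, Set.indicator_of_notMem fun hmem => hz hmem.1, zero_mul]
  · refine lintegral_congr fun z => ?_
    by_cases hz : z ∈ indexEvent α ε s A
    · rw [Set.indicator_of_mem hz, Set.indicator_of_mem hz, Pi.one_apply, one_mul]
    · rw [Set.indicator_of_notMem hz, Set.indicator_of_notMem hz, zero_mul]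

variable {Ω : Type*} [MeasurableSpace Ω] {P : Measure Ω} {X : Ω → Realization}

lemma condRevLaw_eq (hα : α < 0) (hν : ν {s | (s : ℕ → ℝ) = oneState} = 0)
    (hX : MeasurePreserving X P (realLaw ν)) (c : ℝ) {B : Set (ℝ≥0 → ℕ → ℝ)}
    (hB : MeasurableSet B) : condRevLaw P X α c B = revLaw ν α c B := by
  have hreg := hX.quasiMeasurePreserving.ae (ae_isRegular ν hα hν)
  have measurableSet_lt_c : MeasurableSet {y : Realization | lifetime α y < c} :=
    measurableSet_lt measurable_lifetime measurable_const
  have measurableSet_mem_B : MeasurableSet {y : Realization | revPath α y c ∈ B} :=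
    measurable_revPath measurable_id measurable_const hB
  have event_ae_eq :
      ({ω | extinction α (X ω) < c} : Set Ω) =ᵐ[P] X ⁻¹' {y | lifetime α y < c} := by
    refine eventuallyEq_set.2 ?_
    filter_upwards [hreg] with ω hω
    change extinction α (X ω) < c ↔ lifetime α (X ω) < c
    rw [hω.extinction_eq]
  have cond_eq : P[|{ω | extinction α (X ω) < c}] = P[|X ⁻¹' {y | lifetime α y < c}] := by
    rw [ProbabilityTheory.cond, ProbabilityTheory.cond, measure_congr event_ae_eq,
      Measure.restrict_congr_set event_ae_eq]
  rw [condRevLaw, cond_eq, cond_apply (hX.measurable measurableSet_lt_c), revLaw,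
    hX.measure_preimage measurableSet_lt_c.nullMeasurableSet,
    ← hX.measure_preimage (measurableSet_lt_c.inter measurableSet_mem_B).nullMeasurableSet]
  rfl

lemma chain_isIndex_ae_eq (hα : α < 0) (hε : 0 < ε) (hX : ∀ᵐ ω ∂P, IsRegular α (X ω))
    (s : Finset (ℤ × ℕ)) (A : Set (ℕ → ℝ × ℝ × (ℕ → ℝ))) :
    ({ω | chain α (X ω) ∈ A ∧ ∀ p ∈ s, IsIndex α (X ω) ε p.1 p.2} : Set Ω) =ᵐ[P]
      X ⁻¹' indexEvent α ε s A := by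
  refine eventuallyEq_set.2 ?_
  filter_upwards [hX] with ω hω
  change (chain α (X ω) ∈ A ∧ _) ↔ (spineChain α (X ω) ∈ A ∧ _)
  simp only [hω.chain_eq hα, hω.isIndex_iff hα hε]

lemma chain_isIndex_shiftPath_ae_eq (hα : α < 0) (hε : 0 < ε) (hX : ∀ᵐ ω ∂P, IsRegular α (X ω))
    (s : Finset (ℤ × ℕ)) (A : Set (ℕ → ℝ × ℝ × (ℕ → ℝ))) (B : ℤ × ℕ → Set (ℝ≥0 → ℕ → ℝ)) :
    ({ω | chain α (X ω) ∈ A ∧ ∀ p ∈ s, IsIndex α (X ω) ε p.1 p.2 ∧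
        shiftPath α ε (X ω) p.1 p.2 ∈ B p} : Set Ω) =ᵐ[P]
      X ⁻¹' (indexEvent α ε s A ∩ {x | ∀ p ∈ s, shiftPath α ε x p.1 p.2 ∈ B p}) := by
  refine eventuallyEq_set.2 ?_
  filter_upwards [hX] with ω hω
  change (chain α (X ω) ∈ A ∧ _) ↔ ((spineChain α (X ω) ∈ A ∧ _) ∧ _)
  simp only [hω.chain_eq hα, hω.isIndex_iff hα hε, and_assoc]
  exact and_congr_right fun _ => forall₂_and

lemma isCondIndepRevFrag_shiftPath (hα : α < 0) (hν : ν {s | (s : ℕ → ℝ) = oneState} = 0)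
    (hX : MeasurePreserving X P (realLaw ν)) (hε : 0 < ε) :
    IsCondIndepRevFrag P X α ε fun i m ω => shiftPath α ε (X ω) i m := by
  have hreg := hX.quasiMeasurePreserving.ae (ae_isRegular ν hα hν)
  refine ⟨fun i m => (measurable_shiftPath i m).comp hX.measurable, ?_, fun s A B hA hB => ?_⟩
  · filter_upwards [hreg] with ω hω i m hi
    rw [hω.isIndex_iff hα hε] at hi
    rw [hω.condTime_eq hα hε hi]
    exact hω.isRevPath_shiftPath hα hi
  · have measurableSet_index := measurableSet_indexEvent (α := α) (ε := ε) s hA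
    have measurableSet_path := measurableSet_shiftPath_mem (α := α) (ε := ε) s hB
    have measurable_laws : Measurable fun x : Realization =>
        ∏ p ∈ s, revLaw ν α (shiftTime α ε x p.1 p.2) (B p) :=
      Finset.measurable_prod s fun p _ =>
        (measurable_revLaw ν (hB p)).comp (measurable_shiftTime p.1 p.2)
    rw [measure_congr (chain_isIndex_shiftPath_ae_eq hα hε hreg s A B),
      hX.measure_preimage (measurableSet_index.inter measurableSet_path).nullMeasurableSet,
      measure_shiftPath ν hα hν s hA hB,
      Measure.restrict_congr_set (chain_isIndex_ae_eq hα hε hreg s A),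
      ← hX.setLIntegral_comp_preimage measurableSet_index measurable_laws]
    refine setLIntegral_congr_fun_ae (hX.measurable measurableSet_index) ?_
    filter_upwards [hreg] with ω hω hωE
    refine Finset.prod_congr rfl fun p hp => ?_
    rw [condRevLaw_eq ν hα hν hX _ (hB p), hω.condTime_eq hα hε (hωE.2 p hp)]
    rfl

end Law

end Recentering

/-! ### The decomposition of the state along the spine -/

section SpineDecomposition

variable {α ε t : ℝ} {x : Realization}

lemma exists_append_siblingLabel_eq {n : ℕ} {u : List ℕ} (not_above : ¬ spine α x n <:+ u)
    (not_below : ¬ u <:+ spine α x n) : ∃ j < n, ∃ m w, w ++ siblingLabel α x j m = u := by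
  induction n with
  | zero => exact absurd List.nil_suffix not_above
  | succ n ih =>
    by_cases h : spine α x n <:+ u
    · obtain ⟨w, rfl⟩ := h
      rcases w.eq_nil_or_concat with rfl | ⟨w, i, rfl⟩
      · exact absurd (spine_suffix α x n.le_succ) not_below
      · have hi : i ≠ lastChild α (subtree (spine α x n) x) := by
          rintro rfl
          exact not_above ⟨w, by simp [spine]⟩
        obtain ⟨m, hm⟩ := exists_siblingIndex hi
        exact ⟨n, n.lt_succ_self, m, w, by simp [siblingLabel, hm]⟩
    · obtain ⟨j, hj, hjw⟩ := ih h fun hu => not_below (hu.trans (spine_suffix α x n.le_succ))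
      exact ⟨j, hj.trans n.lt_succ_self, hjw⟩

lemma append_siblingLabel_injective {n m n' m' : ℕ} {w w' : List ℕ}
    (h : w ++ siblingLabel α x n m = w' ++ siblingLabel α x n' m') : n = n' ∧ m = m' ∧ w = w' := by
  have index_eq : (n, m) = (n', m') := by
    by_contra hne
    rcases List.suffix_or_suffix_of_suffix (List.suffix_append w _)
      (h ▸ List.suffix_append w' (siblingLabel α x n' m')) with hsuffix | hsuffix
    · exact not_siblingLabel_suffix_siblingLabel hne hsuffix
    · exact not_siblingLabel_suffix_siblingLabel (Ne.symm hne) hsuffix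
  obtain ⟨rfl, rfl⟩ := Prod.mk.inj index_eq
  exact ⟨rfl, rfl, List.append_cancel_right h⟩

/-- The label of the spine at generation `n`, or the label of the descendant `w` of the `m`-th
sibling of the spine at level `level i`. -/
def branchLabel (α : ℝ) (x : Realization) (n : ℕ) {ι : Type*} (level : ι → ℕ) :
    Unit ⊕ (ι × ℕ × List ℕ) → List ℕ
  | .inl _ => spine α x n
  | .inr (i, m, w) => w ++ siblingLabel α x (level i) m

lemma branchLabel_injective {n : ℕ} {ι : Type*} {level : ι → ℕ}
    (hlevel : Function.Injective level) : Function.Injective (branchLabel α x n level) := by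
  rintro (a | ⟨i, m, w⟩) (b | ⟨i', m', w'⟩) hab
  · rfl
  · exact absurd ⟨w', hab.symm⟩ (not_siblingLabel_suffix_spine _ _ _)
  · exact absurd ⟨w, hab⟩ (not_siblingLabel_suffix_spine _ _ _)
  · obtain ⟨hi, rfl, rfl⟩ := append_siblingLabel_injective hab
    rw [hlevel hi]

lemma ClockPos.exists_branchLabel_eq (hc : ClockPos x) {n : ℕ} {ι : Type*} {level : ι → ℕ}
    (hlevel : ∀ j < n, ∃ i, level i = j) (hspine : Alive α x t (spine α x n)) {u : List ℕ}
    (hu : Alive α x t u) : ∃ q, branchLabel α x n level q = u := by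
  by_cases hus : u = spine α x n
  · exact ⟨.inl (), hus.symm⟩
  · obtain ⟨j, hj, m, w, hw⟩ := exists_append_siblingLabel_eq
      (fun h => hus (hspine.eq_of_suffix hc hu h).symm)
      (fun h => hus (hu.eq_of_suffix hc hspine h))
    obtain ⟨i, rfl⟩ := hlevel j hj
    exact ⟨.inr (i, m, w), hw⟩

lemma ClockPos.encard_alive_eq_encard_branchLabel (hc : ClockPos x) {n : ℕ} {ι : Type*}
    {level : ι → ℕ} (hinj : Function.Injective level) (hsurj : ∀ j < n, ∃ i, level i = j)
    (hspine : Alive α x t (spine α x n)) (p : List ℕ → Prop) :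
    {u | Alive α x t u ∧ p u}.encard =
      {q | Alive α x t (branchLabel α x n level q) ∧ p (branchLabel α x n level q)}.encard := by
  rw [← (branchLabel_injective (α := α) (x := x) (n := n) hinj).encard_image]
  congr 1
  ext u
  constructor
  · intro hu
    obtain ⟨q, rfl⟩ := hc.exists_branchLabel_eq hsurj hspine hu.1
    exact ⟨q, hu, rfl⟩
  · rintro ⟨q, hq, rfl⟩
    exact hq

lemma encard_alive_append {v : List ℕ} (hv : 0 < mass x v) {y : ℝ} (hy : 0 ≤ y) :
    {w | Alive α x t (w ++ v) ∧ y < mass x (w ++ v)}.encard =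
      {l | y < mass x v *
        frag α (subtree v x) ((t - birth α x v) * mass x v ^ α) l}.encard := by
  simp_rw [alive_append_iff hv, mass_append, ← div_lt_iff₀' hv, frag]
  rw [encard_setOf_lt_decRearr (M := 1) (fun u => mass_le_one _ _) (div_nonneg hy hv.le),
    encard_subtype_and (Alive α (subtree v x) ((t - birth α x v) * mass x v ^ α))
      (fun u => y / mass x v < mass (subtree v x) u)]

lemma siblingPath_eq_frag {n m : ℕ} (hv : 0 < mass x (siblingLabel α x n m))
    (ht : spineTime α x (n + 1) ≤ t) (htl : t ≤ lifetime α x) :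
    siblingPath α x n m ((lifetime α x - t) * mass x (siblingLabel α x n m) ^ α).toNNReal =
      frag α (subtree (siblingLabel α x n m) x)
        ((t - birth α x (siblingLabel α x n m)) * mass x (siblingLabel α x n m) ^ α) := by
  have hpow : 0 < mass x (siblingLabel α x n m) ^ α := Real.rpow_pos_of_pos hv _
  have coe_eq := Real.coe_toNNReal _ (mul_nonneg (sub_nonneg.2 htl) hpow.le)
  have le_siblingTime :
      (lifetime α x - t) * mass x (siblingLabel α x n m) ^ α ≤ siblingTime α x n m := by
    rw [siblingTime, mul_comm]
    exact mul_le_mul_of_nonneg_left (by linarith) hpow.le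
  rw [siblingPath, revPath, coe_eq, if_pos le_siblingTime, siblingTime, birth_siblingLabel]
  congr 1
  ring

lemma encard_alive_append_siblingLabel {n m : ℕ} (ht : spineTime α x (n + 1) ≤ t)
    (htl : t ≤ lifetime α x) {y : ℝ} (hy : 0 ≤ y) :
    {w | Alive α x t (w ++ siblingLabel α x n m) ∧ y < mass x (w ++ siblingLabel α x n m)}.encard =
      {l | y < mass x (siblingLabel α x n m) * siblingPath α x n m
        ((lifetime α x - t) * mass x (siblingLabel α x n m) ^ α).toNNReal l}.encard := by
  rcases (mass_nonneg x (siblingLabel α x n m)).eq_or_lt with h0 | hpos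
  · rw [Set.encard_eq_zero.2, Set.encard_eq_zero.2]
    · exact Set.eq_empty_of_forall_notMem fun l hl =>
        (show y < _ from hl).not_ge (by rwa [← h0, zero_mul])
    · exact Set.eq_empty_of_forall_notMem fun w hw =>
        (mass_pos_of_suffix (List.suffix_append w _) hw.1.1).ne h0
  · rw [encard_alive_append hpos hy, siblingPath_eq_frag hpos ht htl]

lemma IsRegular.prodΘ_eq (hα : α < 0) (h : IsRegular α x) {k : ℤ} {n : ℕ}
    (hn : NepsInt α x ε + k = n) : prodΘ α x ε k = mass x (spine α x n) := by
  rw [prodΘ, ← h.prod_chainΘ hα, show (NepsInt α x ε + k + 1).toNat = n + 1 by omega]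

lemma IsRegular.Reps_eq (hα : α < 0) (h : IsRegular α x) {k : ℤ} {n : ℕ}
    (hn : NepsInt α x ε + k = n) : Reps α x ε k = ε⁻¹ * (lifetime α x - spineTime α x n) := by
  rw [Reps, ← h.prod_chainY hα, show (NepsInt α x ε + k + 1).toNat = n + 1 by omega]

lemma IsRegular.le_Reps_iff (hα : α < 0) (h : IsRegular α x) (hε : 0 < ε) {k : ℤ} {n : ℕ}
    (hn : NepsInt α x ε + k = n) :
    t ≤ Reps α x ε k ↔ spineTime α x n ≤ lifetime α x - ε * t := by
  rw [h.Reps_eq hα hn, le_inv_mul_iff₀ hε]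
  constructor <;> intro h <;> linarith

lemma IsRegular.existsUnique_Reps (hα : α < 0) (h : IsRegular α x) (hε : 0 < ε) (h0 : 0 < t)
    (ht : t ≤ lifetime α x / ε) : ∃! k : ℤ, -NepsInt α x ε ≤ k ∧ t ≤ Reps α x ε k ∧
      Reps α x ε (k + 1) < t := by
  have ht' : ε * t ≤ lifetime α x := by rwa [le_div_iff₀' hε] at ht
  have hpos : 0 < ε * t := mul_pos hε h0
  obtain ⟨n, hn⟩ := h.exists_spineTime hα (t := lifetime α x - ε * t) (by linarith) (by linarith)
  refine ⟨n - NepsInt α x ε, ⟨by omega, ?_, ?_⟩, ?_⟩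
  · exact (h.le_Reps_iff hα hε (n := n) (by ring)).2 hn.1
  · rw [← not_le, h.le_Reps_iff hα hε (n := n + 1) (by push_cast; ring)]
    exact not_le.2 hn.2
  · rintro k ⟨hk0, hk1, hk2⟩
    obtain ⟨n', hn'⟩ := Int.eq_ofNat_of_zero_le (show 0 ≤ NepsInt α x ε + k by omega)
    rw [h.le_Reps_iff hα hε hn'] at hk1
    rw [← not_le, h.le_Reps_iff hα hε (n := n' + 1) (by push_cast; omega), not_le] at hk2
    have := h.spineTime_unique hα hn ⟨hk1, hk2⟩
    omega

lemma IsRegular.prodΘ_mul_shiftΔ (hα : α < 0) (h : IsRegular α x) (hε : 0 < ε)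
    (hl : ε ≤ lifetime α x) {i : ℤ} (hi : 1 ≤ (spineCount α ε x : ℤ) + i) (m : ℕ) :
    prodΘ α x ε (i - 1) * shiftΔ α x ε i m =
      mass x (siblingLabel α x (siblingLevel α ε x i) m) := by
  have hN := h.NepsInt_eq hα hε hl
  rw [h.prodΘ_eq hα (n := siblingLevel α ε x i) (by rw [hN, siblingLevel]; omega),
    h.shiftΔ_eq hα hε hl hi, mul_div_cancel₀ _ (h.mass_spine_pos hα _).ne']

lemma IsRegular.prodΘ_rpow_mul_shiftΔ_rpow (hα : α < 0) (h : IsRegular α x) (hε : 0 < ε)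
    (hl : ε ≤ lifetime α x) {i : ℤ} (hi : 1 ≤ (spineCount α ε x : ℤ) + i) (m : ℕ) :
    prodΘ α x ε (i - 1) ^ α * shiftΔ α x ε i m ^ α =
      mass x (siblingLabel α x (siblingLevel α ε x i) m) ^ α := by
  have hN := h.NepsInt_eq hα hε hl
  rw [← h.prodΘ_mul_shiftΔ hα hε hl hi, Real.mul_rpow]
  · rw [h.prodΘ_eq hα (n := siblingLevel α ε x i) (by rw [hN, siblingLevel]; omega)]
    exact mass_nonneg _ _
  · rw [h.shiftΔ_eq hα hε hl hi]
    exact div_nonneg (mass_nonneg _ _) (mass_nonneg _ _)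

lemma IsRegular.spineMasses_inr (hα : α < 0) (h : IsRegular α x) (hε : 0 < ε)
    (hl : ε ≤ lifetime α x) {k : ℤ} (i : {i : ℤ // -NepsInt α x ε + 1 ≤ i ∧ i ≤ k}) (m l : ℕ) :
    spineMasses α x ε (fun i m => shiftPath α ε x i m) t k (.inr (i, m, l)) =
      mass x (siblingLabel α x (siblingLevel α ε x i) m) *
        siblingPath α x (siblingLevel α ε x i) m
          (t * ε * mass x (siblingLabel α x (siblingLevel α ε x i) m) ^ α).toNNReal l := by
  have hi : 1 ≤ (spineCount α ε x : ℤ) + i := by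
    have := i.2.1
    have := h.NepsInt_eq hα hε hl
    omega
  rw [spineMasses, mul_assoc (t * ε), h.prodΘ_mul_shiftΔ hα hε hl hi,
    h.prodΘ_rpow_mul_shiftΔ_rpow hα hε hl hi, shiftPath]

lemma IsRegular.frag_eq_decRearr_spineMasses (hα : α < 0) (h : IsRegular α x) (hε : 0 < ε)
    (hl : ε ≤ lifetime α x) (h0 : 0 < t) {k : ℤ} (hk : -NepsInt α x ε ≤ k)
    (hle : t ≤ Reps α x ε k) (hlt : Reps α x ε (k + 1) < t) :
    frag α x (lifetime α x - ε * t) =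
      decRearr (spineMasses α x ε (fun i m => shiftPath α ε x i m) t k) := by
  obtain ⟨n, hn⟩ := Int.eq_ofNat_of_zero_le (show 0 ≤ NepsInt α x ε + k by omega)
  have hpos : 0 < ε * t := mul_pos hε h0
  rw [h.le_Reps_iff hα hε hn] at hle
  rw [← not_le, h.le_Reps_iff hα hε (n := n + 1) (by push_cast; omega), not_le] at hlt
  have spine_alive := (h.alive_spine_iff hα).2 ⟨hle, hlt⟩
  have NepsInt_eq := h.NepsInt_eq hα hε hl
  let level : {i : ℤ // -NepsInt α x ε + 1 ≤ i ∧ i ≤ k} → ℕ := fun i => siblingLevel α ε x i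
  have level_injective : Function.Injective level := by
    rintro ⟨i, hi⟩ ⟨j, hj⟩ hij
    simp only [level, siblingLevel] at hij
    exact Subtype.ext (show i = j by omega)
  have level_surjective : ∀ j < n, ∃ i, level i = j := fun j hj =>
    ⟨⟨j + 1 - NepsInt α x ε, by omega, by omega⟩, by simp only [level, siblingLevel]; omega⟩
  have level_lt : ∀ i, level i + 1 ≤ n := by
    rintro ⟨i, hi⟩
    simp only [level, siblingLevel]
    omega
  refine decRearr_congr fun y hy => ?_
  rw [encard_subtype_and (Alive α x _) (fun u => y < mass x u),
    h.clockPos.encard_alive_eq_encard_branchLabel level_injective level_surjective spine_alive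
      (fun u => y < mass x u), encard_setOf_sum, encard_setOf_sum]
  congr 1
  · simp only [branchLabel, spineMasses, spine_alive, true_and, h.prodΘ_eq hα hn]
  · refine encard_setOf_prod_congr fun i => encard_setOf_prod_congr fun m => ?_
    simp_rw [h.spineMasses_inr hα hε hl i m]
    have born : spineTime α x (level i + 1) ≤ lifetime α x - ε * t :=
      ((h.strictMono_spineTime hα).monotone (level_lt i)).trans hle
    rw [show t * ε = lifetime α x - (lifetime α x - ε * t) by ring]
    exact encard_alive_append_siblingLabel born (by linarith) hy

end SpineDecomposition

end Fragmentation

end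

theorem mainTheorem6 (α : ℝ) (hα : α < 0)
    (ν : MeasureTheory.Measure Fragmentation.UnitMassSeq) [MeasureTheory.IsProbabilityMeasure ν]
    (hν : ν {s | (s : ℕ → ℝ) = Fragmentation.oneState} = 0)
    {Ω : Type*} [MeasurableSpace Ω] (P : MeasureTheory.Measure Ω)
    [MeasureTheory.IsProbabilityMeasure P]
    (X : Ω → Fragmentation.Realization)
    (hX : ∀ u, Measurable fun ω => X ω u)
    (hindep : ProbabilityTheory.iIndepFun (fun u ω => X ω u) P)
    (hlaw : ∀ u, P.map (fun ω => X ω u) = (ProbabilityTheory.expMeasure 1).prod ν)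
    (ε : ℝ) (hε : 0 < ε) :
    AEMeasurable (fun ω => Fragmentation.chain α (X ω)) P ∧
    (∀ᵐ ω ∂P,
      (Fragmentation.Neps α (X ω) ε ≠ ⊥ ↔ ε ≤ Fragmentation.extinction α (X ω)) ∧
      Fragmentation.Neps α (X ω) ε ≠ ((⊤ : ℕ∞) : WithBot ℕ∞)) ∧
    ∃ G : ℤ → ℕ → Ω → NNReal → ℕ → ℝ,
      Fragmentation.IsCondIndepRevFrag P X α ε G ∧
      ∀ᵐ ω ∂P, ε ≤ Fragmentation.extinction α (X ω) →
        ∀ t : ℝ, 0 < t → t ≤ Fragmentation.extinction α (X ω) / ε →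
          (∃! k : ℤ, -Fragmentation.NepsInt α (X ω) ε ≤ k ∧
            t ≤ Fragmentation.Reps α (X ω) ε k ∧ Fragmentation.Reps α (X ω) ε (k + 1) < t) ∧
          ∀ k : ℤ, -Fragmentation.NepsInt α (X ω) ε ≤ k →
            t ≤ Fragmentation.Reps α (X ω) ε k → Fragmentation.Reps α (X ω) ε (k + 1) < t →
            Fragmentation.frag α (X ω) (Fragmentation.extinction α (X ω) - ε * t) =
              Fragmentation.decRearr
                (Fragmentation.spineMasses α (X ω) ε (fun i m => G i m ω) t k) := by
  have hX_law := Fragmentation.measurePreserving_realLaw ν hX hindep hlaw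
  have hreg := hX_law.quasiMeasurePreserving.ae (Fragmentation.ae_isRegular ν hα hν)
  refine ⟨⟨fun ω => Fragmentation.spineChain α (X ω),
      Fragmentation.measurable_spineChain.comp hX_law.measurable, ?_⟩, ?_,
    fun i m ω => Fragmentation.shiftPath α ε (X ω) i m,
    Fragmentation.isCondIndepRevFrag_shiftPath ν hα hν hX_law hε, ?_⟩
  · filter_upwards [hreg] with ω hω using hω.chain_eq hα
  · filter_upwards [hreg] with ω hω
    exact ⟨by rw [hω.extinction_eq, hω.Neps_ne_bot_iff hα hε], hω.Neps_ne_top hα hε⟩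
  · filter_upwards [hreg] with ω hω hl t ht_pos ht
    rw [hω.extinction_eq] at hl ht ⊢
    exact ⟨hω.existsUnique_Reps hα hε ht_pos ht, fun k hk hle hlt =>
      hω.frag_eq_decRearr_spineMasses hα hε hl ht_pos hk hle hlt⟩
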